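/- **Model.** Let $L,\tau,\gamma,v_f,\rho_m>0$ and let $0<v^*<\frac{\gamma}{\gamma+1}v_f$ (congested regime). Put $q^*=\rho_m v^*\left(\frac{v_f-v^*}{v_f}\right)^{1/\gamma}$, $p^*=v_f\left(\frac{q^*}{\rho_m v^*}\right)^{\gamma}$, $\lambda=\gamma p^*-v^*>0$, $\mu=v^*/\lambda$, $k_1=\lambda/v^*$, $k_2=e^{-L/(\tau v^*)}$, $c(x)=-\frac1\tau e^{-x/(\tau v^*)}$. The Aw–Rascle–Zhang (ARZ) traffic model on $(0,L)$ in the variables flow rate and velocity, linearized at $(q^*,v^*)$, is $$\partial_t\tilde q+v^*\partial_x\tilde q=\tfrac{q^*\lambda}{v^*}\partial_x\tilde v+\tfrac{q^*}{\tau}\tfrac{\gamma p^*}{v^*}\Big(\tfrac1{v^*}-\tfrac1{\gamma p^*}\Big)\tilde v-\tfrac{\gamma p^*}{\tau v^*}\tilde q,\qquad \partial_t\tilde v-\lambda\partial_x\tilde v=\tfrac{\lambda}{\tau v^*}\tilde v-\tfrac{\gamma p^*}{\tau q^*}\tilde q .$$ Use the Riemann coordinates $w=e^{x/(\tau v^*)}\big(\tilde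 q-q^*(\frac1{v^*}-\frac1{\gamma p^*})\tilde v\big)$, $v=\frac{q^*}{\gamma p^*}\tilde v$. Let $a\in C([0,L])$ be the gain of the app routing. The controlled system is $$\partial_t w=-v^*\partial_x w,\quad \partial_t v=\lambda\,\partial_x v+c(x)w,\quad w(0,t)=k_1v(0,t)+\int_0^L a(y)w(y,t)\,dy,\quad v(L,t)=k_2w(L,t)+U(t).$$ **Controller.** Let $k,l$ be continuous on $\{0\le y\le x\le L\}$ and $m$ continuous on $\{0\le x\le y\le L\}$ with $$k_x+k_y=0,\qquad \lambda l_x-v^*l_y=c(y)k+v^*l(x,0)a(y),\qquad \lambda m_x-v^*m_y=v^*l(x,0)a(y)$$ in the interiors (derivatives along the characteristic directions), and $k(x,0)=\frac{k_1v^*}{\lambda}l(x,0)$, $l(x,x)=m(x,x)-\frac{c(x)}{\gamma p^*}$, $m(x,L)=0$, $m(0,y)=0$. Let $\check a(x)=v^*a(\mu x)$ for $0\le x\le L/\mu$, $\check a(x)=0$ otherwise, and let $n\in L^2(0,L)$ satisfy $n(x)=-\frac1\lambda\big[\check a(x)-\int_0^x\check a(y)n(x-y)\,dy\big]$ for a.e.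 $x\in(0,L)$. With $$F_v(y)=k(L,y)+n(L-y)-\int_y^L n(L-\xi)k(\xi,y)\,d\xi,$$ $$F_w(y)=l(L,y)+\int_0^{\min\{L,(L-y)/\mu\}}k_1^{-1}n(L-\xi)a(y+\mu\xi)\,d\xi-\int_y^L n(L-\xi)l(\xi,y)\,d\xi-\int_0^y n(L-\xi)m(\xi,y)\,d\xi,$$ the ramp-metering feedback is $$U(t)=\alpha(t)-k_2w(L,t)+\int_0^LF_v(y)v(y,t)\,dy+\int_0^LF_w(y)w(y,t)\,dy-\int_{\min\{\mu L,L\}}^{L}k_1^{-1}a(y)w(y-\mu L,t)\,dy,$$ where $\dot\alpha=-k_3\alpha$ with a chosen $k_3>0$, and $\alpha(0)$ is the value for which the boundary condition at $x=L$ holds at $t=0$. A closed-loop solution on $[0,T)$, $0<T\le\infty$, is a pair $(v,w)$ that is a continuous curve in $H^1(0,L)^2$, is differentiable in time with values in $L^2(0,L)^2$ and satisfies the two equations in $L^2$, together with an $\alpha$ such that the boundary conditions, the feedback law and $\dot\alpha=-k_3\alpha$ hold for all $t\in[0,T)$. Write $\|(v,w)\|_{H^1}^2=\int_0^L(v^2+v_x^2+w^2+w_x^2)\,dx$.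 **Theorem.** The $(v,w)$-equations are equivalent to the linearized ARZ equations for $(\tilde q,\tilde v)$ under the above change of variables (for solutions in the same sense). Kernels $k,l,m,n$ as above exist, and for any such kernels there are $M>0$ and $\omega>0$ such that: 1. (Exponential stability in $H^1$.) Every closed-loop solution on any $[0,T)$, $0<T\le\infty$, with initial data $(v_0,w_0)$ satisfies $$\|(v,w)(\cdot,t)\|_{H^1}\le M e^{-\omega t}\|(v_0,w_0)\|_{H^1}\qquad(0\le t<T).$$ 2. (Global existence in the admissible set.) For every $\varepsilon>0$ and all $v_0,w_0\in H^1(0,L)$ that satisfy $w_0(0)=k_1v_0(0)+\int_0^La(y)w_0(y)\,dy$ and $\|(v_0,w_0)\|_{H^1}<M^{-1}\varepsilon$, there is a closed-loop solution on $[0,\infty)$ with these initial data such that for all $t\ge0$ we have $\|(v,w)(\cdot,t)\|_{H^1}<\varepsilon$ and $|v(x,t)|<\varepsilon$, $|w(x,t)|<\varepsilon$ for all $x\in[0,L]$. Moreover, let $\varepsilon_0=\min\{\rho_mv^*-q^*,\,q^*,\,v_f-v^*,\,v^*\}$. If $\varepsilon\le\varepsilon_0\big/\big(1+k_1+(1+\rho_m)\frac{\gamma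 p^*}{q^*}\big)$, then $|\tilde v|<\varepsilon_0$, $|\tilde q|<\varepsilon_0$, and $\bar v=v^*+\tilde v$, $\bar q=q^*+\tilde q$ satisfy $0<\bar v<v_f$ and $0<\bar q<\rho_m\bar v$ for all $x\in[0,L]$ and $t\ge0$. -/

import Mathlib

open MeasureTheory Set Filter Topology

noncomputable section

/-! ### Functions on the road segment `[0, L]` -/

/-- `f ∈ H¹(0, L)`, for the continuous representative: `f` is absolutely continuous on `[0, L]` and
its (almost everywhere defined) derivative is square integrable. -/
def IsH1 (L : ℝ) (f : ℝ → ℝ) : Prop :=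
  AbsolutelyContinuousOnInterval f 0 L ∧ MemLp (deriv f) 2 (volume.restrict (Ioo 0 L))

/-- The norm of a pair in `H¹(0, L) × H¹(0, L)`. -/
def h1Norm (L : ℝ) (f g : ℝ → ℝ) : ℝ :=
  Real.sqrt ((∫ x in (0 : ℝ)..L, (f x ^ 2 + deriv f x ^ 2)) +
    ∫ x in (0 : ℝ)..L, (g x ^ 2 + deriv g x ^ 2))

/-- The time interval `[0, T)`, with `T = ⊤` allowed. -/
def timeInterval (T : EReal) : Set ℝ := {t : ℝ | 0 ≤ t ∧ (t : EReal) < T}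

/-- `f` (written `f t x`) is an `H¹` solution of `∂ₜ f = F` on `[0, T)`: it is a continuous curve in
`H¹(0, L)`, and at every time it is differentiable in `L²(0, L)` with derivative `F t`. -/
structure IsEvolution (L : ℝ) (T : EReal) (f F : ℝ → ℝ → ℝ) : Prop where
  mem : ∀ t ∈ timeInterval T, IsH1 L (f t)
  continuous : ∀ t ∈ timeInterval T,
    Tendsto (fun s => h1Norm L (fun x => f s x - f t x) 0) (𝓝[timeInterval T] t) (𝓝 0)
  deriv_eq : ∀ t ∈ timeInterval T,
    Tendsto (fun s => eLpNorm (fun x => (s - t)⁻¹ * (f s x - f t x) - F t x) 2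
      (volume.restrict (Ioo 0 L))) (𝓝[timeInterval T \ {t}] t) (𝓝 0)

/-! ### The traffic model -/

/-- Parameters of the Aw–Rascle–Zhang model on `[0, L]` with traffic pressure
`p(ρ) = v_f (ρ / ρ_m) ^ γ`, together with an equilibrium velocity `v*` in the congested regime. -/
structure Traffic where
  /-- length of the road -/
  L : ℝ
  /-- relaxation time -/
  τ : ℝ
  /-- driver aggressiveness -/
  γ : ℝ
  /-- free-flow velocity -/
  vf : ℝ
  /-- maximal density -/
  ρm : ℝ
  /-- equilibrium velocity -/
  vs : ℝ
  L_pos : 0 < L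
  τ_pos : 0 < τ
  γ_pos : 0 < γ
  vf_pos : 0 < vf
  ρm_pos : 0 < ρm
  vs_pos : 0 < vs
  congested : vs < γ / (γ + 1) * vf

namespace Traffic

variable (P : Traffic)

/-- Equilibrium flow rate `q*`. -/
def qs : ℝ := P.ρm * P.vs * ((P.vf - P.vs) / P.vf) ^ (1 / P.γ)

/-- Equilibrium pressure `p*`, the pressure at the density `q* / v*`. -/
def ps : ℝ := P.vf * (P.qs / P.vs / P.ρm) ^ P.γ

/-- The speed `γ p* - v*` of the upstream characteristic. -/
def lam : ℝ := P.γ * P.ps - P.vs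

/-- The ratio `μ* = v* / (γ p* - v*)`. -/
def mu : ℝ := P.vs / P.lam

/-- In-domain coupling `c(x)`. -/
def c (x : ℝ) : ℝ := -(1 / P.τ) * Real.exp (-(x / (P.τ * P.vs)))

/-- Inlet reflection coefficient. -/
def k1 : ℝ := P.lam / P.vs

/-- Outlet reflection coefficient. -/
def k2 : ℝ := Real.exp (-(P.L / (P.τ * P.vs)))

/-- The system in Riemann coordinates on `[0, T)`:
`∂ₜ w = -v* ∂ₓ w`, `∂ₜ v = (γ p* - v*) ∂ₓ v + c(x) w`. -/
def RiemannSystem (T : EReal) (v w : ℝ → ℝ → ℝ) : Prop :=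
  IsEvolution P.L T w (fun t x => -P.vs * deriv (w t) x) ∧
  IsEvolution P.L T v (fun t x => P.lam * deriv (v t) x + P.c x * w t x)

/-- The velocity perturbation `ṽ` that has Riemann coordinate `v = q* / (γ p*) ṽ`. -/
def velPert (v : ℝ → ℝ) (x : ℝ) : ℝ := P.γ * P.ps / P.qs * v x

/-- The flow rate perturbation `q̃` that has Riemann coordinates `v` and
`w = exp (x / (τ v*)) (q̃ - q* (1 / v* - 1 / (γ p*)) ṽ)`. -/
def flowPert (v w : ℝ → ℝ) (x : ℝ) : ℝ :=
  Real.exp (-(x / (P.τ * P.vs))) * w x +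
    P.qs * (1 / P.vs - 1 / (P.γ * P.ps)) * P.velPert v x

/-- The Aw–Rascle–Zhang model in the variables (flow rate, velocity), linearized at `(q*, v*)`,
on `[0, T)`. -/
def LinearizedARZ (T : EReal) (q v : ℝ → ℝ → ℝ) : Prop :=
  IsEvolution P.L T q (fun t x =>
    -P.vs * deriv (q t) x + P.qs * P.lam / P.vs * deriv (v t) x
      + P.qs / P.τ * (P.γ * P.ps / P.vs) * (1 / P.vs - 1 / (P.γ * P.ps)) * v t x
      - P.γ * P.ps / (P.τ * P.vs) * q t x) ∧
  IsEvolution P.L T v (fun t x =>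
    P.lam * deriv (v t) x + P.lam / (P.τ * P.vs) * v t x
      - P.γ * P.ps / (P.τ * P.qs) * q t x)

/-! ### The feedback law -/

/-- Data `k, l, m, n` of a controller; see `IsKernels`. -/
structure Kernels where
  k : ℝ → ℝ → ℝ
  l : ℝ → ℝ → ℝ
  m : ℝ → ℝ → ℝ
  n : ℝ → ℝ

/-- The coefficient `ǎ` equal to `v* a(μ* x)` on `[0, L / μ*]` and to `0` elsewhere. -/
def aCheck (a : ℝ → ℝ) (x : ℝ) : ℝ :=
  (Icc 0 (P.L / P.mu)).indicator (fun x => P.vs * a (P.mu * x)) x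

/-- `k, l` (on `0 ≤ y ≤ x ≤ L`), `m` (on `0 ≤ x ≤ y ≤ L`) and `n` (on `(0, L)`) solve the kernel
equations
`kₓ + k_y = 0`,
`(γ p* - v*) lₓ - v* l_y = c(y) k + v* l(x, 0) a(y)`,
`(γ p* - v*) mₓ - v* m_y = v* l(x, 0) a(y)`
with their boundary conditions, and
`n(x) = -(γ p* - v*)⁻¹ (ǎ(x) - ∫₀ˣ ǎ(y) n(x - y) dy)`.
Since `a` is only continuous, so are `k, l, m`, and the first-order operators on the left are
derivatives along the characteristic directions `(1, 1)` and `(γ p* - v*, -v*)`. -/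
structure IsKernels (a : ℝ → ℝ) (K : Kernels) : Prop where
  k_cont : ContinuousOn (fun p : ℝ × ℝ => K.k p.1 p.2) {p | 0 ≤ p.2 ∧ p.2 ≤ p.1 ∧ p.1 ≤ P.L}
  l_cont : ContinuousOn (fun p : ℝ × ℝ => K.l p.1 p.2) {p | 0 ≤ p.2 ∧ p.2 ≤ p.1 ∧ p.1 ≤ P.L}
  m_cont : ContinuousOn (fun p : ℝ × ℝ => K.m p.1 p.2) {p | 0 ≤ p.1 ∧ p.1 ≤ p.2 ∧ p.2 ≤ P.L}
  k_pde : ∀ x y, 0 < y → y < x → x < P.L → HasDerivAt (fun s => K.k (x + s) (y + s)) 0 0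
  l_pde : ∀ x y, 0 < y → y < x → x < P.L →
    HasDerivAt (fun s => K.l (x + P.lam * s) (y - P.vs * s))
      (P.c y * K.k x y + P.vs * K.l x 0 * a y) 0
  m_pde : ∀ x y, 0 < x → x < y → y < P.L →
    HasDerivAt (fun s => K.m (x + P.lam * s) (y - P.vs * s)) (P.vs * K.l x 0 * a y) 0
  k_bc : ∀ x ∈ Icc 0 P.L, K.k x 0 = P.k1 * P.vs / P.lam * K.l x 0
  l_bc : ∀ x ∈ Icc 0 P.L, K.l x x = K.m x x - P.c x / (P.γ * P.ps)
  m_bc_right : ∀ x ∈ Icc 0 P.L, K.m x P.L = 0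
  m_bc_left : ∀ y ∈ Icc 0 P.L, K.m 0 y = 0
  n_mem : MemLp K.n 2 (volume.restrict (Ioo 0 P.L))
  n_eq : ∀ᵐ x ∂(volume.restrict (Ioo 0 P.L)),
    K.n x = -P.lam⁻¹ * (P.aCheck a x - ∫ y in (0 : ℝ)..x, P.aCheck a y * K.n (x - y))

/-- Feedback gain acting on `v`. -/
def gainV (K : Kernels) (y : ℝ) : ℝ :=
  K.k P.L y + K.n (P.L - y) - ∫ ξ in y..P.L, K.n (P.L - ξ) * K.k ξ y

/-- Feedback gain acting on `w`. -/
def gainW (a : ℝ → ℝ) (K : Kernels) (y : ℝ) : ℝ :=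
  K.l P.L y
    + (∫ ξ in (0 : ℝ)..(min P.L ((P.L - y) / P.mu)),
        P.k1⁻¹ * K.n (P.L - ξ) * a (y + P.mu * ξ))
    - (∫ ξ in y..P.L, K.n (P.L - ξ) * K.l ξ y)
    - ∫ ξ in (0 : ℝ)..y, K.n (P.L - ξ) * K.m ξ y

/-- The ramp-metering feedback `U_ramp`, as a function of the dynamic extension `α` and of the
current state `(v, w)`. -/
def ramp (a : ℝ → ℝ) (K : Kernels) (α : ℝ) (v w : ℝ → ℝ) : ℝ :=
  α - P.k2 * w P.L + (∫ y in (0 : ℝ)..P.L, P.gainV K y * v y)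
    + (∫ y in (0 : ℝ)..P.L, P.gainW a K y * w y)
    - ∫ y in (min (P.mu * P.L) P.L)..P.L, P.k1⁻¹ * a y * w (y - P.mu * P.L)

/-- The app-routing inlet condition `w(0) = k₁ v(0) + ∫₀ᴸ a w`. -/
def InletCondition (a : ℝ → ℝ) (v w : ℝ → ℝ) : Prop :=
  w 0 = P.k1 * v 0 + ∫ y in (0 : ℝ)..P.L, a y * w y

/-- `(v, w)` is an `H¹` solution on `[0, T)` of the closed loop formed by the system, the routing
condition at `x = 0`, and the ramp-metering feedback at `x = L`, with dynamic extension
`α' = -k₃ α`. The boundary conditions hold at `t = 0` too, so `α 0` is the value that makes the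
initial data compatible at `x = L`. -/
structure IsClosedLoop (a : ℝ → ℝ) (K : Kernels) (k3 : ℝ) (T : EReal)
    (v w : ℝ → ℝ → ℝ) (α : ℝ → ℝ) : Prop where
  system : P.RiemannSystem T v w
  inlet : ∀ t ∈ timeInterval T, P.InletCondition a (v t) (w t)
  outlet : ∀ t ∈ timeInterval T,
    v t P.L = P.k2 * w t P.L + P.ramp a K (α t) (v t) (w t)
  extension : ∀ t ∈ timeInterval T, HasDerivWithinAt α (-k3 * α t) (timeInterval T) t

/-! ### Admissible states -/

/-- The radius `ε₀ = min {q_max - q*, q*, v_f - v*, v*}`, with `q_max = ρ_m v*` at equilibrium. -/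
def eps0 : ℝ := min (min (P.ρm * P.vs - P.qs) P.qs) (min (P.vf - P.vs) P.vs)

/-- A bound on `|v|, |w|` under which `|q̃| + ρ_m |ṽ|` and `|ṽ|` are below `ε₀`. -/
def epsAdm : ℝ := P.eps0 / (1 + P.k1 + (1 + P.ρm) * (P.γ * P.ps / P.qs))

/-- The perturbations are below `ε₀`, and the velocity `v* + ṽ` and the flow rate `q* + q̃` satisfy
the physical constraints `0 < v̄ < v_f` and `0 < q̄ < ρ_m v̄` everywhere on the road. -/
def IsAdmissible (v w : ℝ → ℝ) : Prop :=
  ∀ x ∈ Icc 0 P.L,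
    |P.velPert v x| < P.eps0 ∧ |P.flowPert v w x| < P.eps0 ∧
    0 < P.vs + P.velPert v x ∧ P.vs + P.velPert v x < P.vf ∧
    0 < P.qs + P.flowPert v w x ∧
    P.qs + P.flowPert v w x < P.ρm * (P.vs + P.velPert v x)

end Traffic

end

/-!
# Stabilization of linearized congested traffic by ramp metering and app routing

The change of variables between the linearized model and the Riemann coordinates is linear with
smooth coefficients, so evolutions on either side are combinations of evolutions on the other
(`IsEvolution.comb`, `Traffic.riemannSystem_iff`).

The kernel equations are solved along characteristics: `k` is a function of `x - y`, and `l` and `m`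
are explicit integrals of the single function `g = l(·, 0)`. The boundary conditions then reduce to
the Volterra equation `g = -E + (A + E) * g`, where `*` is convolution on `[0, x]`, the kernel
`A = kerA` comes from the routing gain and `E = kerE` from the in-domain coupling. This gives existence
(`Traffic.exists_isKernels`) and shows that every family of kernels has this form
(`Traffic.IsKernels.exists_formulas`). The equation for `n` says that `1 - n *` inverts `1 - A *`.

The closed loop is solved by one function `H` of one real variable, the history function. The flow
coordinate is transported downstream and the routing condition ties it to `v` at the inlet, so with
the ansatz `w(x, t) = k₁ H(λ t - k₁ x)` both equations and the inlet condition hold if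
`v(x, t) = H(λ t + x) - (memory terms)`, where the memory terms are integrals of past values of `H`
against `A` and `E` (`Traffic.opV`, `Traffic.opW`, `Traffic.history_isEvolution`). In terms of `H` the
feedback law collapses: with the convolution identities for `g` and `n` it reads `H(λ t + L) = α(t)`
(`Traffic.ramp_iff`). Hence the feedback places exactly the values of the dynamic extension, a
multiple of `exp (-k₃ t)`, on the leading edge of `H`.

A compatible initial state determines `H` on `[-k₁ L, L]`: the part on `[-k₁ L, 0]` is `w₀`, and the
part on `[0, L]` solves a Volterra equation in `L²`. Continuing `H` beyond `L` by exponential decay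
gives a global closed-loop solution with `‖(v, w)(t)‖ ≤ C exp (-k₃ t) ‖(v₀, w₀)‖` in `H¹`
(`Traffic.exists_history`, `Traffic.exists_isClosedLoop`). An energy estimate shows that closed-loop
solutions are determined by their initial state (`Traffic.eqOn_zero_of_homogeneous`,
`Traffic.IsClosedLoop.eqOn`), so every one of them obeys this bound with `ω = k₃`. The pointwise bounds
follow from the Sobolev inequality `IsH1.abs_le`, and admissibility from
`Traffic.isAdmissible_of_abs_lt`; the constant `M` is the decay constant times the Sobolev factor.
-/


open MeasureTheory Set Filter Topology

noncomputable section

/-! ### Square integrable functions and `H¹` on the road -/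

/-- Lebesgue measure on the road `(0, L)`. -/
abbrev road (L : ℝ) : Measure ℝ := volume.restrict (Ioo 0 L)

/-- The `L²(0, L)` seminorm as a real number (it is `0` when the extended norm is infinite). -/
def l2 (L : ℝ) (f : ℝ → ℝ) : ℝ := (eLpNorm f 2 (road L)).toReal

lemma l2_nonneg (L : ℝ) (f : ℝ → ℝ) : 0 ≤ l2 L f := ENNReal.toReal_nonneg

lemma intervalIntegral_eq_road {L : ℝ} (hL : 0 ≤ L) (f : ℝ → ℝ) :
    ∫ x in (0 : ℝ)..L, f x = ∫ x, f x ∂(road L) := by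
  rw [intervalIntegral.integral_of_le hL, integral_Ioc_eq_integral_Ioo]

lemma intervalIntegrable_iff_road {L : ℝ} (hL : 0 ≤ L) (f : ℝ → ℝ) :
    IntervalIntegrable f volume 0 L ↔ Integrable f (road L) := by
  rw [intervalIntegrable_iff_integrableOn_Ioo_of_le hL]; rfl

lemma l2_sq {L : ℝ} (hL : 0 ≤ L) {f : ℝ → ℝ} (hf : MemLp f 2 (road L)) :
    l2 L f ^ 2 = ∫ x in (0 : ℝ)..L, f x ^ 2 := by
  have h0 : 0 ≤ ∫ x, f x ^ 2 ∂(road L) := integral_nonneg fun x => sq_nonneg _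
  rw [l2, hf.eLpNorm_eq_integral_rpow_norm (by norm_num) (by norm_num),
    intervalIntegral_eq_road hL]
  have : ∫ x, ‖f x‖ ^ (2 : ENNReal).toReal ∂(road L) = ∫ x, f x ^ 2 ∂(road L) := by
    simp [Real.norm_eq_abs]
  rw [this, ENNReal.toReal_ofReal (by positivity), ← Real.rpow_natCast, ← Real.rpow_mul h0]
  simp

lemma MeasureTheory.MemLp.integrable_road {L : ℝ} {f : ℝ → ℝ} (hf : MemLp f 2 (road L)) :
    Integrable f (road L) := hf.integrable (by norm_num)

lemma integral_abs_le_l2 {L : ℝ} (hL : 0 ≤ L) {f : ℝ → ℝ} (hf : MemLp f 2 (road L)) :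
    ∫ x, |f x| ∂(road L) ≤ Real.sqrt L * l2 L f := by
  have h := eLpNorm_le_eLpNorm_mul_rpow_measure_univ (μ := road L) (p := 1) (q := 2)
    (by norm_num) hf.aestronglyMeasurable
  have h1 : ∫ x, |f x| ∂(road L) = (eLpNorm f 1 (road L)).toReal := by
    rw [eLpNorm_one_eq_lintegral_enorm,
      ← integral_norm_eq_lintegral_enorm hf.aestronglyMeasurable]; rfl
  rw [h1]
  have hfin : eLpNorm f 2 (road L) * road L univ ^ ((1 : ENNReal).toReal⁻¹ * 1 -
      1 / (2 : ENNReal).toReal) ≠ ⊤ := by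
    refine ENNReal.mul_ne_top hf.2.ne (ENNReal.rpow_ne_top_of_nonneg (by norm_num) ?_)
    simp
  have := ENNReal.toReal_mono (by simpa using hfin) h
  refine this.trans (le_of_eq ?_)
  rw [ENNReal.toReal_mul, mul_comm, l2]
  congr 1
  simp only [Measure.restrict_apply_univ, Real.volume_Ioo, sub_zero, ENNReal.toReal_one, div_one]
  rw [← ENNReal.toReal_rpow, ENNReal.toReal_ofReal hL, Real.sqrt_eq_rpow]
  norm_num

lemma abs_integral_mul_le_l2 {L : ℝ} (hL : 0 ≤ L) {f g : ℝ → ℝ} (hf : MemLp f 2 (road L))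
    (hg : MemLp g 2 (road L)) : |∫ x in (0 : ℝ)..L, f x * g x| ≤ l2 L f * l2 L g := by
  have hfg : Integrable (fun x => f x * g x) (road L) := hf.integrable_mul hg
  rw [intervalIntegral_eq_road hL]
  refine abs_le_of_sq_le_sq ?_ (mul_nonneg (l2_nonneg _ _) (l2_nonneg _ _))
  rw [mul_pow, l2_sq hL hf, l2_sq hL hg, intervalIntegral_eq_road hL, intervalIntegral_eq_road hL]
  have hf2 : Integrable (fun x => f x ^ 2) (road L) := hf.integrable_sq
  have hg2 : Integrable (fun x => g x ^ 2) (road L) := hg.integrable_sq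
  -- the discriminant of the nonnegative quadratic `s ↦ ∫ (s f + g) ^ 2` is nonpositive
  have key : ∀ s : ℝ, 0 ≤ (∫ x, f x ^ 2 ∂(road L)) * (s * s) +
      (2 * ∫ x, f x * g x ∂(road L)) * s + ∫ x, g x ^ 2 ∂(road L) := by
    intro s
    have : (∫ x, f x ^ 2 ∂(road L)) * (s * s) +
      (2 * ∫ x, f x * g x ∂(road L)) * s + ∫ x, g x ^ 2 ∂(road L) =
        ∫ x, (s * f x + g x) ^ 2 ∂(road L) := by
      rw [← integral_mul_const, ← integral_const_mul, ← integral_mul_const, ← integral_add,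
        ← integral_add]
      · congr 1; ext x; ring
      · exact (hf2.mul_const _).add ((hfg.const_mul _).mul_const _)
      · exact hg2
      · exact hf2.mul_const _
      · exact (hfg.const_mul _).mul_const _
    rw [this]; exact integral_nonneg fun x => sq_nonneg _
  have := discrim_le_zero key
  rw [discrim] at this
  nlinarith

lemma l2_add_le {L : ℝ} {f g : ℝ → ℝ} (hf : MemLp f 2 (road L)) (hg : MemLp g 2 (road L)) :
    l2 L (fun x => f x + g x) ≤ l2 L f + l2 L g := by
  have h := eLpNorm_add_le hf.aestronglyMeasurable hg.aestronglyMeasurable (p := 2) (by norm_num)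
  rw [l2, l2, l2, ← ENNReal.toReal_add hf.2.ne hg.2.ne]
  exact ENNReal.toReal_mono (ENNReal.add_ne_top.2 ⟨hf.2.ne, hg.2.ne⟩) h

lemma _root_.ContinuousOn.memLp_road {L : ℝ} {f : ℝ → ℝ} (hf : ContinuousOn f (Icc 0 L)) :
    MemLp f 2 (road L) := by
  obtain ⟨C, hC⟩ := isCompact_Icc.exists_bound_of_continuousOn hf
  refine MemLp.of_bound ((hf.mono Ioo_subset_Icc_self).aestronglyMeasurable measurableSet_Ioo) C ?_
  exact (ae_restrict_mem measurableSet_Ioo).mono fun x hx => hC x (Ioo_subset_Icc_self hx)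

namespace IsH1

variable {L : ℝ} {f g : ℝ → ℝ}

lemma continuousOn (hL : 0 ≤ L) (hf : IsH1 L f) : ContinuousOn f (Icc 0 L) := by
  simpa [uIcc_of_le hL] using hf.1.continuousOn

lemma memLp (hL : 0 ≤ L) (hf : IsH1 L f) : MemLp f 2 (road L) :=
  (hf.continuousOn hL).memLp_road

lemma ae_differentiableAt (hL : 0 ≤ L) (hf : IsH1 L f) :
    ∀ᵐ x ∂(road L), DifferentiableAt ℝ f x := by
  rw [ae_restrict_iff' measurableSet_Ioo]
  filter_upwards [hf.1.ae_differentiableAt] with x hx h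
  exact hx (by rw [uIcc_of_le hL]; exact Ioo_subset_Icc_self h)

lemma sub_eq_integral (hL : 0 ≤ L) (hf : IsH1 L f) {x y : ℝ} (hx : x ∈ Icc 0 L)
    (hy : y ∈ Icc 0 L) : f x - f y = ∫ s in y..x, deriv f s := by
  refine (AbsolutelyContinuousOnInterval.integral_deriv_eq_sub (hf.1.mono ?_)).symm
  rw [uIcc_of_le hL]; exact uIcc_subset_Icc hy hx

/-- A primitive of a square integrable function is in `H¹`, and its derivative is that function. -/
lemma of_density (hL : 0 ≤ L) {p : ℝ → ℝ} (hp : MemLp p 2 (road L))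
    (h : ∀ x ∈ Icc 0 L, f x = f 0 + ∫ s in (0 : ℝ)..x, p s) :
    IsH1 L f ∧ deriv f =ᵐ[road L] p := by
  have hpi : IntervalIntegrable p volume 0 L :=
    (intervalIntegrable_iff_road hL p).2 hp.integrable_road
  have hac : AbsolutelyContinuousOnInterval f 0 L := by
    have h1 := hpi.absolutelyContinuousOnInterval_intervalIntegral (c := 0) (by simp)
    have h2 : AbsolutelyContinuousOnInterval (fun _ : ℝ => f 0) 0 L :=
      (LipschitzWith.const (f 0)).lipschitzOnWith.absolutelyContinuousOnInterval
    have h3 := h2.fun_add h1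
    rw [AbsolutelyContinuousOnInterval] at h3 ⊢
    refine h3.congr' ?_
    rw [EventuallyEq, eventually_inf_principal]
    refine Eventually.of_forall fun E hE => Finset.sum_congr rfl fun i hi => ?_
    have := hE.1 i hi
    rw [uIcc_of_le hL] at this
    rw [h _ this.1, h _ this.2]
  have hd : deriv f =ᵐ[road L] p := by
    rw [EventuallyEq, ae_restrict_iff' measurableSet_Ioo]
    filter_upwards [hpi.ae_hasDerivAt_integral] with x hx hxm
    have h1 := hx (by rw [uIcc_of_le hL]; exact Ioo_subset_Icc_self hxm) 0 (by simp)
    refine HasDerivAt.deriv ((h1.const_add (f 0)).congr_of_eventuallyEq ?_)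
    filter_upwards [Ioo_mem_nhds hxm.1 hxm.2] with y hy
    exact h y (Ioo_subset_Icc_self hy)
  exact ⟨⟨hac, hp.ae_eq hd.symm⟩, hd⟩

/-- Linear combinations with `C¹` coefficients stay in `H¹`, and the product rule holds almost
everywhere. -/
lemma comb (hL : 0 ≤ L) {p q : ℝ → ℝ} (hp : ContDiff ℝ 1 p) (hq : ContDiff ℝ 1 q)
    (hf : IsH1 L f) (hg : IsH1 L g) :
    IsH1 L (fun x => p x * f x + q x * g x) ∧
    deriv (fun x => p x * f x + q x * g x) =ᵐ[road L]
      fun x => (deriv p x * f x + p x * deriv f x) + (deriv q x * g x + q x * deriv g x) := by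
  have hd : deriv (fun x => p x * f x + q x * g x) =ᵐ[road L]
      fun x => (deriv p x * f x + p x * deriv f x) + (deriv q x * g x + q x * deriv g x) := by
    filter_upwards [hf.ae_differentiableAt hL, hg.ae_differentiableAt hL] with x h1 h2
    have hpx := (hp.differentiable (by norm_num) x).hasDerivAt
    have hqx := (hq.differentiable (by norm_num) x).hasDerivAt
    exact ((hpx.mul h1.hasDerivAt).add (hqx.mul h2.hasDerivAt)).deriv
  have mulc : ∀ {r u : ℝ → ℝ}, Continuous r → MemLp u 2 (road L) →
      MemLp (fun x => r x * u x) 2 (road L) := by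
    intro r u hr hu
    obtain ⟨C, hC⟩ := isCompact_Icc.exists_bound_of_continuousOn (hr.continuousOn (s := Icc 0 L))
    refine MemLp.of_le_mul (c := C) hu (hr.aestronglyMeasurable.mul hu.aestronglyMeasurable) ?_
    refine (ae_restrict_mem measurableSet_Ioo).mono fun x hx => ?_
    rw [norm_mul]
    exact mul_le_mul_of_nonneg_right (hC x (Ioo_subset_Icc_self hx)) (norm_nonneg _)
  refine ⟨⟨(hp.contDiffOn.absolutelyContinuousOnInterval.fun_mul hf.1).fun_add
    (hq.contDiffOn.absolutelyContinuousOnInterval.fun_mul hg.1), ?_⟩, hd⟩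
  refine MemLp.ae_eq hd.symm ?_
  have hp' := hp.continuous_deriv (by norm_num)
  have hq' := hq.continuous_deriv (by norm_num)
  exact ((mulc hp' (hf.memLp hL)).add (mulc hp.continuous hf.2)).add
    ((mulc hq' (hg.memLp hL)).add (mulc hq.continuous hg.2))

lemma sub (hL : 0 ≤ L) (hf : IsH1 L f) (hg : IsH1 L g) :
    IsH1 L (fun x => f x - g x) ∧
      deriv (fun x => f x - g x) =ᵐ[road L] fun x => deriv f x - deriv g x := by
  have h := hf.comb hL (p := fun _ => 1) (q := fun _ => -1) contDiff_const contDiff_const hg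
  simpa [sub_eq_add_neg] using h

lemma zero (hL : 0 ≤ L) : IsH1 L (0 : ℝ → ℝ) :=
  (of_density hL (p := 0) MemLp.zero (by simp)).1

/-- Sobolev inequality on an interval. -/
lemma abs_le (hL : 0 < L) (hf : IsH1 L f) {x : ℝ} (hx : x ∈ Icc 0 L) :
    |f x| ≤ (Real.sqrt L / L) * l2 L f + Real.sqrt L * l2 L (deriv f) := by
  have h0 := integral_abs_le_l2 hL.le (hf.memLp hL.le)
  have h1 := integral_abs_le_l2 hL.le hf.2
  have hpt : ∀ y ∈ Ioo 0 L, |f x| ≤ |f y| + ∫ s, |deriv f s| ∂(road L) := by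
    intro y hy
    have hy' := Ioo_subset_Icc_self hy
    have h2 := hf.sub_eq_integral hL.le hx hy'
    have h3 : |f x - f y| ≤ ∫ s, |deriv f s| ∂(road L) := by
      rw [h2, ← Real.norm_eq_abs]
      refine intervalIntegral.norm_integral_le_integral_norm_uIoc.trans ?_
      rw [← integral_Ioc_eq_integral_Ioo (x := (0 : ℝ))]
      refine setIntegral_mono_set ?_ (ae_of_all _ fun _ => norm_nonneg _) ?_
      · have := hf.2.integrable_road.norm
        rw [← IntegrableOn, ← integrableOn_Ioc_iff_integrableOn_Ioo] at this
        exact this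
      · refine LE.le.eventuallyLE (Ioc_subset_Ioc ?_ ?_)
        · exact le_min hy'.1 hx.1
        · exact max_le hy'.2 hx.2
    have := abs_sub_abs_le_abs_sub (f x) (f y)
    linarith
  have hint : L * |f x| ≤ (∫ y, |f y| ∂(road L)) + L * ∫ s, |deriv f s| ∂(road L) := by
    have h3 := integral_mono_ae (μ := road L) (f := fun _ => |f x|)
      (g := fun y => |f y| + ∫ s, |deriv f s| ∂(road L)) (integrable_const _)
      ((hf.memLp hL.le).integrable_road.abs.add (integrable_const _))
      ((ae_restrict_mem measurableSet_Ioo).mono hpt)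
    rw [integral_add (hf.memLp hL.le).integrable_road.abs (integrable_const _)] at h3
    simpa [Measure.real, hL.le] using h3
  have : L * |f x| ≤ L * ((Real.sqrt L / L) * l2 L f + Real.sqrt L * l2 L (deriv f)) := by
    refine hint.trans ?_
    rw [mul_add, ← mul_assoc, mul_div_cancel₀ _ hL.ne']
    exact add_le_add h0 (mul_le_mul_of_nonneg_left h1 hL.le)
  exact le_of_mul_le_mul_left this hL

end IsH1

lemma h1Norm_eq {L : ℝ} (hL : 0 ≤ L) {f g : ℝ → ℝ} (hf : IsH1 L f) (hg : IsH1 L g) :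
    h1Norm L f g = Real.sqrt (l2 L f ^ 2 + l2 L (deriv f) ^ 2 +
      (l2 L g ^ 2 + l2 L (deriv g) ^ 2)) := by
  have key : ∀ {u : ℝ → ℝ}, IsH1 L u → ∫ x in (0 : ℝ)..L, (u x ^ 2 + deriv u x ^ 2) =
      l2 L u ^ 2 + l2 L (deriv u) ^ 2 := by
    intro u hu
    rw [l2_sq hL (hu.memLp hL), l2_sq hL hu.2, intervalIntegral.integral_add]
    · exact (intervalIntegrable_iff_road hL _).2 (hu.memLp hL).integrable_sq
    · exact (intervalIntegrable_iff_road hL _).2 hu.2.integrable_sq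
  rw [h1Norm, key hf, key hg]

lemma l2_le_h1Norm {L : ℝ} (hL : 0 ≤ L) {f g : ℝ → ℝ} (hf : IsH1 L f) (hg : IsH1 L g) :
    l2 L f ≤ h1Norm L f g ∧ l2 L (deriv f) ≤ h1Norm L f g ∧
      l2 L g ≤ h1Norm L f g ∧ l2 L (deriv g) ≤ h1Norm L f g := by
  rw [h1Norm_eq hL hf hg]
  refine ⟨?_, ?_, ?_, ?_⟩ <;> refine Real.le_sqrt_of_sq_le ?_ <;>
    linarith [sq_nonneg (l2 L f), sq_nonneg (l2 L (deriv f)), sq_nonneg (l2 L g),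
      sq_nonneg (l2 L (deriv g))]

lemma h1Norm_le {L : ℝ} (hL : 0 ≤ L) {f g : ℝ → ℝ} (hf : IsH1 L f) (hg : IsH1 L g) :
    h1Norm L f g ≤ l2 L f + l2 L (deriv f) + (l2 L g + l2 L (deriv g)) := by
  have h1 := l2_nonneg L f
  have h2 := l2_nonneg L (deriv f)
  have h3 := l2_nonneg L g
  have h4 := l2_nonneg L (deriv g)
  rw [h1Norm_eq hL hf hg]
  refine Real.sqrt_le_iff.2 ⟨by positivity, ?_⟩
  nlinarith [mul_nonneg h1 h2, mul_nonneg h1 h3, mul_nonneg h1 h4, mul_nonneg h2 h3,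
    mul_nonneg h2 h4, mul_nonneg h3 h4]

lemma h1Norm_nonneg (L : ℝ) (f g : ℝ → ℝ) : 0 ≤ h1Norm L f g := Real.sqrt_nonneg _

lemma deriv_eqOn_Ioo {L : ℝ} {f g : ℝ → ℝ} (h : EqOn f g (Icc 0 L)) :
    EqOn (deriv f) (deriv g) (Ioo 0 L) := fun x hx =>
  EventuallyEq.deriv_eq (by
    filter_upwards [Ioo_mem_nhds hx.1 hx.2] with y hy using h (Ioo_subset_Icc_self hy))

lemma h1Norm_congr {L : ℝ} (hL : 0 ≤ L) {f g f' g' : ℝ → ℝ} (hf : EqOn f f' (Icc 0 L))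
    (hg : EqOn g g' (Icc 0 L)) : h1Norm L f g = h1Norm L f' g' := by
  have key : ∀ {u v : ℝ → ℝ}, EqOn u v (Icc 0 L) → ∫ x in (0 : ℝ)..L, (u x ^ 2 + deriv u x ^ 2) =
      ∫ x in (0 : ℝ)..L, (v x ^ 2 + deriv v x ^ 2) := by
    intro u v h
    rw [intervalIntegral_eq_road hL, intervalIntegral_eq_road hL]
    refine setIntegral_congr_fun measurableSet_Ioo fun x hx => ?_
    simp only [h (Ioo_subset_Icc_self hx), deriv_eqOn_Ioo h hx]
  rw [h1Norm, h1Norm, key hf, key hg]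

/-! ### Calculus of evolutions -/

/-- Convergence to zero in `H¹` is convergence of the function and of its derivative in `L²`. -/
lemma tendsto_h1Norm_zero_iff {L : ℝ} (hL : 0 ≤ L) {l : Filter ℝ} {u : ℝ → ℝ → ℝ}
    (hu : ∀ᶠ s in l, IsH1 L (u s)) :
    Tendsto (fun s => h1Norm L (u s) 0) l (𝓝 0) ↔
      Tendsto (fun s => l2 L (u s)) l (𝓝 0) ∧ Tendsto (fun s => l2 L (deriv (u s))) l (𝓝 0) := by
  constructor
  · intro h
    refine ⟨squeeze_zero' (Eventually.of_forall fun _ => l2_nonneg _ _) ?_ h,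
      squeeze_zero' (Eventually.of_forall fun _ => l2_nonneg _ _) ?_ h⟩
    · exact hu.mono fun s hs => (l2_le_h1Norm hL hs (IsH1.zero hL)).1
    · exact hu.mono fun s hs => (l2_le_h1Norm hL hs (IsH1.zero hL)).2.1
  · rintro ⟨h1, h2⟩
    refine squeeze_zero' (Eventually.of_forall fun _ => h1Norm_nonneg _ _ _) ?_
      (by simpa using h1.add h2)
    refine hu.mono fun s hs => (h1Norm_le hL hs (IsH1.zero hL)).trans (le_of_eq ?_)
    have h0 : deriv (0 : ℝ → ℝ) = 0 := by
      ext x; exact deriv_const x (0 : ℝ)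
    simp [h0, l2]

lemma continuous_mul_memLp {L : ℝ} {r u : ℝ → ℝ} (hr : Continuous r) (hu : MemLp u 2 (road L)) :
    MemLp (fun x => r x * u x) 2 (road L) := by
  obtain ⟨C, hC⟩ := isCompact_Icc.exists_bound_of_continuousOn (hr.continuousOn (s := Icc 0 L))
  refine MemLp.of_le_mul (c := C) hu (hr.aestronglyMeasurable.mul hu.aestronglyMeasurable) ?_
  refine (ae_restrict_mem measurableSet_Ioo).mono fun x hx => ?_
  rw [norm_mul]
  exact mul_le_mul_of_nonneg_right (hC x (Ioo_subset_Icc_self hx)) (norm_nonneg _)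

lemma exists_eLpNorm_mul_le {L : ℝ} {r : ℝ → ℝ} (hr : Continuous r) :
    ∃ C : ℝ, 0 ≤ C ∧ ∀ u : ℝ → ℝ, eLpNorm (fun x => r x * u x) 2 (road L) ≤
      ENNReal.ofReal C * eLpNorm u 2 (road L) := by
  obtain ⟨C, hC⟩ := isCompact_Icc.exists_bound_of_continuousOn (hr.continuousOn (s := Icc 0 L))
  refine ⟨max C 0, le_max_right _ _, fun u => ?_⟩
  refine eLpNorm_le_mul_eLpNorm_of_ae_le_mul ?_ 2
  refine (ae_restrict_mem measurableSet_Ioo).mono fun x hx => ?_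
  rw [norm_mul]
  exact mul_le_mul_of_nonneg_right ((hC x (Ioo_subset_Icc_self hx)).trans (le_max_left _ _))
    (norm_nonneg _)

lemma exists_l2_mul_le {L : ℝ} {r : ℝ → ℝ} (hr : Continuous r) :
    ∃ C : ℝ, 0 ≤ C ∧ ∀ u : ℝ → ℝ, MemLp u 2 (road L) →
      l2 L (fun x => r x * u x) ≤ C * l2 L u := by
  obtain ⟨C, hC0, hC⟩ := exists_eLpNorm_mul_le (L := L) hr
  refine ⟨C, hC0, fun u hu => ?_⟩
  have := ENNReal.toReal_mono (ENNReal.mul_ne_top ENNReal.ofReal_ne_top hu.2.ne) (hC u)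
  rwa [ENNReal.toReal_mul, ENNReal.toReal_ofReal hC0] at this

lemma l2_congr {L : ℝ} {f g : ℝ → ℝ} (h : f =ᵐ[road L] g) : l2 L f = l2 L g := by
  rw [l2, l2, eLpNorm_congr_ae h]

namespace IsEvolution

variable {L : ℝ} {T : EReal} {f F g G : ℝ → ℝ → ℝ}

lemma congr (hf : IsEvolution L T f F) (h : ∀ t ∈ timeInterval T, F t =ᵐ[road L] G t) :
    IsEvolution L T f G where
  mem := hf.mem
  continuous := hf.continuous
  deriv_eq t ht := by
    refine (hf.deriv_eq t ht).congr fun s => eLpNorm_congr_ae ?_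
    filter_upwards [h t ht] with x hx
    rw [hx]

/-- Evolutions may be combined linearly with coefficients that are continuously differentiable in
the space variable. -/
lemma comb (hL : 0 ≤ L) {p q : ℝ → ℝ} (hp : ContDiff ℝ 1 p) (hq : ContDiff ℝ 1 q)
    (hf : IsEvolution L T f F) (hg : IsEvolution L T g G)
    (hF : ∀ t ∈ timeInterval T, MemLp (F t) 2 (road L))
    (hG : ∀ t ∈ timeInterval T, MemLp (G t) 2 (road L)) :
    IsEvolution L T (fun t x => p x * f t x + q x * g t x)
      (fun t x => p x * F t x + q x * G t x) where
  mem t ht := ((hf.mem t ht).comb hL hp hq (hg.mem t ht)).1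
  continuous t ht := by
    have hself : ∀ᶠ s in 𝓝[timeInterval T] t, s ∈ timeInterval T := self_mem_nhdsWithin
    have ef := hself.mono fun s hs => ((hf.mem s hs).sub hL (hf.mem t ht)).1
    have eg := hself.mono fun s hs => ((hg.mem s hs).sub hL (hg.mem t ht)).1
    obtain ⟨f1, f2⟩ := (tendsto_h1Norm_zero_iff hL ef).1 (hf.continuous t ht)
    obtain ⟨g1, g2⟩ := (tendsto_h1Norm_zero_iff hL eg).1 (hg.continuous t ht)
    obtain ⟨Cp, hCp0, hCp⟩ := exists_l2_mul_le (L := L) hp.continuous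
    obtain ⟨Cq, hCq0, hCq⟩ := exists_l2_mul_le (L := L) hq.continuous
    obtain ⟨Dp, hDp0, hDp⟩ := exists_l2_mul_le (L := L) (hp.continuous_deriv (by norm_num))
    obtain ⟨Dq, hDq0, hDq⟩ := exists_l2_mul_le (L := L) (hq.continuous_deriv (by norm_num))
    have hrew : (fun s => h1Norm L (fun x => p x * f s x + q x * g s x -
        (p x * f t x + q x * g t x)) 0) = fun s => h1Norm L
        (fun x => p x * (f s x - f t x) + q x * (g s x - g t x)) 0 := by
      ext s; congr 1; ext x; ring
    rw [hrew, tendsto_h1Norm_zero_iff hL]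
    · constructor
      · refine squeeze_zero' (Eventually.of_forall fun _ => l2_nonneg _ _) ?_
          (by simpa using (f1.const_mul Cp).add (g1.const_mul Cq))
        filter_upwards [ef, eg] with s h1 h2
        exact (l2_add_le (continuous_mul_memLp hp.continuous (h1.memLp hL))
          (continuous_mul_memLp hq.continuous (h2.memLp hL))).trans
          (add_le_add (hCp _ (h1.memLp hL)) (hCq _ (h2.memLp hL)))
      · refine squeeze_zero' (Eventually.of_forall fun _ => l2_nonneg _ _) ?_
          (by
            simpa using ((f1.const_mul Dp).add (f2.const_mul Cp)).add
              ((g1.const_mul Dq).add (g2.const_mul Cq)))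
        filter_upwards [ef, eg] with s h1 h2
        rw [l2_congr (h1.comb hL hp hq h2).2]
        have a1 := continuous_mul_memLp (hp.continuous_deriv (by norm_num)) (h1.memLp hL)
        have a2 := continuous_mul_memLp hp.continuous h1.2
        have a3 := continuous_mul_memLp (hq.continuous_deriv (by norm_num)) (h2.memLp hL)
        have a4 := continuous_mul_memLp hq.continuous h2.2
        refine (l2_add_le (a1.add a2) (a3.add a4)).trans (add_le_add ?_ ?_)
        · exact (l2_add_le a1 a2).trans (add_le_add (hDp _ (h1.memLp hL)) (hCp _ h1.2))
        · exact (l2_add_le a3 a4).trans (add_le_add (hDq _ (h2.memLp hL)) (hCq _ h2.2))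
    · filter_upwards [ef, eg] with s h1 h2
      exact (h1.comb hL hp hq h2).1
  deriv_eq t ht := by
    obtain ⟨Cp, hCp0, hCp⟩ := exists_eLpNorm_mul_le (L := L) hp.continuous
    obtain ⟨Cq, hCq0, hCq⟩ := exists_eLpNorm_mul_le (L := L) hq.continuous
    have h1 := ENNReal.Tendsto.const_mul (a := ENNReal.ofReal Cp) (hf.deriv_eq t ht)
      (Or.inr ENNReal.ofReal_ne_top)
    have h2 := ENNReal.Tendsto.const_mul (a := ENNReal.ofReal Cq) (hg.deriv_eq t ht)
      (Or.inr ENNReal.ofReal_ne_top)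
    have h3 := h1.add h2
    rw [mul_zero, mul_zero, add_zero] at h3
    refine tendsto_of_tendsto_of_tendsto_of_le_of_le' tendsto_const_nhds h3
      (Eventually.of_forall fun _ => zero_le) ?_
    have hself : ∀ᶠ s in 𝓝[timeInterval T \ {t}] t, s ∈ timeInterval T \ {t} :=
      self_mem_nhdsWithin
    filter_upwards [hself] with s hs
    have m1 : MemLp (fun x => (s - t)⁻¹ * (f s x - f t x) - F t x) 2 (road L) :=
      ((((hf.mem s hs.1).memLp hL).sub ((hf.mem t ht).memLp hL)).const_mul _).sub (hF t ht)
    have m2 : MemLp (fun x => (s - t)⁻¹ * (g s x - g t x) - G t x) 2 (road L) :=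
      ((((hg.mem s hs.1).memLp hL).sub ((hg.mem t ht).memLp hL)).const_mul _).sub (hG t ht)
    calc _ = eLpNorm (fun x => p x * ((s - t)⁻¹ * (f s x - f t x) - F t x) +
          q x * ((s - t)⁻¹ * (g s x - g t x) - G t x)) 2 (road L) := by
            congr 1; ext x; ring
      _ ≤ _ := eLpNorm_add_le
          (continuous_mul_memLp hp.continuous m1).aestronglyMeasurable
          (continuous_mul_memLp hq.continuous m2).aestronglyMeasurable (by norm_num)
      _ ≤ _ := add_le_add (hCp _) (hCq _)

lemma sub (hL : 0 ≤ L) (hf : IsEvolution L T f F) (hg : IsEvolution L T g G)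
    (hF : ∀ t ∈ timeInterval T, MemLp (F t) 2 (road L))
    (hG : ∀ t ∈ timeInterval T, MemLp (G t) 2 (road L)) :
    IsEvolution L T (fun t x => f t x - g t x) (fun t x => F t x - G t x) := by
  have h := hf.comb hL (p := fun _ => 1) (q := fun _ => -1) contDiff_const contDiff_const hg hF hG
  simpa [sub_eq_add_neg] using h

end IsEvolution

/-! ### Equilibrium quantities -/

namespace Traffic

variable (P : Traffic)

lemma vs_lt_vf : P.vs < P.vf := by
  have h := P.congested
  have h1 : P.γ / (P.γ + 1) < 1 := by
    rw [div_lt_one (by linarith [P.γ_pos])]; linarith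
  nlinarith [P.vf_pos]

lemma ps_eq : P.ps = P.vf - P.vs := by
  have h0 : 0 < (P.vf - P.vs) / P.vf := div_pos (sub_pos.2 P.vs_lt_vf) P.vf_pos
  have h1 := P.vf_pos.ne'
  have h2 := P.ρm_pos.ne'
  have h3 := P.vs_pos.ne'
  have h4 : P.qs / P.vs / P.ρm = ((P.vf - P.vs) / P.vf) ^ (1 / P.γ) := by
    rw [qs]; field_simp
  rw [ps, h4, ← Real.rpow_mul h0.le, one_div, inv_mul_cancel₀ P.γ_pos.ne', Real.rpow_one]
  field_simp

lemma lam_pos : 0 < P.lam := by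
  have h := P.congested
  have hγ := P.γ_pos
  rw [lam, ps_eq]
  rw [div_mul_eq_mul_div, lt_div_iff₀ (by linarith)] at h
  linarith

lemma qs_pos : 0 < P.qs := by
  have h0 : 0 < (P.vf - P.vs) / P.vf := div_pos (sub_pos.2 P.vs_lt_vf) P.vf_pos
  have h2 := P.ρm_pos
  have h3 := P.vs_pos
  rw [qs]; positivity

lemma gamma_ps : P.γ * P.ps = P.lam + P.vs := by rw [lam]; ring

lemma gamma_ps_pos : 0 < P.γ * P.ps := by
  rw [gamma_ps]; linarith [P.lam_pos, P.vs_pos]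

lemma k1_pos : 0 < P.k1 := div_pos P.lam_pos P.vs_pos

lemma mu_pos : 0 < P.mu := div_pos P.vs_pos P.lam_pos

lemma mu_eq : P.mu = P.k1⁻¹ := by rw [mu, k1, inv_div]

/-! ### The change of variables -/

section

variable {P} {T : EReal} {v w : ℝ → ℝ → ℝ}

lemma continuous_c : Continuous P.c := by unfold c; fun_prop

lemma RiemannSystem.memLp_w (h : P.RiemannSystem T v w) :
    ∀ t ∈ timeInterval T, MemLp (fun x => -P.vs * deriv (w t) x) 2 (road P.L) :=
  fun t ht => (h.1.mem t ht).2.const_mul _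

lemma RiemannSystem.memLp_v (h : P.RiemannSystem T v w) :
    ∀ t ∈ timeInterval T, MemLp (fun x => P.lam * deriv (v t) x + P.c x * w t x) 2 (road P.L) :=
  fun t ht => ((h.2.mem t ht).2.const_mul _).add
    (continuous_mul_memLp continuous_c ((h.1.mem t ht).memLp P.L_pos.le))

lemma RiemannSystem.linearizedARZ (h : P.RiemannSystem T v w) :
    P.LinearizedARZ T (fun t => P.flowPert (v t) (w t)) (fun t => P.velPert (v t)) := by
  have hL := P.L_pos.le
  have hvs := P.vs_pos.ne'
  have hqs := P.qs_pos.ne'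
  have hτ := P.τ_pos.ne'
  have hg := P.gamma_ps_pos.ne'
  have hγ := P.gamma_ps
  have hce : ContDiff ℝ 1 fun x : ℝ => Real.exp (-(x / (P.τ * P.vs))) := by fun_prop
  have hde : ∀ x, deriv (fun x : ℝ => Real.exp (-(x / (P.τ * P.vs)))) x =
      -(1 / (P.τ * P.vs)) * Real.exp (-(x / (P.τ * P.vs))) := by
    intro x
    have := (((hasDerivAt_id x).div_const (P.τ * P.vs)).neg).exp
    rw [HasDerivAt.deriv (by simpa using! this)]; ring
  constructor
  · have h1 := h.1.comb hL (q := fun _ => P.qs * (1 / P.vs - 1 / (P.γ * P.ps)) *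
      (P.γ * P.ps / P.qs)) hce contDiff_const h.2 h.memLp_w h.memLp_v
    have e : (fun t => P.flowPert (v t) (w t)) = fun t x => Real.exp (-(x / (P.τ * P.vs))) * w t x +
        P.qs * (1 / P.vs - 1 / (P.γ * P.ps)) * (P.γ * P.ps / P.qs) * v t x := by
      ext t x; simp only [flowPert, velPert]; ring
    rw [← e] at h1
    refine h1.congr fun t ht => ?_
    have hd := ((h.1.mem t ht).comb hL (q := fun _ => P.qs * (1 / P.vs - 1 / (P.γ * P.ps)) *
      (P.γ * P.ps / P.qs)) hce contDiff_const (h.2.mem t ht)).2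
    have e' := congrFun e t
    rw [← e'] at hd
    filter_upwards [hd] with x hx
    have hv : deriv (P.velPert (v t)) x = P.γ * P.ps / P.qs * deriv (v t) x := by
      unfold velPert; exact deriv_const_mul_field _
    rw [hx, hv, hde, deriv_const]
    simp only [flowPert, velPert, c]
    rw [hγ] at hg ⊢
    field_simp
    ring
  · have h1 := h.2.comb hL (p := fun _ => P.γ * P.ps / P.qs) (q := fun _ => 0)
      contDiff_const contDiff_const h.1 h.memLp_v h.memLp_w
    have e : (fun t => P.velPert (v t)) = fun t x => P.γ * P.ps / P.qs * v t x + 0 * w t x := by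
      ext t x; simp only [velPert]; ring
    rw [← e] at h1
    refine h1.congr fun t ht => ?_
    refine Eventually.of_forall fun x => ?_
    have hv : deriv (P.velPert (v t)) x = P.γ * P.ps / P.qs * deriv (v t) x := by
      unfold velPert; exact deriv_const_mul_field _
    simp only [hv]
    simp only [flowPert, velPert, c]
    rw [hγ] at hg ⊢
    field_simp
    ring

lemma LinearizedARZ.riemannSystem
    (h : P.LinearizedARZ T (fun t => P.flowPert (v t) (w t)) (fun t => P.velPert (v t))) :
    P.RiemannSystem T v w := by
  have hL := P.L_pos.le
  have hvs := P.vs_pos.ne'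
  have hqs := P.qs_pos.ne'
  have hτ := P.τ_pos.ne'
  have hg := P.gamma_ps_pos.ne'
  have hγ := P.gamma_ps
  have hce : ContDiff ℝ 1 fun x : ℝ => Real.exp (x / (P.τ * P.vs)) := by fun_prop
  have hde : ∀ x, deriv (fun x : ℝ => Real.exp (x / (P.τ * P.vs))) x =
      1 / (P.τ * P.vs) * Real.exp (x / (P.τ * P.vs)) := by
    intro x
    have := ((hasDerivAt_id x).div_const (P.τ * P.vs)).exp
    rw [HasDerivAt.deriv (by simpa using! this)]; ring
  have hme : ∀ x, Real.exp (x / (P.τ * P.vs)) = (Real.exp (-(x / (P.τ * P.vs))))⁻¹ := by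
    intro x; rw [Real.exp_neg, inv_inv]
  have hcq : ContDiff ℝ 1 fun x : ℝ => Real.exp (x / (P.τ * P.vs)) *
    -(P.qs * (1 / P.vs - 1 / (P.γ * P.ps))) := by fun_prop
  have hF : ∀ t ∈ timeInterval T, MemLp (fun x =>
      -P.vs * deriv (P.flowPert (v t) (w t)) x + P.qs * P.lam / P.vs * deriv (P.velPert (v t)) x
      + P.qs / P.τ * (P.γ * P.ps / P.vs) * (1 / P.vs - 1 / (P.γ * P.ps)) * P.velPert (v t) x
      - P.γ * P.ps / (P.τ * P.vs) * P.flowPert (v t) (w t) x) 2 (road P.L) := fun t ht =>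
    ((((h.1.mem t ht).2.const_mul _).add ((h.2.mem t ht).2.const_mul _)).add
      (((h.2.mem t ht).memLp hL).const_mul _)).sub (((h.1.mem t ht).memLp hL).const_mul _)
  have hG : ∀ t ∈ timeInterval T, MemLp (fun x =>
      P.lam * deriv (P.velPert (v t)) x + P.lam / (P.τ * P.vs) * P.velPert (v t) x
      - P.γ * P.ps / (P.τ * P.qs) * P.flowPert (v t) (w t) x) 2 (road P.L) := fun t ht =>
    (((h.2.mem t ht).2.const_mul _).add (((h.2.mem t ht).memLp hL).const_mul _)).sub
      (((h.1.mem t ht).memLp hL).const_mul _)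
  have hv : ∀ t x, deriv (P.velPert (v t)) x = P.γ * P.ps / P.qs * deriv (v t) x := by
    intro t x; unfold velPert; exact deriv_const_mul_field _
  constructor
  · have h1 := h.1.comb hL hce hcq h.2 hF hG
    have e : w = fun t x => Real.exp (x / (P.τ * P.vs)) * P.flowPert (v t) (w t) x +
        Real.exp (x / (P.τ * P.vs)) * -(P.qs * (1 / P.vs - 1 / (P.γ * P.ps))) *
          P.velPert (v t) x := by
      ext t x
      rw [hme]; simp only [flowPert, velPert]
      have := Real.exp_pos (-(x / (P.τ * P.vs)))
      field_simp; ring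
    rw [← e] at h1
    refine h1.congr fun t ht => ?_
    have hd := ((h.1.mem t ht).comb hL hce hcq (h.2.mem t ht)).2
    rw [← congrFun e t] at hd
    filter_upwards [hd] with x hx
    rw [hx, deriv_mul_const_field, hde, hv]
    simp only [flowPert, velPert]
    rw [hγ] at hg ⊢
    field_simp
    ring
  · have h1 := h.2.comb hL (p := fun _ => P.qs / (P.γ * P.ps)) (q := fun _ => 0)
      contDiff_const contDiff_const h.1 hG hF
    have e : v = fun t x => P.qs / (P.γ * P.ps) * P.velPert (v t) x +
        0 * P.flowPert (v t) (w t) x := by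
      have hps : P.ps ≠ 0 := right_ne_zero_of_mul hg
      have hγ0 := P.γ_pos.ne'
      ext t x; simp only [velPert]; field_simp; ring
    rw [← e] at h1
    refine h1.congr fun t ht => ?_
    refine Eventually.of_forall fun x => ?_
    simp only [hv]
    simp only [flowPert, velPert, c]
    rw [hγ] at hg ⊢
    field_simp
    ring

/-- The linearized model and the system in Riemann coordinates have the same solutions. -/
lemma riemannSystem_iff : P.RiemannSystem T v w ↔
    P.LinearizedARZ T (fun t => P.flowPert (v t) (w t)) (fun t => P.velPert (v t)) :=
  ⟨RiemannSystem.linearizedARZ, LinearizedARZ.riemannSystem⟩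

end

end Traffic

/-! ### Convolutions on `[0, x]` and Volterra equations -/

/-- Measurable, locally bounded functions with at most countably many discontinuities. -/
structure IsPC (f : ℝ → ℝ) : Prop where
  measurable : Measurable f
  bounded : ∀ R : ℝ, ∃ C : ℝ, ∀ r, |r| ≤ R → |f r| ≤ C
  countable : {x | ¬ ContinuousAt f x}.Countable

/-- The causal convolution `∫₀ˣ f(r) g(x - r) dr`. -/
def conv (f g : ℝ → ℝ) (x : ℝ) : ℝ := ∫ r in (0 : ℝ)..x, f r * g (x - r)

namespace IsPC

variable {f g : ℝ → ℝ}

lemma of_continuous (hf : Continuous f) : IsPC f where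
  measurable := hf.measurable
  bounded R := by
    obtain ⟨C, hC⟩ := isCompact_Icc.exists_bound_of_continuousOn (hf.continuousOn (s := Icc (-R) R))
    exact ⟨C, fun r hr => hC r (abs_le.1 hr)⟩
  countable := by simp [hf.continuousAt]

lemma add (hf : IsPC f) (hg : IsPC g) : IsPC (fun x => f x + g x) where
  measurable := hf.measurable.add hg.measurable
  bounded R := by
    obtain ⟨C, hC⟩ := hf.bounded R
    obtain ⟨D, hD⟩ := hg.bounded R
    exact ⟨C + D, fun r hr => (abs_add_le _ _).trans (add_le_add (hC r hr) (hD r hr))⟩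
  countable := by
    refine (hf.countable.union hg.countable).mono fun x hx => ?_
    by_contra h
    simp only [mem_union, mem_ofPred_eq, not_or, not_not] at h
    exact hx (h.1.add h.2)

lemma ae_continuousAt_sub (hf : IsPC f) (x : ℝ) :
    ∀ᵐ r : ℝ, ContinuousAt f (x - r) := by
  have h : ((fun r => x - r) ⁻¹' {y | ¬ ContinuousAt f y}).Countable :=
    hf.countable.preimage (sub_right_injective)
  exact (h.ae_notMem volume).mono fun r hr => by simpa using hr

lemma intervalIntegrable (hf : IsPC f) (a b : ℝ) : IntervalIntegrable f volume a b := by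
  obtain ⟨C, hC⟩ := hf.bounded (max |a| |b|)
  rw [intervalIntegrable_iff]
  have : IsFiniteMeasure (volume.restrict (uIoc a b)) := by rw [uIoc]; infer_instance
  refine Integrable.of_bound hf.measurable.aestronglyMeasurable C ?_
  refine (ae_restrict_mem measurableSet_uIoc).mono fun r hr => hC r ?_
  exact abs_le_max_abs_abs (uIoc_subset_uIcc hr).1 (uIoc_subset_uIcc hr).2 |>.trans (by
    rcases le_total a b with h | h <;> simp [h, max_comm])

end IsPC

lemma intervalIntegrable_mul_of_bounded {f g : ℝ → ℝ} {a b C : ℝ}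
    (hf : IntervalIntegrable f volume a b) (hg : Measurable g)
    (hC : ∀ r ∈ uIcc a b, |g r| ≤ C) : IntervalIntegrable (fun r => f r * g r) volume a b := by
  rw [intervalIntegrable_iff] at hf ⊢
  refine Integrable.mul_bdd (c := C) hf hg.aestronglyMeasurable ?_
  exact (ae_restrict_mem measurableSet_uIoc).mono fun r hr => hC r (uIoc_subset_uIcc hr)

lemma IsPC.intervalIntegrable_mul_sub {f g : ℝ → ℝ} {a b : ℝ}
    (hf : IntervalIntegrable f volume a b) (hg : IsPC g) (x : ℝ) :
    IntervalIntegrable (fun r => f r * g (x - r)) volume a b := by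
  obtain ⟨C, hC⟩ := hg.bounded (|x| + max |a| |b|)
  refine intervalIntegrable_mul_of_bounded (C := C) hf
    (hg.measurable.comp (measurable_const.sub measurable_id)) fun r hr => hC _ ?_
  have h1 : |r| ≤ max |a| |b| := abs_le_max_abs_abs hr.1 hr.2 |>.trans (by
    rcases le_total a b with h | h <;> simp [h, max_comm])
  exact (abs_sub _ _).trans (by linarith)

lemma continuous_integral_mul_sub {f g : ℝ → ℝ} (hf : ∀ a b, IntervalIntegrable f volume a b)
    (hg : IsPC g) : Continuous fun p : ℝ × ℝ => ∫ r in (0 : ℝ)..p.2, f r * g (p.1 - r) := by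
  rw [continuous_iff_continuousAt]
  rintro ⟨x, b⟩
  obtain ⟨C, hC⟩ := hg.bounded (|x| + 1 + (|b| + 1))
  have hb : ∀ r ∈ uIoc (-(|b| + 1)) (|b| + 1), |r| ≤ |b| + 1 := by
    intro r hr
    rw [uIoc_of_le (by linarith [abs_nonneg b])] at hr
    exact abs_le.2 ⟨hr.1.le, hr.2⟩
  refine intervalIntegral.continuousAt_parametric_primitive_of_dominated
    (F := fun x r => f r * g (x - r)) (fun r => |f r| * C)
    (-(|b| + 1)) (|b| + 1) (fun y => ?_) ?_ ?_ ?_ ⟨by linarith [abs_nonneg b],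
      by linarith [abs_nonneg b]⟩ ⟨by linarith [neg_abs_le b], by linarith [le_abs_self b]⟩
      (by simp)
  · exact (intervalIntegrable_iff.1 (hg.intervalIntegrable_mul_sub (hf _ _) y)).aestronglyMeasurable
  · filter_upwards [Metric.ball_mem_nhds x one_pos] with y hy
    refine (ae_restrict_mem measurableSet_uIoc).mono fun r hr => ?_
    rw [norm_mul]
    refine mul_le_mul_of_nonneg_left (hC _ ?_) (norm_nonneg _)
    have h1 : |y| ≤ |x| + 1 := by
      have := abs_sub_abs_le_abs_sub y x
      rw [Metric.mem_ball, Real.dist_eq] at hy; linarith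
    exact (abs_sub _ _).trans (add_le_add h1 (hb r hr))
  · exact (hf _ _).abs.mul_const _
  · refine ae_restrict_of_ae ((hg.ae_continuousAt_sub x).mono fun r hr => ?_)
    exact continuousAt_const.mul (ContinuousAt.comp (f := fun y => y - r) hr (by fun_prop))

lemma continuous_conv {f g : ℝ → ℝ} (hf : ∀ a b, IntervalIntegrable f volume a b) (hg : IsPC g) :
    Continuous (conv f g) :=
  (continuous_integral_mul_sub hf hg).comp (continuous_id.prodMk continuous_id)

lemma conv_comm (f g : ℝ → ℝ) (x : ℝ) : conv f g x = conv g f x := by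
  have := intervalIntegral.integral_comp_sub_left (a := 0) (b := x) (fun r => g r * f (x - r)) x
  simp only [sub_sub_cancel, sub_self, sub_zero] at this
  rw [conv, conv, ← this]
  exact intervalIntegral.integral_congr fun r _ => mul_comm _ _

lemma conv_congr {f f' g g' : ℝ → ℝ} {x : ℝ} (hx : 0 ≤ x)
    (hf : ∀ᵐ r, r ∈ Ioc 0 x → f r = f' r) (hg : ∀ r ∈ Ico 0 x, g r = g' r) :
    conv f g x = conv f' g' x := by
  refine intervalIntegral.integral_congr_ae ?_
  filter_upwards [hf] with r hr hrm
  rw [uIoc_of_le hx] at hrm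
  rw [hr hrm, hg _ ⟨by linarith [hrm.2], by linarith [hrm.1]⟩]

/-- Fubini's theorem on the triangle `0 ≤ z ≤ y ≤ x`. -/
lemma integral_triangle_swap {x : ℝ} (hx : 0 ≤ x) {F : ℝ → ℝ → ℝ}
    (hF : IntegrableOn (fun q : ℝ × ℝ => if q.2 ≤ q.1 then F q.1 q.2 else 0)
      (Ioc 0 x ×ˢ Ioc 0 x)) :
    ∫ y in (0 : ℝ)..x, ∫ z in (0 : ℝ)..y, F y z = ∫ z in (0 : ℝ)..x, ∫ y in z..x, F y z := by
  have h := intervalIntegral_intervalIntegral_swap (a := 0) (b := x) (c := 0) (d := x)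
    (F := fun y z => if z ≤ y then F y z else 0) (by rw [uIoc_of_le hx]; exact hF)
  have h1 : ∀ y ∈ uIcc 0 x, ∫ z in (0 : ℝ)..x, (if z ≤ y then F y z else 0) =
      ∫ z in (0 : ℝ)..y, F y z := by
    intro y hy
    rw [uIcc_of_le hx] at hy
    rw [← intervalIntegral.integral_indicator hy]
    exact intervalIntegral.integral_congr fun z _ => by simp [indicator]
  have h2 : ∀ z ∈ uIcc 0 x, ∫ y in (0 : ℝ)..x, (if z ≤ y then F y z else 0) =
      ∫ y in z..x, F y z := by
    intro z hz
    rw [uIcc_of_le hx] at hz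
    have e : (fun y => if z ≤ y then F y z else 0) = indicator (Ici z) fun y => F y z := by
      ext y; simp [indicator]
    rw [e, intervalIntegral.integral_of_le hx, intervalIntegral.integral_of_le hz.2,
      integral_indicator measurableSet_Ici, Measure.restrict_restrict measurableSet_Ici]
    refine setIntegral_congr_set ?_
    have : (Ioi z ∩ Ioc 0 x : Set ℝ) = Ioc z x := by
      ext y; simp only [mem_inter_iff, mem_Ioi, mem_Ioc]
      exact ⟨fun h => ⟨h.1, h.2.2⟩, fun h => ⟨h.1, hz.1.trans_lt h.1, h.2⟩⟩
    rw [← this]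
    exact Ioi_ae_eq_Ici.symm.inter (ae_eq_refl _)
  rw [intervalIntegral.integral_congr h1, intervalIntegral.integral_congr h2] at h
  exact h

lemma conv_assoc {f g h : ℝ → ℝ} {x C D : ℝ} (hx : 0 ≤ x) (hf : IntervalIntegrable f volume 0 x)
    (hg : Measurable g) (hgC : ∀ r ∈ Icc 0 x, |g r| ≤ C)
    (hh : Measurable h) (hhD : ∀ r ∈ Icc 0 x, |h r| ≤ D) :
    conv (conv f g) h x = conv f (conv g h) x := by
  have hC : 0 ≤ C := (abs_nonneg _).trans (hgC 0 ⟨le_rfl, hx⟩)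
  have hfi : Integrable f (volume.restrict (Ioc 0 x)) := by
    rwa [intervalIntegrable_iff, uIoc_of_le hx] at hf
  have hF : IntegrableOn (fun q : ℝ × ℝ => if q.2 ≤ q.1 then f q.2 * g (q.1 - q.2) * h (x - q.1)
      else 0) (Ioc 0 x ×ˢ Ioc 0 x) := by
    have h1 : Integrable (fun q : ℝ × ℝ => f q.2)
        ((volume.restrict (Ioc 0 x)).prod (volume.restrict (Ioc 0 x))) := hfi.comp_snd _
    rw [IntegrableOn, Measure.volume_eq_prod, ← Measure.prod_restrict]
    have h2 : Measurable fun q : ℝ × ℝ => if q.2 ≤ q.1 then g (q.1 - q.2) * h (x - q.1) else 0 := by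
      refine Measurable.ite (measurableSet_le measurable_snd measurable_fst) ?_ measurable_const
      exact (hg.comp (measurable_fst.sub measurable_snd)).mul
        (hh.comp (measurable_const.sub measurable_fst))
    have h3 := h1.mul_bdd (c := C * D) h2.aestronglyMeasurable ?_
    · refine h3.congr (Eventually.of_forall fun q => ?_)
      dsimp only
      split_ifs <;> ring
    · rw [Measure.prod_restrict]
      refine (ae_restrict_mem (measurableSet_Ioc.prod measurableSet_Ioc)).mono fun q hq => ?_
      obtain ⟨⟨a1, a2⟩, ⟨b1, b2⟩⟩ := hq
      split_ifs with hle
      · rw [norm_mul]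
        exact mul_le_mul (hgC _ ⟨by linarith, by linarith⟩) (hhD _ ⟨by linarith, by linarith⟩)
          (norm_nonneg _) hC
      · simp only [norm_zero]
        exact mul_nonneg hC ((abs_nonneg _).trans (hhD 0 ⟨le_rfl, hx⟩))
  have key := integral_triangle_swap hx (F := fun y z => f z * g (y - z) * h (x - y)) hF
  calc conv (conv f g) h x = ∫ y in (0 : ℝ)..x, ∫ z in (0 : ℝ)..y, f z * g (y - z) * h (x - y) := by
        simp only [conv, intervalIntegral.integral_mul_const]
    _ = _ := key
    _ = conv f (conv g h) x := by
        refine intervalIntegral.integral_congr fun z _ => ?_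
        have e := intervalIntegral.integral_comp_sub_right (a := z) (b := x)
          (fun u => f z * (g u * h (x - z - u))) z
        simp only [sub_self] at e
        rw [conv, ← intervalIntegral.integral_const_mul, ← e]
        refine intervalIntegral.integral_congr fun y _ => ?_
        rw [sub_sub_sub_cancel_right, mul_assoc]

/-- A Volterra equation whose kernel has small mass is solved by a contraction. -/
lemma exists_volterra_of_small {X : ℝ} (hX : 0 ≤ X) {H f : ℝ → ℝ} (hH : IsPC H)
    (hf : Continuous f) (hs : ∫ r in (0 : ℝ)..X, |H r| ≤ 1 / 2) :
    ∃ u : ℝ → ℝ, Continuous u ∧ ∀ x ∈ Icc 0 X, u x = f x + conv H u x := by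
  have cont : ∀ u : C(Icc 0 X, ℝ), Continuous (IccExtend hX u) := fun u => u.continuous.Icc_extend'
  let Φ : C(Icc 0 X, ℝ) → C(Icc 0 X, ℝ) := fun u =>
    ⟨fun x => f x + conv H (IccExtend hX u) x, (hf.comp continuous_subtype_val).add
      ((continuous_conv hH.intervalIntegrable (IsPC.of_continuous (cont u))).comp
        continuous_subtype_val)⟩
  have hΦ : ContractingWith (1 / 2) Φ := by
    refine ⟨by norm_num, LipschitzWith.of_dist_le_mul fun u v => ?_⟩
    rw [ContinuousMap.dist_le (by positivity)]
    rintro ⟨x, hx⟩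
    simp only [Φ, ContinuousMap.coe_mk, Real.dist_eq, add_sub_add_left_eq_sub, conv]
    rw [← intervalIntegral.integral_sub
      ((IsPC.of_continuous (cont u)).intervalIntegrable_mul_sub (hH.intervalIntegrable _ _) x)
      ((IsPC.of_continuous (cont v)).intervalIntegrable_mul_sub (hH.intervalIntegrable _ _) x),
      ← Real.norm_eq_abs]
    have h1 : ∫ r in (0 : ℝ)..x, |H r| ≤ 1 / 2 := by
      refine le_trans ?_ hs
      exact intervalIntegral.integral_mono_interval le_rfl hx.1 hx.2
        (Eventually.of_forall fun _ => abs_nonneg _) (hH.intervalIntegrable _ _).abs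
    calc _ ≤ ∫ r in (0 : ℝ)..x, |H r| * dist u v := by
          refine intervalIntegral.norm_integral_le_of_norm_le hx.1
            (Eventually.of_forall fun r _ => ?_) ((hH.intervalIntegrable _ _).abs.mul_const _)
          rw [← mul_sub, norm_mul]
          exact mul_le_mul_of_nonneg_left (u.dist_apply_le_dist (g := v) _) (norm_nonneg _)
      _ = (∫ r in (0 : ℝ)..x, |H r|) * dist u v := intervalIntegral.integral_mul_const _ _
      _ ≤ _ := by
          refine mul_le_mul_of_nonneg_right (h1.trans (le_of_eq ?_)) dist_nonneg
          norm_num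
  let u₀ : C(Icc 0 X, ℝ) := ContractingWith.fixedPoint Φ hΦ
  have hfix : Φ u₀ = u₀ := hΦ.fixedPoint_isFixedPt
  refine ⟨IccExtend hX u₀, cont _, fun x hx => ?_⟩
  rw [IccExtend_of_mem _ _ hx]
  conv_lhs => rw [← hfix]
  rfl

/-- The Volterra equation `u = f + H * u` on `[0, X]` has a continuous solution. -/
lemma exists_volterra {X : ℝ} (hX : 0 ≤ X) {H f : ℝ → ℝ} (hH : IsPC H)
    (hf : Continuous f) :
    ∃ u : ℝ → ℝ, Continuous u ∧ ∀ x ∈ Icc 0 X, u x = f x + conv H u x := by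
  obtain ⟨C, hC⟩ := hH.bounded X
  have hC0 : 0 ≤ C := (abs_nonneg _).trans (hC 0 (by simpa using hX))
  -- an exponential weight with a large exponent makes the mass of the kernel small
  set K : ℝ := 2 * C + 1 with hK
  have hK0 : 0 < K := by positivity
  have hHK : IsPC fun r => Real.exp (-(K * r)) * H r := by
    have hec : Continuous fun r : ℝ => Real.exp (-(K * r)) := by fun_prop
    refine ⟨hec.measurable.mul hH.measurable, fun R => ?_, ?_⟩
    · obtain ⟨C1, h1⟩ := (IsPC.of_continuous hec).bounded R
      obtain ⟨C2, h2⟩ := hH.bounded R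
      refine ⟨C1 * C2, fun r hr => ?_⟩
      rw [abs_mul]
      exact mul_le_mul (h1 r hr) (h2 r hr) (abs_nonneg _) ((abs_nonneg _).trans (h1 r hr))
    · exact hH.countable.mono fun x hx h => hx (hec.continuousAt.mul h)
  have hsmall : ∫ r in (0 : ℝ)..X, |Real.exp (-(K * r)) * H r| ≤ 1 / 2 := by
    have hint : ∫ r in (0 : ℝ)..X, Real.exp (-(K * r)) ≤ 1 / K := by
      have hd : ∀ r ∈ uIcc 0 X, HasDerivAt (fun r => -(1 / K) * Real.exp (-(K * r)))
          (Real.exp (-(K * r))) r := by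
        intro r _
        have := ((((hasDerivAt_id r).const_mul K).neg).exp).const_mul (-(1 / K))
        refine this.congr_deriv ?_
        simp only [Pi.neg_apply, id]; field_simp
      rw [intervalIntegral.integral_eq_sub_of_hasDerivAt hd
        (Continuous.intervalIntegrable (by fun_prop) _ _)]
      have := Real.exp_pos (-(K * X))
      have h2 : 0 ≤ 1 / K * Real.exp (-(K * X)) := by positivity
      simp only [mul_zero, neg_zero, Real.exp_zero]
      linarith
    calc ∫ r in (0 : ℝ)..X, |Real.exp (-(K * r)) * H r| ≤ ∫ r in (0 : ℝ)..X,
          Real.exp (-(K * r)) * C := by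
          refine intervalIntegral.integral_mono_on hX (hHK.intervalIntegrable _ _).abs
            (Continuous.intervalIntegrable (by fun_prop) _ _) fun r hr => ?_
          rw [abs_mul, abs_of_pos (Real.exp_pos _)]
          refine mul_le_mul_of_nonneg_left (hC r ?_) (Real.exp_pos _).le
          rw [abs_of_nonneg hr.1]; exact hr.2
      _ ≤ 1 / K * C := by
          rw [intervalIntegral.integral_mul_const]
          exact mul_le_mul_of_nonneg_right hint hC0
      _ ≤ 1 / 2 := by
          rw [div_mul_eq_mul_div, one_mul, div_le_iff₀ hK0]; linarith
  obtain ⟨u, hu, hsol⟩ := exists_volterra_of_small (f := fun x => Real.exp (-(K * x)) * f x)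
    hX hHK (by fun_prop) hsmall
  refine ⟨fun x => Real.exp (K * x) * u x, by fun_prop, fun x hx => ?_⟩
  dsimp only
  rw [hsol x hx, mul_add, ← mul_assoc, ← Real.exp_add, add_neg_cancel, Real.exp_zero, one_mul,
    conv, conv, ← intervalIntegral.integral_const_mul]
  congr 1
  refine intervalIntegral.integral_congr fun r _ => ?_
  have : Real.exp (K * (x - r)) = Real.exp (K * x) * Real.exp (-(K * r)) := by
    rw [← Real.exp_add]; ring_nf
  simp only [this]; ring

/-- The resolvent `ρ = H + H * ρ` of a Volterra kernel. Only `ρ - H` is continuous. -/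
lemma exists_resolvent {X : ℝ} (hX : 0 ≤ X) {H : ℝ → ℝ} (hH : IsPC H) :
    ∃ ρ : ℝ → ℝ, IsPC ρ ∧ ∀ x ∈ Icc 0 X, ρ x = H x + conv H ρ x := by
  obtain ⟨s, hs, hsol⟩ := exists_volterra hX hH (continuous_conv hH.intervalIntegrable hH)
  refine ⟨fun x => H x + s x, hH.add (IsPC.of_continuous hs), fun x hx => ?_⟩
  dsimp only
  rw [hsol x hx, conv, conv, conv, ← intervalIntegral.integral_add
    (hH.intervalIntegrable_mul_sub (hH.intervalIntegrable _ _) x)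
    ((IsPC.of_continuous hs).intervalIntegrable_mul_sub (hH.intervalIntegrable _ _) x)]
  simp only [mul_add]

/-- With the resolvent `ρ`, the function `f + f * ρ` solves `p = f + p * H`, for integrable `f`. -/
lemma conv_resolvent {X : ℝ} {H ρ f : ℝ → ℝ} (hH : IsPC H) (hρ : IsPC ρ)
    (hres : ∀ x ∈ Icc 0 X, ρ x = H x + conv H ρ x)
    (hf : ∀ a b, IntervalIntegrable f volume a b) {x : ℝ} (hx : x ∈ Icc 0 X) :
    f x + conv f ρ x = f x + conv (fun y => f y + conv f ρ y) H x := by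
  have hc := continuous_conv hf hρ
  have h1 : conv (fun y => f y + conv f ρ y) H x = conv f H x + conv (conv f ρ) H x := by
    rw [conv, conv, conv, ← intervalIntegral.integral_add
      (hH.intervalIntegrable_mul_sub (hf _ _) x)
      (hH.intervalIntegrable_mul_sub (hc.intervalIntegrable _ _) x)]
    simp only [add_mul]
  obtain ⟨C, hC⟩ := hρ.bounded x
  obtain ⟨D, hD⟩ := hH.bounded x
  have h2 : conv (conv f ρ) H x = conv f (conv ρ H) x :=
    conv_assoc hx.1 (hf _ _) hρ.measurable (fun r hr => hC r (by rw [abs_of_nonneg hr.1]; exact hr.2))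
      hH.measurable (fun r hr => hD r (by rw [abs_of_nonneg hr.1]; exact hr.2))
  have h3 : conv f (conv ρ H) x = conv f (fun y => ρ y - H y) x := by
    refine conv_congr hx.1 (Eventually.of_forall fun _ _ => rfl) fun r hr => ?_
    rw [conv_comm]
    linarith [hres r ⟨hr.1, hr.2.le.trans hx.2⟩]
  have h4 : conv f (fun y => ρ y - H y) x = conv f ρ x - conv f H x := by
    rw [conv, conv, conv, ← intervalIntegral.integral_sub
      (hρ.intervalIntegrable_mul_sub (hf _ _) x)
      (hH.intervalIntegrable_mul_sub (hf _ _) x)]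
    simp only [mul_sub]
  rw [h1, h2, h3, h4]; ring

/-! ### The kernel equations -/

/-- A function that is continuous on a segment and has vanishing derivative in the direction
`(p, q)` inside it takes the same value at both endpoints. -/
lemma eq_of_hasDerivAt_zero_along {F : ℝ → ℝ → ℝ} {p q x y s₀ : ℝ} (hs₀ : 0 ≤ s₀)
    (hcont : ContinuousOn (fun s => F (x - p * s) (y - q * s)) (Icc 0 s₀))
    (hd : ∀ s ∈ Ioo 0 s₀,
      HasDerivAt (fun r => F (x - p * s + p * r) (y - q * s + q * r)) 0 0) :
    F x y = F (x - p * s₀) (y - q * s₀) := by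
  rcases hs₀.eq_or_lt with rfl | hpos
  · simp
  have hd' : ∀ s ∈ Ioo 0 s₀, HasDerivAt (fun s => F (x - p * s) (y - q * s)) 0 s := by
    intro s hs
    have h1 : HasDerivAt (fun r : ℝ => s - r) (-1) s := by
      simpa using (hasDerivAt_id s).const_sub s
    have h2 := HasDerivAt.comp (h := fun r : ℝ => s - r) s
      (h₂ := fun r => F (x - p * s + p * r) (y - q * s + q * r)) (h₂' := 0)
      (by simpa using hd s hs) h1
    simp only [zero_mul] at h2
    refine h2.congr_of_eventuallyEq (Eventually.of_forall fun r => ?_)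
    simp only [Function.comp]
    congr 1 <;> ring
  obtain ⟨c, hc, h⟩ := exists_hasDerivAt_eq_slope _ _ hpos hcont hd'
  have h3 := (div_eq_zero_iff.1 h.symm).resolve_right (by linarith)
  simp only [mul_zero, sub_zero] at h3
  linarith

namespace Traffic

variable (P : Traffic)

/-- The ratio `v* / (γ p*)`. -/
def kap : ℝ := P.vs / (P.γ * P.ps)

/-- The part of the Volterra kernel of the closed loop that stems from the routing gain `a`. It jumps
at the ends of `[0, k₁L]`. -/
def kerA (a : ℝ → ℝ) : ℝ → ℝ :=
  (Icc 0 (P.k1 * P.L)).indicator fun r => P.mu * a (P.mu * r)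

/-- The part of the Volterra kernel of the closed loop that stems from the in-domain coupling. -/
def kerE (r : ℝ) : ℝ := P.c (P.kap * r) / (P.γ * P.ps)

/-- The Volterra kernel of the closed loop. -/
def kerH (a : ℝ → ℝ) (r : ℝ) : ℝ := P.kerA a r + P.kerE r

/-- The spatial damping factor `exp (-y / (τ v*))`. -/
def damp (y : ℝ) : ℝ := Real.exp (-(y / (P.τ * P.vs)))

/-- The kernel `m` in terms of `g = l(·, 0)`. -/
def kerM (a g : ℝ → ℝ) (x y : ℝ) : ℝ :=
  ∫ r in (P.k1 * y)..(x + P.k1 * y), P.kerA a r * g (x + P.k1 * y - r)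

/-- The kernel `l` in terms of `g = l(·, 0)`. -/
def kerL (a g : ℝ → ℝ) (x y : ℝ) : ℝ :=
  P.damp y * (conv P.kerE g (x - y) - P.kerE (x - y)) + P.kerM a g x y

lemma k1_mul_vs : P.k1 * P.vs = P.lam := by rw [k1, div_mul_cancel₀ _ P.vs_pos.ne']

lemma mu_mul_k1 : P.mu * P.k1 = 1 := by rw [mu_eq, inv_mul_cancel₀ P.k1_pos.ne']

lemma lam_mul_mu : P.lam * P.mu = P.vs := by rw [mu, mul_div_cancel₀ _ P.lam_pos.ne']

lemma L_div_mu : P.L / P.mu = P.k1 * P.L := by rw [mu_eq, div_inv_eq_mul, mul_comm]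

lemma kap_mul_one_add_k1 : P.kap * (1 + P.k1) = 1 := by
  rw [kap, k1, gamma_ps]
  have h1 := P.vs_pos
  have h2 := P.lam_pos
  field_simp
  ring

variable {P} {a : ℝ → ℝ}

lemma kerA_of_mem {r : ℝ} (h0 : 0 ≤ r) (h1 : r ≤ P.k1 * P.L) :
    P.kerA a r = P.mu * a (P.mu * r) := indicator_of_mem (s := Icc 0 (P.k1 * P.L)) ⟨h0, h1⟩ _

lemma kerA_of_gt {r : ℝ} (h : P.k1 * P.L < r) : P.kerA a r = 0 :=
  indicator_of_notMem (fun hr => not_lt.2 hr.2 h) _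

lemma kerA_k1_mul {y : ℝ} (hy : y ∈ Icc 0 P.L) : P.kerA a (P.k1 * y) = P.mu * a y := by
  rw [kerA_of_mem (mul_nonneg P.k1_pos.le hy.1) (mul_le_mul_of_nonneg_left hy.2 P.k1_pos.le),
    ← mul_assoc, mu_mul_k1, one_mul]

lemma aCheck_eq : P.aCheck a = fun x => P.lam * P.kerA a x := by
  ext x
  rw [aCheck, kerA, L_div_mu]
  by_cases hx : x ∈ Icc 0 (P.k1 * P.L)
  · rw [indicator_of_mem hx, indicator_of_mem hx, ← mul_assoc, lam_mul_mu]
  · rw [indicator_of_notMem hx, indicator_of_notMem hx, mul_zero]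

lemma kerA_eq_extend : P.kerA a = (Icc 0 (P.k1 * P.L)).indicator fun r =>
    P.mu * IccExtend P.L_pos.le ((Icc 0 P.L).domRestrict a) (P.mu * r) := by
  ext r
  by_cases hr : r ∈ Icc 0 (P.k1 * P.L)
  · have h : P.mu * r ∈ Icc 0 P.L := by
      refine ⟨mul_nonneg P.mu_pos.le hr.1, ?_⟩
      have := mul_le_mul_of_nonneg_left hr.2 P.mu_pos.le
      rwa [← mul_assoc, mu_mul_k1, one_mul] at this
    rw [kerA, indicator_of_mem hr, indicator_of_mem hr, IccExtend_of_mem _ _ h, domRestrict_apply]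
  · rw [kerA, indicator_of_notMem hr, indicator_of_notMem hr]

lemma continuous_extend (ha : ContinuousOn a (Icc 0 P.L)) :
    Continuous fun r => P.mu * IccExtend P.L_pos.le ((Icc 0 P.L).domRestrict a) (P.mu * r) :=
  continuous_const.mul ((continuousOn_iff_continuous_domRestrict.1 ha).Icc_extend'.comp
    (continuous_const.mul continuous_id))

lemma isPC_kerA (ha : ContinuousOn a (Icc 0 P.L)) : IsPC (P.kerA a) := by
  have hc := continuous_extend ha
  rw [kerA_eq_extend]
  refine ⟨hc.measurable.indicator measurableSet_Icc, fun R => ?_, ?_⟩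
  · obtain ⟨C, hC⟩ := (IsPC.of_continuous hc).bounded R
    refine ⟨C, fun r hr => ?_⟩
    by_cases h : r ∈ Icc 0 (P.k1 * P.L)
    · rw [indicator_of_mem h]; exact hC r hr
    · rw [indicator_of_notMem h, abs_zero]; exact (abs_nonneg _).trans (hC r hr)
  · refine ((finite_singleton (P.k1 * P.L)).insert 0).countable.mono fun x hx => ?_
    by_contra h
    simp only [mem_insert_iff, mem_singleton_iff, not_or] at h
    refine hx ?_
    refine ContinuousOn.continuousAt_indicator hc.continuousOn ?_
    rw [frontier_Icc (mul_pos P.k1_pos P.L_pos).le]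
    simp [h]

lemma continuousAt_kerA (ha : ContinuousOn a (Icc 0 P.L)) {r : ℝ} (h0 : 0 < r)
    (h1 : r < P.k1 * P.L) : ContinuousAt (P.kerA a) r := by
  rw [kerA_eq_extend]
  refine ContinuousOn.continuousAt_indicator (continuous_extend ha).continuousOn ?_
  rw [frontier_Icc (mul_pos P.k1_pos P.L_pos).le]
  simp [h0.ne', h1.ne]

lemma continuous_kerE : Continuous P.kerE := by unfold kerE c; fun_prop

lemma isPC_kerH (ha : ContinuousOn a (Icc 0 P.L)) : IsPC (P.kerH a) :=
  (isPC_kerA ha).add (IsPC.of_continuous continuous_kerE)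

lemma continuous_damp : Continuous P.damp := by unfold damp; fun_prop

lemma damp_add (x y : ℝ) : P.damp (x + y) = P.damp x * P.damp y := by
  rw [damp, damp, damp, ← Real.exp_add]; ring_nf

lemma c_eq (x : ℝ) : P.c x = P.c 0 * P.damp x := by simp [c, damp]

lemma kerE_eq (x : ℝ) : P.kerE x = P.kerE 0 * P.damp (P.kap * x) := by
  rw [kerE, c_eq, kerE, mul_zero]; ring

lemma hasDerivAt_damp (x : ℝ) : HasDerivAt P.damp (-(1 / (P.τ * P.vs)) * P.damp x) x := by
  have := (((hasDerivAt_id x).div_const (P.τ * P.vs)).neg).exp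
  refine this.congr_deriv ?_
  simp only [damp, Pi.neg_apply, id]; ring

lemma hasDerivAt_kerE (x : ℝ) :
    HasDerivAt P.kerE (-(P.kap / (P.τ * P.vs)) * P.kerE x) x := by
  have h := ((hasDerivAt_damp (P := P) (P.kap * x)).comp x
    ((hasDerivAt_id x).const_mul P.kap)).const_mul (P.kerE 0)
  have e : P.kerE = fun y => P.kerE 0 * (P.damp ∘ fun y => P.kap * id y) y := by
    ext y; rw [kerE_eq]; rfl
  rw [e]
  refine h.congr_deriv ?_
  simp only [Function.comp, id]
  ring

/-- Because `kerE` is an exponential, its convolution with `g` solves a differential equation. -/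
lemma hasDerivAt_conv_kerE {g : ℝ → ℝ} (hg : Continuous g) (x : ℝ) :
    HasDerivAt (conv P.kerE g)
      (-(P.kap / (P.τ * P.vs)) * conv P.kerE g x + P.kerE 0 * g x) x := by
  have e : ∀ y, conv P.kerE g y = P.kerE y * ∫ r in (0 : ℝ)..y, g r * P.damp (-(P.kap * r)) := by
    intro y
    rw [conv_comm, conv, ← intervalIntegral.integral_const_mul]
    refine intervalIntegral.integral_congr fun r _ => ?_
    rw [kerE_eq, kerE_eq y, mul_sub, sub_eq_add_neg, damp_add]; ring
  have hc : Continuous fun r => g r * P.damp (-(P.kap * r)) :=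
    hg.mul (continuous_damp.comp (by fun_prop))
  have h := (hasDerivAt_kerE (P := P) x).mul (hc.integral_hasStrictDerivAt 0 x).hasDerivAt
  have e' : conv P.kerE g = P.kerE * fun y => ∫ r in (0 : ℝ)..y, g r * P.damp (-(P.kap * r)) := by
    ext y; rw [e y]; rfl
  have h1 : P.damp (P.kap * x) * P.damp (-(P.kap * x)) = 1 := by
    rw [← damp_add]; simp [damp]
  rw [e']
  refine h.congr_deriv ?_
  rw [← e', e x, kerE_eq x]
  linear_combination (P.kerE 0 * g x) * h1

lemma continuous_kerM (ha : ContinuousOn a (Icc 0 P.L)) {g : ℝ → ℝ} (hg : Continuous g) :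
    Continuous fun p : ℝ × ℝ => P.kerM a g p.1 p.2 := by
  have hA := (isPC_kerA ha)
  have h := continuous_integral_mul_sub hA.intervalIntegrable (IsPC.of_continuous hg)
  have e : (fun p : ℝ × ℝ => P.kerM a g p.1 p.2) = fun p =>
      (∫ r in (0 : ℝ)..(p.1 + P.k1 * p.2), P.kerA a r * g (p.1 + P.k1 * p.2 - r)) -
      ∫ r in (0 : ℝ)..(P.k1 * p.2), P.kerA a r * g (p.1 + P.k1 * p.2 - r) := by
    ext p
    have hI := fun b => (IsPC.of_continuous hg).intervalIntegrable_mul_sub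
      (hA.intervalIntegrable 0 b) (p.1 + P.k1 * p.2)
    rw [intervalIntegral.integral_interval_sub_left (hI _) (hI _)]
    rfl
  rw [e]
  exact (h.comp (f := fun p : ℝ × ℝ => (p.1 + P.k1 * p.2, p.1 + P.k1 * p.2)) (by fun_prop)).sub
    (h.comp (f := fun p : ℝ × ℝ => (p.1 + P.k1 * p.2, P.k1 * p.2)) (by fun_prop))

lemma continuous_kerL (ha : ContinuousOn a (Icc 0 P.L)) {g : ℝ → ℝ} (hg : Continuous g) :
    Continuous fun p : ℝ × ℝ => P.kerL a g p.1 p.2 := by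
  have h1 := continuous_conv (continuous_kerE (P := P)).intervalIntegrable (IsPC.of_continuous hg)
  have h2 := continuous_kerE (P := P)
  have h3 := continuous_damp (P := P)
  exact ((h3.comp continuous_snd).mul ((h1.comp (by fun_prop)).sub (h2.comp (by fun_prop)))).add
    (continuous_kerM ha hg)

/-- The equation for `m`. Differentiability needs only continuity of `a`, because along a
characteristic the variable enters through a limit of integration. -/
lemma hasDerivAt_kerM (ha : ContinuousOn a (Icc 0 P.L)) {g : ℝ → ℝ} (hg : Continuous g)
    (x : ℝ) {y : ℝ} (h0 : 0 < y) (h1 : y < P.L) :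
    HasDerivAt (fun s => P.kerM a g (x + P.lam * s) (y - P.vs * s)) (P.vs * g x * a y) 0 := by
  have hA := (isPC_kerA ha)
  -- the upper limit `x + k₁ y` is constant along the characteristic
  have e : (fun s => P.kerM a g (x + P.lam * s) (y - P.vs * s)) = fun s =>
      ∫ r in (P.k1 * y - P.lam * s)..(x + P.k1 * y), P.kerA a r * g (x + P.k1 * y - r) := by
    ext s
    have e1 : P.k1 * (y - P.vs * s) = P.k1 * y - P.lam * s := by
      rw [← k1_mul_vs]; ring
    have e2 : x + P.lam * s + (P.k1 * y - P.lam * s) = x + P.k1 * y := by ring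
    rw [kerM, e1, e2]
  have hI := (IsPC.of_continuous hg).intervalIntegrable_mul_sub
    (hA.intervalIntegrable (P.k1 * y - P.lam * 0) (x + P.k1 * y)) (x + P.k1 * y)
  have hy : P.k1 * y - P.lam * 0 = P.k1 * y := by ring
  have hcA : ContinuousAt (P.kerA a) (P.k1 * y - P.lam * 0) := by
    rw [hy]
    exact continuousAt_kerA ha (mul_pos P.k1_pos h0) (mul_lt_mul_of_pos_left h1 P.k1_pos)
  have hcg : Continuous fun r => g (x + P.k1 * y - r) := hg.comp (by fun_prop)
  have hm : StronglyMeasurable fun r => P.kerA a r * g (x + P.k1 * y - r) :=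
    (hA.measurable.mul hcg.measurable).stronglyMeasurable
  have h2 := intervalIntegral.integral_hasDerivAt_left hI
    (hm.stronglyMeasurableAtFilter) (hcA.mul hcg.continuousAt)
  have h3 : HasDerivAt (fun s : ℝ => P.k1 * y - P.lam * s) (-P.lam) 0 := by
    simpa using ((hasDerivAt_id (0 : ℝ)).const_mul P.lam).const_sub (P.k1 * y)
  rw [e]
  refine (HasDerivAt.comp (h := fun s : ℝ => P.k1 * y - P.lam * s) 0 h2 h3).congr_deriv ?_
  rw [hy, kerA_k1_mul ⟨h0.le, h1.le⟩, add_sub_cancel_right, ← lam_mul_mu]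
  ring

/-- The equation for `l`. -/
lemma hasDerivAt_kerL (ha : ContinuousOn a (Icc 0 P.L)) {g : ℝ → ℝ} (hg : Continuous g)
    (x : ℝ) {y : ℝ} (h0 : 0 < y) (h1 : y < P.L) :
    HasDerivAt (fun s => P.kerL a g (x + P.lam * s) (y - P.vs * s))
      (P.c y * g (x - y) + P.vs * g x * a y) 0 := by
  have hd : HasDerivAt (fun s : ℝ => y - P.vs * s) (-P.vs) 0 := by
    simpa using ((hasDerivAt_id (0 : ℝ)).const_mul P.vs).const_sub y
  have hX : HasDerivAt (fun s : ℝ => x + P.lam * s - (y - P.vs * s)) (P.lam + P.vs) 0 := by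
    have := (((hasDerivAt_id (0 : ℝ)).const_mul P.lam).const_add x).sub hd
    simpa using! this
  have d1 := HasDerivAt.comp (h := fun s : ℝ => y - P.vs * s) 0 (hasDerivAt_damp (P := P) _) hd
  have d2 := HasDerivAt.comp (h := fun s : ℝ => x + P.lam * s - (y - P.vs * s)) 0
    (hasDerivAt_conv_kerE (P := P) hg _) hX
  have d3 := HasDerivAt.comp (h := fun s : ℝ => x + P.lam * s - (y - P.vs * s)) 0
    (hasDerivAt_kerE (P := P) _) hX
  have d := (d1.mul (d2.sub d3)).add (hasDerivAt_kerM ha hg x h0 h1)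
  refine d.congr_deriv ?_
  have hc0 : P.kerE 0 * (P.γ * P.ps) = P.c 0 := by
    rw [kerE, mul_zero, div_mul_cancel₀ _ P.gamma_ps_pos.ne']
  have hk : P.kap * (P.γ * P.ps) = P.vs := by
    rw [kap, div_mul_cancel₀ _ P.gamma_ps_pos.ne']
  simp only [Function.comp, mul_zero, add_zero, sub_zero, c_eq y, Pi.sub_apply]
  rw [gamma_ps] at hc0 hk
  linear_combination P.damp y * g (x - y) * hc0 -
    (P.damp y * (conv P.kerE g (x - y) - P.kerE (x - y)) / (P.τ * P.vs)) * hk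

end Traffic

namespace Traffic

variable {P : Traffic} {a : ℝ → ℝ}

lemma kerM_zero_left (g : ℝ → ℝ) (y : ℝ) : P.kerM a g 0 y = 0 := by
  rw [kerM, zero_add, intervalIntegral.integral_same]

lemma kerM_right (g : ℝ → ℝ) {x : ℝ} (hx : 0 ≤ x) : P.kerM a g x P.L = 0 := by
  rw [kerM]
  refine intervalIntegral.integral_zero_ae (Eventually.of_forall fun r hr => ?_)
  rw [uIoc_of_le (by linarith)] at hr
  rw [kerA_of_gt hr.1, zero_mul]

lemma kerM_zero_right (g : ℝ → ℝ) (x : ℝ) : P.kerM a g x 0 = conv (P.kerA a) g x := by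
  simp [kerM, conv]

lemma kerL_zero_right {g : ℝ → ℝ} (x : ℝ) :
    P.kerL a g x 0 = conv P.kerE g x - P.kerE x + conv (P.kerA a) g x := by
  rw [kerL, kerM_zero_right]; simp [damp]

/-- The boundary condition of `l` on the diagonal. -/
lemma kerL_self (g : ℝ → ℝ) (x : ℝ) :
    P.kerL a g x x = P.kerM a g x x - P.c x / (P.γ * P.ps) := by
  rw [kerL, sub_self, kerE, mul_zero, c_eq x]
  simp only [conv, intervalIntegral.integral_same]
  ring

lemma conv_kerH (ha : ContinuousOn a (Icc 0 P.L)) {g : ℝ → ℝ} (hg : IsPC g) (x : ℝ) :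
    conv (P.kerH a) g x = conv (P.kerA a) g x + conv P.kerE g x := by
  rw [conv, conv, conv, ← intervalIntegral.integral_add
    (hg.intervalIntegrable_mul_sub ((isPC_kerA ha).intervalIntegrable _ _) x)
    (hg.intervalIntegrable_mul_sub (continuous_kerE.intervalIntegrable _ _) x)]
  simp only [kerH, add_mul]

/-- The kernel equations have a solution. -/
lemma exists_isKernels (ha : ContinuousOn a (Icc 0 P.L)) : ∃ K : Kernels, P.IsKernels a K := by
  have hA := isPC_kerA ha
  obtain ⟨g, hg, hgs⟩ := exists_volterra P.L_pos.le (isPC_kerH ha) (continuous_kerE (P := P)).neg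
  obtain ⟨σ, hσ, hσs⟩ := exists_volterra P.L_pos.le hA
    ((continuous_conv hA.intervalIntegrable hA).neg)
  have hl0 : ∀ x ∈ Icc 0 P.L, P.kerL a g x 0 = g x := by
    intro x hx
    rw [hgs x hx, conv_kerH ha (IsPC.of_continuous hg), kerL_zero_right, Pi.neg_apply]; ring
  refine ⟨⟨fun x y => g (x - y), P.kerL a g, P.kerM a g, fun x => -P.kerA a x + σ x⟩, ?_⟩
  constructor
  · exact (hg.comp (by fun_prop)).continuousOn
  · exact (continuous_kerL ha hg).continuousOn
  · exact (continuous_kerM ha hg).continuousOn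
  · intro x y _ _ _
    have : (fun s => g (x + s - (y + s))) = fun _ => g (x - y) := by
      ext s; rw [add_sub_add_right_eq_sub]
    simp only [this]
    exact hasDerivAt_const _ _
  · intro x y h0 h1 h2
    simp only [hl0 x ⟨(h0.trans h1).le, h2.le⟩]
    exact hasDerivAt_kerL ha hg x h0 (h1.trans h2)
  · intro x y h0 h1 h2
    simp only [hl0 x ⟨h0.le, (h1.trans h2).le⟩]
    exact hasDerivAt_kerM ha hg x (h0.trans h1) h2
  · intro x hx
    simp only [hl0 x hx, sub_zero, k1_mul_vs, div_self P.lam_pos.ne', one_mul]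
  · intro x hx
    exact kerL_self g x
  · intro x hx
    exact kerM_right g hx.1
  · intro y hy
    exact kerM_zero_left g y
  · have hb : IsPC fun x => -P.kerA a x + σ x := by
      refine IsPC.add ?_ (IsPC.of_continuous hσ)
      refine ⟨hA.measurable.neg, fun R => ?_, ?_⟩
      · simpa using hA.bounded R
      · exact hA.countable.mono fun x hx h => hx (ContinuousAt.neg h)
    obtain ⟨C, hC⟩ := hb.bounded P.L
    refine MemLp.of_bound hb.measurable.aestronglyMeasurable C ?_
    refine (ae_restrict_mem measurableSet_Ioo).mono fun x hx => hC x ?_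
    rw [abs_of_pos hx.1]; exact hx.2.le
  · refine (ae_restrict_mem measurableSet_Ioo).mono fun x hx => ?_
    have hx' := Ioo_subset_Icc_self hx
    rw [aCheck_eq]
    have h1 : ∫ y in (0 : ℝ)..x, P.lam * P.kerA a y * (-P.kerA a (x - y) + σ (x - y)) =
        P.lam * (conv (P.kerA a) σ x - conv (P.kerA a) (P.kerA a) x) := by
      rw [conv, conv, ← intervalIntegral.integral_sub
        ((IsPC.of_continuous hσ).intervalIntegrable_mul_sub (hA.intervalIntegrable _ _) x)
        (hA.intervalIntegrable_mul_sub (hA.intervalIntegrable _ _) x),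
        ← intervalIntegral.integral_const_mul]
      refine intervalIntegral.integral_congr fun r _ => ?_
      ring
    dsimp only
    rw [h1, hσs x hx', ← mul_sub, neg_mul, ← mul_assoc, inv_mul_cancel₀ P.lam_pos.ne']
    simp only [Pi.neg_apply]
    ring

/-- Any solution of the kernel equations is given by the formulas for `kerM` and `kerL` in terms of
one continuous function `g`, which solves a Volterra equation. -/
lemma IsKernels.exists_formulas (ha : ContinuousOn a (Icc 0 P.L)) {K : Kernels}
    (hK : P.IsKernels a K) : ∃ g : ℝ → ℝ, Continuous g ∧
      (∀ x y, 0 ≤ y → y < x → x ≤ P.L → K.k x y = g (x - y)) ∧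
      (∀ x y, 0 ≤ y → y ≤ x → x ≤ P.L → K.l x y = P.kerL a g x y) ∧
      (∀ x y, 0 ≤ x → x ≤ y → y ≤ P.L → K.m x y = P.kerM a g x y) ∧
      ∀ x ∈ Icc 0 P.L, g x = -P.kerE x + conv (P.kerH a) g x := by
  have hlam := P.lam_pos
  have hvs := P.vs_pos
  have hl0c : ContinuousOn (fun x => K.l x 0) (Icc 0 P.L) :=
    hK.l_cont.comp (f := fun x : ℝ => (x, (0 : ℝ))) (by fun_prop)
      fun x hx => ⟨le_rfl, hx.1, hx.2⟩
  obtain ⟨g, hg, hgl⟩ : ∃ g : ℝ → ℝ, Continuous g ∧ ∀ x ∈ Icc 0 P.L, g x = K.l x 0 :=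
    ⟨IccExtend P.L_pos.le ((Icc 0 P.L).domRestrict fun x => K.l x 0),
      (continuousOn_iff_continuous_domRestrict.1 hl0c).Icc_extend',
      fun x hx => by rw [IccExtend_of_mem _ _ hx]; rfl⟩
  -- `k` is constant along the diagonals and is traced back to `y = 0`
  have hk : ∀ x y, 0 ≤ y → y < x → x ≤ P.L → K.k x y = g (x - y) := by
    intro x y h0 h1 h2
    rw [eq_of_hasDerivAt_zero_along (F := K.k) (p := 1) (q := 1) h0]
    · simp only [one_mul, sub_self]
      have hm : x - y ∈ Icc 0 P.L := ⟨by linarith, by linarith⟩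
      rw [hK.k_bc _ hm, hgl _ hm, k1_mul_vs, div_self hlam.ne', one_mul]
    · refine hK.k_cont.comp (f := fun s : ℝ => (x - 1 * s, y - 1 * s)) (by fun_prop) ?_
      intro s hs
      exact ⟨by linarith [hs.2], by linarith, by linarith [hs.1]⟩
    · intro s hs
      have := hK.k_pde (x - 1 * s) (y - 1 * s)
      simp only [one_mul] at this ⊢
      exact this (by linarith [hs.2]) (by linarith) (by linarith [hs.1])
  -- both sides solve the same transport equation; the characteristic is traced back to the first of
  -- the edges `x = 0` and `y = L` that it meets
  have hm : ∀ x y, 0 ≤ x → x ≤ y → y ≤ P.L → K.m x y = P.kerM a g x y := by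
    intro x y h0 h1 h2
    set s₀ := min (x / P.lam) ((P.L - y) / P.vs) with hs₀
    have hs1 : ∀ s ≤ s₀, P.lam * s ≤ x ∧ P.vs * s ≤ P.L - y := by
      intro s hs
      rw [hs₀, le_min_iff, le_div_iff₀ hlam, le_div_iff₀ hvs] at hs
      constructor <;> linarith
    have hs2 : ∀ s < s₀, P.lam * s < x ∧ P.vs * s < P.L - y := by
      intro s hs
      rw [hs₀, lt_min_iff, lt_div_iff₀ hlam, lt_div_iff₀ hvs] at hs
      constructor <;> linarith
    have hs0 : 0 ≤ s₀ := le_min (by positivity) (div_nonneg (by linarith) hvs.le)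
    have h := eq_of_hasDerivAt_zero_along (F := fun x y => K.m x y - P.kerM a g x y)
      (p := P.lam) (q := -P.vs) (x := x) (y := y) hs0 ?_ ?_
    · have hend : K.m (x - P.lam * s₀) (y - -P.vs * s₀) -
          P.kerM a g (x - P.lam * s₀) (y - -P.vs * s₀) = 0 := by
        have hx1 := hs1 s₀ le_rfl
        rcases min_choice (x / P.lam) ((P.L - y) / P.vs) with hc | hc
        · have e : x - P.lam * s₀ = 0 := by
            rw [hs₀, hc, mul_div_cancel₀ _ hlam.ne', sub_self]
          rw [e, kerM_zero_left, hK.m_bc_left _ ⟨by nlinarith, by linarith⟩, sub_zero]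
        · have e : y - -P.vs * s₀ = P.L := by
            rw [hs₀, hc, neg_mul, mul_div_cancel₀ _ hvs.ne']; ring
          rw [e, kerM_right g (by linarith), hK.m_bc_right _ ⟨by linarith, by nlinarith⟩, sub_zero]
      linarith
    · refine ContinuousOn.sub ?_ ((continuous_kerM ha hg).comp
        (f := fun s : ℝ => (x - P.lam * s, y - -P.vs * s)) (by fun_prop)).continuousOn
      refine hK.m_cont.comp (f := fun s : ℝ => (x - P.lam * s, y - -P.vs * s)) (by fun_prop) ?_
      intro s hs
      have := hs1 s hs.2
      have h3 := mul_nonneg hlam.le hs.1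
      have h4 := mul_nonneg hvs.le hs.1
      exact ⟨by dsimp only; linarith, by dsimp only; linarith, by dsimp only; linarith⟩
    · intro s hs
      have := hs2 s hs.2
      have h3 := mul_pos hlam hs.1
      have h4 := mul_pos hvs hs.1
      have d1 := hK.m_pde (x - P.lam * s) (y - -P.vs * s) (by linarith) (by linarith) (by linarith)
      have d2 := hasDerivAt_kerM ha hg (x - P.lam * s) (y := y - -P.vs * s) (by linarith)
        (by linarith)
      rw [hgl _ ⟨by linarith, by linarith⟩] at d2
      have d := d1.sub d2
      rw [sub_self] at d
      refine d.congr_of_eventuallyEq (Eventually.of_forall fun r => ?_)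
      simp only [Pi.sub_apply]
      rw [show y - -P.vs * s + -P.vs * r = y - -P.vs * s - P.vs * r by ring]
  -- for `l` the characteristic is traced back to the diagonal
  have hl : ∀ x y, 0 ≤ y → y ≤ x → x ≤ P.L → K.l x y = P.kerL a g x y := by
    intro x y h0 h1 h2
    set s₀ := (x - y) / (P.lam + P.vs) with hs₀
    have hs0 : 0 ≤ s₀ := div_nonneg (by linarith) (by linarith)
    have hs1 : ∀ s ≤ s₀, (P.lam + P.vs) * s ≤ x - y := by
      intro s hs
      rw [hs₀, le_div_iff₀ (by linarith)] at hs
      linarith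
    have hs2 : ∀ s < s₀, (P.lam + P.vs) * s < x - y := by
      intro s hs
      rw [hs₀, lt_div_iff₀ (by linarith)] at hs
      linarith
    have h := eq_of_hasDerivAt_zero_along (F := fun x y => K.l x y - P.kerL a g x y)
      (p := P.lam) (q := -P.vs) (x := x) (y := y) hs0 ?_ ?_
    · have e : y - -P.vs * s₀ = x - P.lam * s₀ := by
        have : (P.lam + P.vs) * s₀ = x - y := mul_div_cancel₀ _ (by linarith)
        linarith
      have h4 := mul_nonneg hvs.le hs0
      have h3 := mul_nonneg hlam.le hs0
      have hmem : x - P.lam * s₀ ∈ Icc 0 P.L := ⟨by rw [← e]; linarith, by linarith⟩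
      rw [e, hK.l_bc _ hmem, kerL_self, hm _ _ hmem.1 le_rfl hmem.2] at h
      linarith
    · refine ContinuousOn.sub ?_ ((continuous_kerL ha hg).comp
        (f := fun s : ℝ => (x - P.lam * s, y - -P.vs * s)) (by fun_prop)).continuousOn
      refine hK.l_cont.comp (f := fun s : ℝ => (x - P.lam * s, y - -P.vs * s)) (by fun_prop) ?_
      intro s hs
      have := hs1 s hs.2
      have h3 := mul_nonneg hlam.le hs.1
      have h4 := mul_nonneg hvs.le hs.1
      exact ⟨by dsimp only; linarith, by dsimp only; linarith, by dsimp only; linarith⟩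
    · intro s hs
      have := hs2 s hs.2
      have h3 := mul_pos hlam hs.1
      have h4 := mul_pos hvs hs.1
      have d1 := hK.l_pde (x - P.lam * s) (y - -P.vs * s) (by linarith) (by linarith) (by linarith)
      have d2 := hasDerivAt_kerL ha hg (x - P.lam * s) (y := y - -P.vs * s) (by linarith)
        (by linarith)
      rw [hk _ _ (by linarith) (by linarith) (by linarith), ← hgl _ ⟨by linarith, by linarith⟩] at d1
      have d := d1.sub d2
      rw [sub_self] at d
      refine d.congr_of_eventuallyEq (Eventually.of_forall fun r => ?_)
      simp only [Pi.sub_apply]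
      rw [show y - -P.vs * s + -P.vs * r = y - -P.vs * s - P.vs * r by ring]
  refine ⟨g, hg, hk, hl, hm, fun x hx => ?_⟩
  rw [hgl x hx, hl x 0 le_rfl hx.1 hx.2, kerL_zero_right, conv_kerH ha (IsPC.of_continuous hg)]
  ring

end Traffic

/-! ### Convolution algebra -/

section

variable {f g h : ℝ → ℝ} {x : ℝ}

lemma conv_sub_right (hf : IntervalIntegrable f volume 0 x) (hg : IsPC g) (hh : IsPC h) :
    conv f (fun y => g y - h y) x = conv f g x - conv f h x := by
  rw [conv, conv, conv, ← intervalIntegral.integral_sub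
    (hg.intervalIntegrable_mul_sub hf x) (hh.intervalIntegrable_mul_sub hf x)]
  simp only [mul_sub]

lemma conv_add_right (hf : IntervalIntegrable f volume 0 x) (hg : IsPC g) (hh : IsPC h) :
    conv f (fun y => g y + h y) x = conv f g x + conv f h x := by
  rw [conv, conv, conv, ← intervalIntegral.integral_add
    (hg.intervalIntegrable_mul_sub hf x) (hh.intervalIntegrable_mul_sub hf x)]
  simp only [mul_add]

lemma IsPC.conv_assoc (hx : 0 ≤ x) (hf : IntervalIntegrable f volume 0 x) (hg : IsPC g)
    (hh : IsPC h) : conv (conv f g) h x = conv f (conv g h) x := by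
  obtain ⟨C, hC⟩ := hg.bounded x
  obtain ⟨D, hD⟩ := hh.bounded x
  exact _root_.conv_assoc hx hf
    hg.measurable (fun r hr => hC r (by rw [abs_of_nonneg hr.1]; exact hr.2))
    hh.measurable (fun r hr => hD r (by rw [abs_of_nonneg hr.1]; exact hr.2))

lemma conv_congr_left {f' : ℝ → ℝ} (hx : 0 ≤ x) (hf : ∀ r ∈ Ioo 0 x, f r = f' r) :
    conv f g x = conv f' g x := by
  refine conv_congr hx ?_ fun _ _ => rfl
  have : ∀ᵐ r : ℝ, r ≠ x := by simp [ae_iff]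
  filter_upwards [this] with r hr hrm
  exact hf r ⟨hrm.1, lt_of_le_of_ne hrm.2 hr⟩

end

/-- Fubini's theorem on `[0, L]²` for an integrable function times a bounded kernel. -/
lemma integral_kernel_swap {L C D : ℝ} (hL : 0 ≤ L) {f w : ℝ → ℝ} {Q : ℝ → ℝ → ℝ}
    (hf : IntervalIntegrable f volume 0 L) (hQ : Measurable (Function.uncurry Q))
    (hQC : ∀ x ∈ Icc 0 L, ∀ y ∈ Icc 0 L, |Q x y| ≤ C) (hw : Measurable w)
    (hwD : ∀ y ∈ Icc 0 L, |w y| ≤ D) :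
    ∫ y in (0 : ℝ)..L, (∫ x in (0 : ℝ)..L, f x * Q x y) * w y =
      ∫ x in (0 : ℝ)..L, f x * ∫ y in (0 : ℝ)..L, Q x y * w y := by
  have hC : 0 ≤ C := (abs_nonneg _).trans (hQC 0 ⟨le_rfl, hL⟩ 0 ⟨le_rfl, hL⟩)
  have hfi : Integrable f (volume.restrict (Ioc 0 L)) := by
    rwa [intervalIntegrable_iff, uIoc_of_le hL] at hf
  have h1 : Integrable (fun q : ℝ × ℝ => f q.1)
      ((volume.restrict (Ioc 0 L)).prod (volume.restrict (Ioc 0 L))) := hfi.comp_fst _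
  have hm : Measurable fun q : ℝ × ℝ => Q q.1 q.2 * w q.2 := hQ.mul (hw.comp measurable_snd)
  have h2 := h1.mul_bdd (c := C * D) hm.aestronglyMeasurable (by
    rw [Measure.prod_restrict]
    refine (ae_restrict_mem (measurableSet_Ioc.prod measurableSet_Ioc)).mono fun q hq => ?_
    rw [norm_mul]
    exact mul_le_mul (hQC _ (Ioc_subset_Icc_self hq.1) _ (Ioc_subset_Icc_self hq.2))
      (hwD _ (Ioc_subset_Icc_self hq.2)) (norm_nonneg _) hC)
  have h3 := intervalIntegral_intervalIntegral_swap (a := 0) (b := L) (c := 0) (d := L)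
    (F := fun x y => f x * (Q x y * w y)) (by
      rw [uIoc_of_le hL, IntegrableOn, Measure.volume_eq_prod, ← Measure.prod_restrict]
      exact h2)
  simp only [← intervalIntegral.integral_const_mul, ← intervalIntegral.integral_mul_const]
  rw [h3]
  simp only [mul_assoc]

/-- The memory term `∫ g(s) K(x - s) ds` over `b(x) ≤ s ≤ x`. -/
def memory (K b g : ℝ → ℝ) (x : ℝ) : ℝ := ∫ s in (b x)..x, g s * K (x - s)

namespace Traffic

variable {P : Traffic} {a : ℝ → ℝ}

/-! ### The feedback gains -/

/-- The kernel of the state transformation that acts on `w`: it is `l` below the diagonal and `m`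
above it. -/
def kerT (P : Traffic) (a g : ℝ → ℝ) (x y : ℝ) : ℝ :=
  P.kerM a g x y + if y < x then P.damp y * (conv P.kerE g (x - y) - P.kerE (x - y)) else 0

/-- The kernel through which the convolution with `n` enters the gain on `w`. -/
def kerQ (P : Traffic) (a g : ℝ → ℝ) (x y : ℝ) : ℝ := P.kerA a (x + P.k1 * y) - P.kerT a g x y

lemma continuous_conv_kerE {g : ℝ → ℝ} (hg : Continuous g) : Continuous (conv P.kerE g) :=
  continuous_conv continuous_kerE.intervalIntegrable (IsPC.of_continuous hg)

lemma kerT_of_lt {g : ℝ → ℝ} {x y : ℝ} (h : y < x) : P.kerT a g x y = P.kerL a g x y := by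
  rw [kerT, if_pos h, kerL, add_comm]

lemma kerT_of_le {g : ℝ → ℝ} {x y : ℝ} (h : x ≤ y) : P.kerT a g x y = P.kerM a g x y := by
  rw [kerT, if_neg (not_lt.2 h), add_zero]

lemma measurable_kerT (ha : ContinuousOn a (Icc 0 P.L)) {g : ℝ → ℝ} (hg : Continuous g) :
    Measurable (Function.uncurry (P.kerT a g)) := by
  have h1 := continuous_conv_kerE (P := P) hg
  have h2 := continuous_kerE (P := P)
  have h3 := continuous_damp (P := P)
  refine (continuous_kerM ha hg).measurable.add ?_
  refine Measurable.ite (measurableSet_lt measurable_snd measurable_fst) ?_ measurable_const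
  exact ((h3.comp continuous_snd).mul ((h1.comp (by fun_prop)).sub (h2.comp (by fun_prop)))).measurable

lemma exists_bound_square {L : ℝ} {F : ℝ → ℝ → ℝ} (hF : Continuous (Function.uncurry F)) :
    ∃ C, ∀ x ∈ Icc 0 L, ∀ y ∈ Icc 0 L, |F x y| ≤ C := by
  obtain ⟨C, hC⟩ := (isCompact_Icc.prod isCompact_Icc).exists_bound_of_continuousOn
    (hF.continuousOn (s := Icc 0 L ×ˢ Icc 0 L))
  exact ⟨C, fun x hx y hy => hC (x, y) ⟨hx, hy⟩⟩

lemma exists_bound_kerT (ha : ContinuousOn a (Icc 0 P.L)) {g : ℝ → ℝ} (hg : Continuous g) :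
    ∃ C, ∀ x ∈ Icc 0 P.L, ∀ y ∈ Icc 0 P.L, |P.kerT a g x y| ≤ C := by
  obtain ⟨C, hC⟩ := exists_bound_square (L := P.L) (F := P.kerL a g) (continuous_kerL ha hg)
  obtain ⟨D, hD⟩ := exists_bound_square (L := P.L) (F := P.kerM a g) (continuous_kerM ha hg)
  refine ⟨max C D, fun x hx y hy => ?_⟩
  rcases lt_or_ge y x with h | h
  · rw [kerT_of_lt h]; exact (hC x hx y hy).trans (le_max_left _ _)
  · rw [kerT_of_le h]; exact (hD x hx y hy).trans (le_max_right _ _)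

lemma measurable_kerQ (ha : ContinuousOn a (Icc 0 P.L)) {g : ℝ → ℝ} (hg : Continuous g) :
    Measurable (Function.uncurry (P.kerQ a g)) :=
  ((isPC_kerA ha).measurable.comp (measurable_fst.add (measurable_snd.const_mul _))).sub
    (measurable_kerT ha hg)

lemma exists_bound_kerQ (ha : ContinuousOn a (Icc 0 P.L)) {g : ℝ → ℝ} (hg : Continuous g) :
    ∃ C, ∀ x ∈ Icc 0 P.L, ∀ y ∈ Icc 0 P.L, |P.kerQ a g x y| ≤ C := by
  obtain ⟨C, hC⟩ := exists_bound_kerT ha hg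
  obtain ⟨D, hD⟩ := (isPC_kerA ha).bounded (P.L + P.k1 * P.L)
  refine ⟨D + C, fun x hx y hy => (abs_sub _ _).trans (add_le_add (hD _ ?_) (hC x hx y hy))⟩
  have h1 := mul_nonneg P.k1_pos.le hy.1
  have h2 := mul_le_mul_of_nonneg_left hy.2 P.k1_pos.le
  rw [abs_of_nonneg (add_nonneg hx.1 h1)]
  exact add_le_add hx.2 h2

namespace IsKernels

variable {K : Kernels}

lemma n_intervalIntegrable (hK : P.IsKernels a K) : IntervalIntegrable K.n volume 0 P.L :=
  (intervalIntegrable_iff_road P.L_pos.le _).2 hK.n_mem.integrable_road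

lemma n_refl_intervalIntegrable (hK : P.IsKernels a K) :
    IntervalIntegrable (fun x => K.n (P.L - x)) volume 0 P.L := by
  have := (hK.n_intervalIntegrable.comp_sub_left P.L).symm
  simpa using this

lemma n_ae_eq (hK : P.IsKernels a K) :
    ∀ᵐ x ∂(road P.L), K.n x = -P.kerA a x + conv (P.kerA a) K.n x := by
  filter_upwards [hK.n_eq] with x hx
  rw [hx, aCheck_eq]
  have : ∫ y in (0 : ℝ)..x, P.lam * P.kerA a y * K.n (x - y) =
      P.lam * conv (P.kerA a) K.n x := by
    rw [conv, ← intervalIntegral.integral_const_mul]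
    simp only [mul_assoc]
  dsimp only
  rw [this, ← mul_sub, neg_mul, ← mul_assoc, inv_mul_cancel₀ P.lam_pos.ne']
  ring

/-- The operators `1 - A *` and `1 - n *` are inverse to each other. -/
lemma conv_n_sub (ha : ContinuousOn a (Icc 0 P.L)) (hK : P.IsKernels a K) {h : ℝ → ℝ}
    (hh : Continuous h) :
    conv K.n (fun x => h x - conv (P.kerA a) h x) P.L = -conv (P.kerA a) h P.L := by
  have hL := P.L_pos.le
  have hA := isPC_kerA ha
  have hn := hK.n_intervalIntegrable
  have hPC := IsPC.of_continuous hh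
  rw [conv_sub_right hn hPC (IsPC.of_continuous (continuous_conv hA.intervalIntegrable hPC)),
    ← IsPC.conv_assoc hL hn hA hPC]
  have h1 : conv (conv K.n (P.kerA a)) h P.L = conv (fun x => K.n x + P.kerA a x) h P.L := by
    refine conv_congr hL ?_ fun _ _ => rfl
    have h2 := hK.n_ae_eq
    rw [ae_restrict_iff' measurableSet_Ioo] at h2
    have h3 : ∀ᵐ r : ℝ, r ≠ P.L := by simp [ae_iff]
    filter_upwards [h2, h3] with r hr hr' hrm
    rw [conv_comm]
    linarith [hr ⟨hrm.1, lt_of_le_of_ne hrm.2 hr'⟩]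
  have h4 : conv (fun x => K.n x + P.kerA a x) h P.L =
      conv K.n h P.L + conv (P.kerA a) h P.L := by
    rw [conv, conv, conv, ← intervalIntegral.integral_add (hPC.intervalIntegrable_mul_sub hn _)
      (hPC.intervalIntegrable_mul_sub (hA.intervalIntegrable _ _) _)]
    simp only [add_mul]
  rw [h1, h4]; ring

variable {g : ℝ → ℝ}

/-- The gain on `v` depends on the distance to the outlet only. -/
lemma gainV_eq (hk : ∀ x y, 0 ≤ y → y < x → x ≤ P.L → K.k x y = g (x - y)) {y : ℝ}
    (hy : y ∈ Ioo 0 P.L) :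
    P.gainV K y = g (P.L - y) + K.n (P.L - y) - conv K.n g (P.L - y) := by
  have h1 : ∫ ξ in y..P.L, K.n (P.L - ξ) * K.k ξ y = conv K.n g (P.L - y) := by
    have e := intervalIntegral.integral_comp_sub_left (a := y) (b := P.L)
      (fun z => K.n z * g (P.L - y - z)) P.L
    rw [sub_self] at e
    rw [conv, ← e]
    refine intervalIntegral.integral_congr_ae (Eventually.of_forall fun ξ hξ => ?_)
    rw [uIoc_of_le hy.2.le] at hξ
    rw [hk ξ y hy.1.le hξ.1 hξ.2]
    congr 2; ring
  rw [gainV, hk _ _ hy.1.le hy.2 le_rfl, h1]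

/-- The three integrals in the gain on `w` combine into one integral over the road. -/
lemma gainW_eq (ha : ContinuousOn a (Icc 0 P.L)) (hK : P.IsKernels a K) (hg : Continuous g)
    (hl : ∀ x y, 0 ≤ y → y ≤ x → x ≤ P.L → K.l x y = P.kerL a g x y)
    (hm : ∀ x y, 0 ≤ x → x ≤ y → y ≤ P.L → K.m x y = P.kerM a g x y) {y : ℝ}
    (hy : y ∈ Ioo 0 P.L) :
    P.gainW a K y = P.kerT a g P.L y +
      ∫ ξ in (0 : ℝ)..P.L, K.n (P.L - ξ) * P.kerQ a g ξ y := by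
  have hL := P.L_pos.le
  have hnr := hK.n_refl_intervalIntegrable
  have hA := isPC_kerA ha
  have hy' := Ioo_subset_Icc_self hy
  obtain ⟨C, hC⟩ := exists_bound_kerT ha hg
  obtain ⟨D, hD⟩ := hA.bounded (P.L + P.k1 * P.L)
  have hTi : IntervalIntegrable (fun ξ => K.n (P.L - ξ) * P.kerT a g ξ y) volume 0 P.L :=
    intervalIntegrable_mul_of_bounded hnr
      ((measurable_kerT ha hg).comp (measurable_id.prodMk measurable_const))
      (fun r hr => hC r (by rwa [uIcc_of_le hL] at hr) y hy')
  have hAi : IntervalIntegrable (fun ξ => K.n (P.L - ξ) * P.kerA a (ξ + P.k1 * y)) volume 0 P.L := by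
    refine intervalIntegrable_mul_of_bounded (C := D) hnr
      (hA.measurable.comp (measurable_id.add measurable_const)) (fun r hr => hD _ ?_)
    rw [uIcc_of_le hL] at hr
    have h1 := mul_nonneg P.k1_pos.le hy'.1
    have h2 := mul_le_mul_of_nonneg_left hy'.2 P.k1_pos.le
    rw [abs_of_nonneg (add_nonneg hr.1 h1)]
    exact add_le_add hr.2 h2
  have e1 : ∫ ξ in (0 : ℝ)..(min P.L ((P.L - y) / P.mu)),
        P.k1⁻¹ * K.n (P.L - ξ) * a (y + P.mu * ξ) =
      ∫ ξ in (0 : ℝ)..P.L, K.n (P.L - ξ) * P.kerA a (ξ + P.k1 * y) := by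
    have hb : min P.L ((P.L - y) / P.mu) ∈ Icc 0 P.L :=
      ⟨le_min hL (div_nonneg (by linarith [hy.2]) P.mu_pos.le), min_le_left _ _⟩
    rw [← intervalIntegral.integral_indicator hb]
    refine intervalIntegral.integral_congr fun ξ hξ => ?_
    rw [uIcc_of_le hL] at hξ
    have hiff : ξ ≤ min P.L ((P.L - y) / P.mu) ↔ ξ + P.k1 * y ≤ P.k1 * P.L := by
      have : (P.L - y) / P.mu = P.k1 * P.L - P.k1 * y := by
        rw [mu_eq, div_inv_eq_mul]; ring
      rw [le_min_iff, this, le_sub_iff_add_le]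
      exact ⟨fun h => h.2, fun h => ⟨hξ.2, h⟩⟩
    by_cases h : ξ + P.k1 * y ≤ P.k1 * P.L
    · have hin : ξ ∈ {x | x ≤ min P.L ((P.L - y) / P.mu)} := hiff.2 h
      rw [indicator_of_mem hin, kerA_of_mem (add_nonneg hξ.1 (mul_nonneg P.k1_pos.le hy'.1)) h,
        mul_add, ← mul_assoc P.mu P.k1, mu_mul_k1, one_mul, ← mu_eq, add_comm y]
      ring
    · have hin : ξ ∉ {x | x ≤ min P.L ((P.L - y) / P.mu)} := fun h' => h (hiff.1 h')
      rw [indicator_of_notMem hin, kerA_of_gt (not_le.1 h), mul_zero]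
  have e2 : (∫ ξ in y..P.L, K.n (P.L - ξ) * K.l ξ y) + ∫ ξ in (0 : ℝ)..y, K.n (P.L - ξ) * K.m ξ y =
      ∫ ξ in (0 : ℝ)..P.L, K.n (P.L - ξ) * P.kerT a g ξ y := by
    have s1 : uIcc 0 y ⊆ uIcc 0 P.L := by
      rw [uIcc_of_le hL, uIcc_of_le hy.1.le]; exact Icc_subset_Icc_right hy.2.le
    have s2 : uIcc y P.L ⊆ uIcc 0 P.L := by
      rw [uIcc_of_le hL, uIcc_of_le hy.2.le]; exact Icc_subset_Icc_left hy.1.le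
    rw [← intervalIntegral.integral_add_adjacent_intervals (hTi.mono_set s1) (hTi.mono_set s2),
      add_comm]
    congr 1
    · refine intervalIntegral.integral_congr fun ξ hξ => ?_
      rw [uIcc_of_le hy.1.le] at hξ
      rw [hm ξ y hξ.1 hξ.2 hy.2.le, kerT_of_le hξ.2]
    · refine intervalIntegral.integral_congr_ae (Eventually.of_forall fun ξ hξ => ?_)
      rw [uIoc_of_le hy.2.le] at hξ
      rw [hl ξ y hy.1.le hξ.1.le hξ.2, kerT_of_lt hξ.1]
  have e3 : ∫ ξ in (0 : ℝ)..P.L, K.n (P.L - ξ) * P.kerQ a g ξ y =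
      (∫ ξ in (0 : ℝ)..P.L, K.n (P.L - ξ) * P.kerA a (ξ + P.k1 * y)) -
        ∫ ξ in (0 : ℝ)..P.L, K.n (P.L - ξ) * P.kerT a g ξ y := by
    rw [← intervalIntegral.integral_sub hAi hTi]
    simp only [kerQ, mul_sub]
  rw [gainW, hl _ _ hy.1.le hy.2.le le_rfl, kerT_of_lt hy.2, e1, e3, ← e2]
  ring

end IsKernels

end Traffic

namespace Traffic

variable {P : Traffic} {a : ℝ → ℝ} {K : Kernels}

namespace IsKernels

lemma memLp_n_refl (hK : P.IsKernels a K) : MemLp (fun x => K.n (P.L - x)) 2 (road P.L) := by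
  have h : MeasurePreserving (fun x => P.L - x) (road P.L) (road P.L) := by
    have := (Measure.measurePreserving_sub_left (volume : Measure ℝ) P.L).restrict_preimage
      (s := Ioo 0 P.L) measurableSet_Ioo
    simpa using! this
  exact hK.n_mem.comp_measurePreserving h

/-- The gain on `v` is square integrable but in general not bounded, since `n` is not. -/
lemma memLp_gainV (ha : ContinuousOn a (Icc 0 P.L)) (hK : P.IsKernels a K) :
    MemLp (P.gainV K) 2 (road P.L) := by
  obtain ⟨g, hg, hk, -⟩ := hK.exists_formulas ha
  have hL := P.L_pos.le
  -- `K.n` may be replaced by a function that is integrable on the whole line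
  set n' := (Ioo 0 P.L).indicator K.n with hn'
  have hint : ∀ u v, IntervalIntegrable n' volume u v := fun u v =>
    ((integrable_indicator_iff measurableSet_Ioo).2
      hK.n_mem.integrable_road).intervalIntegrable
  have hcc := continuous_conv hint (IsPC.of_continuous hg)
  have h1 : MemLp (fun y => g (P.L - y) + K.n (P.L - y) - conv n' g (P.L - y)) 2 (road P.L) := by
    refine MemLp.sub (MemLp.add ?_ hK.memLp_n_refl) ?_
    · exact (hg.comp (by fun_prop)).continuousOn.memLp_road
    · exact (hcc.comp (by fun_prop)).continuousOn.memLp_road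
  refine h1.ae_eq ?_
  refine (ae_restrict_mem measurableSet_Ioo).mono fun y hy => ?_
  rw [gainV_eq hk hy]
  dsimp only
  congr 1
  refine conv_congr_left (by linarith [hy.2]) fun r hr => ?_
  rw [hn', indicator_of_mem (s := Ioo 0 P.L) ⟨hr.1, by linarith [hr.2, hy.1]⟩]

lemma memLp_gainW (ha : ContinuousOn a (Icc 0 P.L)) (hK : P.IsKernels a K) :
    MemLp (P.gainW a K) 2 (road P.L) := by
  obtain ⟨g, hg, -, hl, hm, -⟩ := hK.exists_formulas ha
  have hL := P.L_pos.le
  obtain ⟨C, hC⟩ := exists_bound_kerT ha hg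
  obtain ⟨D, hD⟩ := exists_bound_kerQ ha hg
  have hnr := hK.memLp_n_refl
  have hLm : P.L ∈ Icc 0 P.L := ⟨hL, le_rfl⟩
  have h1 : MemLp (fun y => P.kerT a g P.L y) 2 (road P.L) := by
    refine MemLp.of_bound ((measurable_kerT ha hg).comp
      (measurable_const.prodMk measurable_id)).aestronglyMeasurable C ?_
    exact (ae_restrict_mem measurableSet_Ioo).mono fun y hy =>
      hC _ hLm y (Ioo_subset_Icc_self hy)
  have h2 : MemLp (fun y => ∫ ξ, K.n (P.L - ξ) * P.kerQ a g ξ y ∂(road P.L)) 2 (road P.L) := by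
    refine MemLp.of_bound ?_ (∫ ξ, |K.n (P.L - ξ)| * D ∂(road P.L)) ?_
    · have hm2 : AEStronglyMeasurable (fun q : ℝ × ℝ => K.n (P.L - q.2) * P.kerQ a g q.2 q.1)
          ((road P.L).prod (road P.L)) :=
        hnr.aestronglyMeasurable.comp_snd.mul
          ((measurable_kerQ ha hg).comp measurable_swap).aestronglyMeasurable
      exact hm2.integral_prod_right'
    · refine (ae_restrict_mem measurableSet_Ioo).mono fun y hy => ?_
      refine norm_integral_le_of_norm_le (hnr.integrable_road.abs.mul_const _) ?_
      refine (ae_restrict_mem measurableSet_Ioo).mono fun ξ hξ => ?_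
      rw [norm_mul]
      exact mul_le_mul_of_nonneg_left (hD _ (Ioo_subset_Icc_self hξ) _ (Ioo_subset_Icc_self hy))
        (norm_nonneg _)
  refine (h1.add h2).ae_eq ?_
  refine (ae_restrict_mem measurableSet_Ioo).mono fun y hy => ?_
  rw [gainW_eq ha hK hg hl hm hy, intervalIntegral_eq_road hL]
  rfl

end IsKernels

/-! ### The feedback law in terms of the history of the inlet flow -/

/-- The contribution of the routing gain to `v`. -/
def memA (P : Traffic) (a : ℝ → ℝ) : (ℝ → ℝ) → ℝ → ℝ := memory (P.kerA a) fun _ => -(P.k1 * P.L)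

/-- The contribution of the in-domain coupling to `v`. -/
def memE (P : Traffic) : (ℝ → ℝ) → ℝ → ℝ := memory P.kerE fun x => -(P.k1 * x)

/-- The profile of `v` belonging to a history function. -/
def opV (P : Traffic) (a g : ℝ → ℝ) (x : ℝ) : ℝ := g x - (P.memA a g x + P.memE g x)

/-- The profile of `w` belonging to a history function. -/
def opW (P : Traffic) (g : ℝ → ℝ) (x : ℝ) : ℝ := P.k1 * g (-(P.k1 * x))

lemma continuous_opW {h : ℝ → ℝ} (hh : Continuous h) : Continuous (P.opW h) := by
  unfold opW; fun_prop

/-- The part of `∫ A(r) h(x - r) dr` that depends on the values of `h` at negative arguments. -/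
def routed (P : Traffic) (a h : ℝ → ℝ) (x : ℝ) : ℝ :=
  ∫ r in x..(x + P.k1 * P.L), P.kerA a r * h (x - r)

lemma continuous_routed (ha : ContinuousOn a (Icc 0 P.L)) {h : ℝ → ℝ} (hh : Continuous h) :
    Continuous (P.routed a h) := by
  have hA := (isPC_kerA ha)
  have hc := continuous_integral_mul_sub hA.intervalIntegrable (IsPC.of_continuous hh)
  have e : P.routed a h = fun x => (∫ r in (0 : ℝ)..(x + P.k1 * P.L), P.kerA a r * h (x - r)) -
      ∫ r in (0 : ℝ)..x, P.kerA a r * h (x - r) := by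
    ext x
    have hI := fun b => (IsPC.of_continuous hh).intervalIntegrable_mul_sub
      (hA.intervalIntegrable 0 b) x
    rw [intervalIntegral.integral_interval_sub_left (hI _) (hI _)]
    rfl
  rw [e]
  exact (hc.comp (f := fun x : ℝ => (x, x + P.k1 * P.L)) (by fun_prop)).sub
    (hc.comp (f := fun x : ℝ => (x, x)) (by fun_prop))

/-- The past of the history function is the state `w`. -/
lemma routed_eq (x : ℝ) (h : ℝ → ℝ) : P.routed a h x =
    ∫ y in (0 : ℝ)..P.L, P.kerA a (x + P.k1 * y) * P.opW h y := by
  have e := intervalIntegral.integral_comp_add_mul (a := 0) (b := P.L)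
    (fun r => P.kerA a r * h (x - r)) P.k1_pos.ne' x
  rw [mul_zero, add_zero, smul_eq_mul] at e
  have e2 : P.routed a h x = P.k1 * ∫ y in (0 : ℝ)..P.L, P.kerA a (x + P.k1 * y) *
      h (x - (x + P.k1 * y)) := by
    rw [e, ← mul_assoc, mul_inv_cancel₀ P.k1_pos.ne', one_mul]; rfl
  rw [e2, ← intervalIntegral.integral_const_mul]
  refine intervalIntegral.integral_congr fun y _ => ?_
  rw [sub_add_cancel_left, opW]; ring

lemma kerE_add (x y : ℝ) : P.kerE (x + P.k1 * y) = P.damp y * P.kerE (x - y) := by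
  have h := kap_mul_one_add_k1 P
  rw [kerE_eq, kerE_eq (x - y)]
  have : P.kap * (x + P.k1 * y) = y + P.kap * (x - y) := by linear_combination y * h
  rw [this, damp_add]; ring

/-- The memory terms split into contributions of positive and of negative arguments of the history
function, that is, of the values not yet visible in `w` and of `w` itself. -/
lemma memA_add_memE (ha : ContinuousOn a (Icc 0 P.L)) {h : ℝ → ℝ} (hh : Continuous h) (x : ℝ) :
    P.memA a h x + P.memE h x =
      conv (P.kerH a) h x + P.routed a h x +
        conv P.kerE (fun y => P.damp y * P.opW h y) x := by
  have hPC := IsPC.of_continuous hh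
  have hE := continuous_kerE (P := P)
  have hAi := fun u v => hPC.intervalIntegrable_mul_sub
    ((isPC_kerA ha).intervalIntegrable u v) x
  have hEi := fun u v => hPC.intervalIntegrable_mul_sub (hE.intervalIntegrable (μ := volume) u v) x
  have e1 : P.memA a h x = conv (P.kerA a) h x + P.routed a h x := by
    have e := intervalIntegral.integral_comp_sub_left (a := 0) (b := x + P.k1 * P.L)
      (fun s => h s * P.kerA a (x - s)) x
    simp only [sub_sub_cancel, sub_zero, sub_add_cancel_left] at e
    rw [conv, routed, intervalIntegral.integral_add_adjacent_intervals (hAi _ _) (hAi _ _),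
      memA, memory, ← e]
    simp only [mul_comm]
  have e2 : P.memE h x = ∫ r in (0 : ℝ)..((1 + P.k1) * x), P.kerE r * h (x - r) := by
    have e := intervalIntegral.integral_comp_sub_left (a := 0) (b := (1 + P.k1) * x)
      (fun s => h s * P.kerE (x - s)) x
    have h1 : x - (1 + P.k1) * x = -(P.k1 * x) := by ring
    simp only [sub_sub_cancel, sub_zero, h1] at e
    rw [memE, memory, ← e]
    simp only [mul_comm]
  have e3 : ∫ r in (0 : ℝ)..((1 + P.k1) * x), P.kerE r * h (x - r) =
      conv P.kerE h x + conv P.kerE (fun y => P.damp y * P.opW h y) x := by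
    rw [← intervalIntegral.integral_add_adjacent_intervals (hEi 0 x) (hEi _ _), conv_comm _ _ x,
      conv_comm P.kerE (fun y => _), conv, conv]
    congr 1
    · exact conv_comm P.kerE h x
    have e := intervalIntegral.integral_comp_add_mul (a := 0) (b := x)
      (fun r => P.kerE r * h (x - r)) P.k1_pos.ne' x
    rw [mul_zero, add_zero, smul_eq_mul] at e
    have e4 : ∫ r in x..((1 + P.k1) * x), P.kerE r * h (x - r) =
        P.k1 * ∫ y in (0 : ℝ)..x, P.kerE (x + P.k1 * y) * h (x - (x + P.k1 * y)) := by
      rw [e, ← mul_assoc, mul_inv_cancel₀ P.k1_pos.ne', one_mul]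
      congr 1; ring
    rw [e4, ← intervalIntegral.integral_const_mul]
    refine intervalIntegral.integral_congr fun y _ => ?_
    rw [kerE_add, sub_add_cancel_left, opW]; ring
  rw [e1, e2, e3, conv_kerH ha hPC]; ring

/-- The state transformation acts on `w` through convolutions with `g = l(·, 0)`. -/
lemma integral_kerT (ha : ContinuousOn a (Icc 0 P.L)) {g h : ℝ → ℝ} (hg : Continuous g)
    (hh : Continuous h) {x : ℝ} (hx : x ∈ Icc 0 P.L) :
    ∫ y in (0 : ℝ)..P.L, P.kerT a g x y * P.opW h y =
      conv g (P.routed a h) x +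
        conv (conv P.kerE g) (fun y => P.damp y * P.opW h y) x -
        conv P.kerE (fun y => P.damp y * P.opW h y) x := by
  have hL := P.L_pos.le
  have hA := isPC_kerA ha
  set W : ℝ → ℝ := P.opW h with hW
  have hWc : Continuous W := continuous_opW hh
  have hdW : Continuous fun y => P.damp y * W y := continuous_damp.mul hWc
  have hMc : Continuous fun y => P.kerM a g x y :=
    (continuous_kerM ha hg).comp (f := fun y : ℝ => (x, y)) (by fun_prop)
  have hMW : Continuous fun y => P.kerM a g x y * W y := hMc.mul hWc
  have hR : Continuous fun y => P.damp y * (conv P.kerE g (x - y) - P.kerE (x - y)) * W y := by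
    have h1 := continuous_conv_kerE (P := P) hg
    have h2 := continuous_kerE (P := P)
    have h3 := continuous_damp (P := P)
    fun_prop
  have e1 : ∫ y in (0 : ℝ)..P.L, P.kerT a g x y * W y = (∫ y in (0 : ℝ)..P.L, P.kerM a g x y * W y)
      + ∫ y in (0 : ℝ)..x, P.damp y * (conv P.kerE g (x - y) - P.kerE (x - y)) * W y := by
    have hi : IntervalIntegrable (fun y => {y | y ≤ x}.indicator (fun y => P.damp y *
        (conv P.kerE g (x - y) - P.kerE (x - y)) * W y) y) volume 0 P.L := by
      rw [intervalIntegrable_iff]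
      exact (intervalIntegrable_iff.1 (hR.intervalIntegrable 0 P.L)).indicator measurableSet_Iic
    rw [← intervalIntegral.integral_indicator hx,
      ← intervalIntegral.integral_add (hMW.intervalIntegrable _ _) hi]
    refine intervalIntegral.integral_congr_ae ?_
    have h0 : ∀ᵐ y : ℝ, y ≠ x := by simp [ae_iff]
    filter_upwards [h0] with y hy _
    rw [kerT, add_mul]
    congr 1
    by_cases h : y < x
    · rw [if_pos h, indicator_of_mem (s := {y | y ≤ x}) h.le]
    · rw [if_neg h, zero_mul, indicator_of_notMem]
      exact fun h' => h (lt_of_le_of_ne h' hy)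
  have e2 : ∫ y in (0 : ℝ)..x, P.damp y * (conv P.kerE g (x - y) - P.kerE (x - y)) * W y =
      conv (conv P.kerE g) (fun y => P.damp y * W y) x - conv P.kerE (fun y => P.damp y * W y) x := by
    rw [conv_comm (conv P.kerE g), conv_comm P.kerE (fun y => _),
      ← conv_sub_right (hdW.intervalIntegrable _ _)
        (IsPC.of_continuous (continuous_conv_kerE hg)) (IsPC.of_continuous continuous_kerE), conv]
    refine intervalIntegral.integral_congr fun y _ => ?_
    ring
  have e3 : ∫ y in (0 : ℝ)..P.L, P.kerM a g x y * W y = conv g (P.routed a h) x := by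
    have hM : ∀ y, P.kerM a g x y = ∫ s in (0 : ℝ)..P.L,
        {s | s ≤ x}.indicator (fun s => g (x - s)) s * P.kerA a (s + P.k1 * y) := by
      intro y
      have e := intervalIntegral.integral_comp_add_right (a := 0) (b := x)
        (fun r => P.kerA a r * g (x + P.k1 * y - r)) (P.k1 * y)
      rw [zero_add] at e
      rw [kerM, ← e, ← intervalIntegral.integral_indicator hx]
      refine intervalIntegral.integral_congr fun s _ => ?_
      by_cases hs : s ≤ x
      · rw [indicator_of_mem (s := {s | s ≤ x}) hs, indicator_of_mem (s := {s | s ≤ x}) hs,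
          add_sub_add_right_eq_sub, mul_comm]
      · rw [indicator_of_notMem (s := {s | s ≤ x}) hs, indicator_of_notMem (s := {s | s ≤ x}) hs,
          zero_mul]
    simp only [hM]
    obtain ⟨C, hC⟩ := hA.bounded (P.L + P.k1 * P.L)
    obtain ⟨D, hD⟩ := isCompact_Icc.exists_bound_of_continuousOn (hWc.continuousOn (s := Icc 0 P.L))
    have hgi : IntervalIntegrable ({s | s ≤ x}.indicator fun s => g (x - s)) volume 0 P.L := by
      rw [intervalIntegrable_iff]
      have hc : Continuous fun s => g (x - s) := by fun_prop
      exact (intervalIntegrable_iff.1 (hc.intervalIntegrable 0 P.L)).indicator measurableSet_Iic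
    rw [integral_kernel_swap (Q := fun s y => P.kerA a (s + P.k1 * y)) (C := C) hL hgi
      (hA.measurable.comp (measurable_fst.add (measurable_snd.const_mul _)))
      (fun s hs y hy => hC _ ?_) hWc.measurable hD]
    · have hr : ∀ s, ∫ y in (0 : ℝ)..P.L, P.kerA a (s + P.k1 * y) * W y = P.routed a h s :=
        fun s => (routed_eq s h).symm
      simp only [hr]
      rw [conv_comm, conv, ← intervalIntegral.integral_indicator hx]
      refine intervalIntegral.integral_congr fun s _ => ?_
      by_cases hs : s ≤ x
      · rw [indicator_of_mem (s := {s | s ≤ x}) hs, indicator_of_mem (s := {s | s ≤ x}) hs, mul_comm]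
      · rw [indicator_of_notMem (s := {s | s ≤ x}) hs, indicator_of_notMem (s := {s | s ≤ x}) hs,
          zero_mul]
    · have h1 := mul_nonneg P.k1_pos.le hy.1
      have h2 := mul_le_mul_of_nonneg_left hy.2 P.k1_pos.le
      rw [abs_of_nonneg (add_nonneg hs.1 h1)]
      exact add_le_add hs.2 h2
  rw [e1, e2, e3]; ring

end Traffic

namespace Traffic

variable {P : Traffic} {a : ℝ → ℝ} {K : Kernels}

/-- The delayed term of the feedback law is the routed inflow at the outlet. -/
lemma delayed_term_eq (h : ℝ → ℝ) :
    ∫ y in (min (P.mu * P.L) P.L)..P.L, P.k1⁻¹ * a y * P.opW h (y - P.mu * P.L) = P.routed a h P.L := by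
  have hL := P.L_pos.le
  have hk := P.k1_pos
  have hμ := P.mu_pos
  have hμL : 0 ≤ P.mu * P.L := mul_nonneg hμ.le hL
  have hkμ : P.k1 * (P.mu * P.L) = P.L := by
    rw [← mul_assoc, mul_comm P.k1, mu_mul_k1, one_mul]
  rw [routed_eq]
  rcases le_total (P.mu * P.L) P.L with hle | hle
  · rw [min_eq_left hle]
    have hb : P.L - P.mu * P.L ∈ Icc 0 P.L := ⟨by linarith, by linarith⟩
    have e := intervalIntegral.integral_comp_sub_right (a := P.mu * P.L) (b := P.L)
      (fun y => P.k1⁻¹ * a (y + P.mu * P.L) * P.opW h y) (P.mu * P.L)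
    simp only [sub_add_cancel, sub_self] at e
    rw [e, ← intervalIntegral.integral_indicator hb]
    refine intervalIntegral.integral_congr fun y hy => ?_
    rw [uIcc_of_le hL] at hy
    by_cases h1 : y ≤ P.L - P.mu * P.L
    · have h2 : P.L + P.k1 * y ≤ P.k1 * P.L := by
        have := mul_le_mul_of_nonneg_left h1 hk.le
        rw [mul_sub, hkμ] at this; linarith
      rw [indicator_of_mem (s := {y | y ≤ P.L - P.mu * P.L}) h1,
        kerA_of_mem (add_nonneg hL (mul_nonneg hk.le hy.1)) h2, mul_add, ← mul_assoc P.mu P.k1,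
        mu_mul_k1, one_mul, ← mu_eq, add_comm y]
    · have h2 : P.k1 * P.L < P.L + P.k1 * y := by
        have := mul_lt_mul_of_pos_left (not_le.1 h1) hk
        rw [mul_sub, hkμ] at this; linarith
      rw [indicator_of_notMem (s := {y | y ≤ P.L - P.mu * P.L}) h1, kerA_of_gt h2, zero_mul]
  · rw [min_eq_right hle, intervalIntegral.integral_same]
    refine (intervalIntegral.integral_zero_ae (Eventually.of_forall fun y hy => ?_)).symm
    rw [uIoc_of_le hL] at hy
    have h1 := mul_le_mul_of_nonneg_left hle hk.le
    rw [hkμ] at h1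
    rw [kerA_of_gt (by linarith [mul_pos hk hy.1]), zero_mul]

/-- The feedback law prescribes the value of the history function at the end of its window. -/
lemma ramp_iff (ha : ContinuousOn a (Icc 0 P.L)) (hK : P.IsKernels a K) {h : ℝ → ℝ}
    (hh : Continuous h) (α : ℝ) :
    P.opV a h P.L = P.k2 * P.opW h P.L + P.ramp a K α (P.opV a h) (P.opW h) ↔ h P.L = α := by
  obtain ⟨g, hg, hk, hl, hm, hgs⟩ := hK.exists_formulas ha
  have hL := P.L_pos.le
  have hLm : P.L ∈ Icc 0 P.L := ⟨hL, le_rfl⟩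
  have hA := isPC_kerA ha
  have hE := continuous_kerE (P := P)
  have hH := isPC_kerH ha
  have hn := hK.n_intervalIntegrable
  have hnr := hK.n_refl_intervalIntegrable
  have pg := IsPC.of_continuous hg
  have ph := IsPC.of_continuous hh
  have pE := IsPC.of_continuous hE
  set W : ℝ → ℝ := P.opW h with hWdef
  have hWc : Continuous W := continuous_opW hh
  have hdW : Continuous fun y => P.damp y * W y := continuous_damp.mul hWc
  have pdW := IsPC.of_continuous hdW
  have hrt := continuous_routed ha hh
  have prt := IsPC.of_continuous hrt
  -- continuous functions on the line that agree with the pieces of the transformation on the road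
  set EW : ℝ → ℝ := conv P.kerE fun y => P.damp y * W y with hEW
  have cEW : Continuous EW := continuous_conv hE.intervalIntegrable pdW
  have pEW := IsPC.of_continuous cEW
  have cHh : Continuous (conv (P.kerH a) h) := continuous_conv hH.intervalIntegrable ph
  set V : ℝ → ℝ := fun x => h x - conv (P.kerH a) h x - P.routed a h x - EW x with hVdef
  have hVc : Continuous V := ((hh.sub cHh).sub hrt).sub cEW
  have pV := IsPC.of_continuous hVc
  have hvV : ∀ x, P.opV a h x = V x := by
    intro x
    rw [opV, memA_add_memE ha hh x]
    simp only [hVdef, hEW, hWdef]; ring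
  have cEg := continuous_conv_kerE (P := P) hg
  set Λ : ℝ → ℝ := fun x => conv g (P.routed a h) x +
        conv (conv P.kerE g) (fun y => P.damp y * W y) x - EW x with hΛdef
  have hΛc : Continuous Λ :=
    ((continuous_conv hg.intervalIntegrable prt).add
      (continuous_conv cEg.intervalIntegrable pdW)).sub cEW
  have pΛ := IsPC.of_continuous hΛc
  have hΛ : ∀ x ∈ Icc 0 P.L, ∫ y in (0 : ℝ)..P.L, P.kerT a g x y * W y = Λ x := fun x hx =>
    integral_kerT ha hg hh hx
  have cgV : Continuous (conv g V) := continuous_conv hg.intervalIntegrable pV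
  have pgV := IsPC.of_continuous cgV
  -- the gain on `v`
  have hGV : ∫ y in (0 : ℝ)..P.L, P.gainV K y * P.opV a h y =
      conv g V P.L + conv K.n V P.L - conv K.n (conv g V) P.L := by
    have e1 : ∫ y in (0 : ℝ)..P.L, P.gainV K y * P.opV a h y =
        conv (fun x => g x + K.n x - conv K.n g x) V P.L := by
      rw [conv_comm, conv]
      rw [intervalIntegral_eq_road hL, intervalIntegral_eq_road hL]
      refine setIntegral_congr_fun measurableSet_Ioo fun y hy => ?_
      simp only [IsKernels.gainV_eq hk hy, hvV y]
      ring
    -- the convolution `n * g` on the road is that of a globally integrable function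
    have e2 : conv (fun x => g x + K.n x - conv K.n g x) V P.L =
        conv g V P.L + conv K.n V P.L - conv (conv K.n g) V P.L := by
      set n' := (Ioo 0 P.L).indicator K.n with hn'
      have hint : ∀ u v, IntervalIntegrable n' volume u v := fun u v =>
        ((integrable_indicator_iff measurableSet_Ioo).2
          hK.n_mem.integrable_road).intervalIntegrable
      have hcc := continuous_conv hint pg
      have hcn : ∀ r ∈ Ioo 0 P.L, conv K.n g r = conv n' g r := fun r hr =>
        conv_congr_left hr.1.le fun s hs => by
          rw [hn', indicator_of_mem (s := Ioo 0 P.L) ⟨hs.1, hs.2.trans hr.2⟩]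
      rw [conv_congr_left hL hcn,
        conv_congr_left (f' := fun x => g x + K.n x - conv n' g x) hL
          (fun r hr => by rw [hcn r hr]),
        conv, conv, conv, conv, ← intervalIntegral.integral_add
          (pV.intervalIntegrable_mul_sub (hg.intervalIntegrable _ _) _)
          (pV.intervalIntegrable_mul_sub hn _), ← intervalIntegral.integral_sub
          ((pV.intervalIntegrable_mul_sub (hg.intervalIntegrable _ _) _).add
            (pV.intervalIntegrable_mul_sub hn _))
          (pV.intervalIntegrable_mul_sub (hcc.intervalIntegrable _ _) _)]
      simp only [sub_mul, add_mul]
    rw [e1, e2, IsPC.conv_assoc hL hn pg pV]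
  -- the gain on `w`
  have hGW : ∫ y in (0 : ℝ)..P.L, P.gainW a K y * W y =
      Λ P.L + conv K.n (fun x => P.routed a h x - Λ x) P.L := by
    obtain ⟨C, hC⟩ := exists_bound_kerT ha hg
    obtain ⟨D, hD⟩ := exists_bound_kerQ ha hg
    obtain ⟨B, hB⟩ := isCompact_Icc.exists_bound_of_continuousOn (hWc.continuousOn (s := Icc 0 P.L))
    have hTm : ∀ x, Measurable (P.kerT a g x) := fun x =>
      (measurable_kerT ha hg).comp (measurable_const.prodMk measurable_id)
    have hTi : ∀ x ∈ Icc 0 P.L,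
        IntervalIntegrable (fun y => P.kerT a g x y * W y) volume 0 P.L := by
      intro x hx
      simp only [mul_comm _ (W _)]
      exact intervalIntegrable_mul_of_bounded (hWc.intervalIntegrable _ _) (hTm x)
        fun r hr => hC x hx r (by rwa [uIcc_of_le hL] at hr)
    have hAi : ∀ x ∈ Icc 0 P.L,
        IntervalIntegrable (fun y => P.kerA a (x + P.k1 * y) * W y) volume 0 P.L := by
      obtain ⟨M, hM⟩ := hA.bounded (P.L + P.k1 * P.L)
      intro x hx
      simp only [mul_comm _ (W _)]
      refine intervalIntegrable_mul_of_bounded (C := M) (hWc.intervalIntegrable _ _)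
        (hA.measurable.comp (measurable_const.add (measurable_const.mul measurable_id)))
        fun r hr => hM _ ?_
      rw [uIcc_of_le hL] at hr
      have h1 := mul_nonneg P.k1_pos.le hr.1
      have h2 := mul_le_mul_of_nonneg_left hr.2 P.k1_pos.le
      rw [abs_of_nonneg (add_nonneg hx.1 h1)]
      exact add_le_add hx.2 h2
    have hQ : ∀ x ∈ Icc 0 P.L, ∫ y in (0 : ℝ)..P.L, P.kerQ a g x y * W y =
        P.routed a h x - Λ x := by
      intro x hx
      rw [← hΛ x hx, routed_eq, ← intervalIntegral.integral_sub (hAi x hx) (hTi x hx)]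
      simp only [kerQ, sub_mul]
    have hgw : IntervalIntegrable (fun y => P.gainW a K y * W y) volume 0 P.L := by
      rw [intervalIntegrable_iff_road hL]
      exact (hK.memLp_gainW ha).integrable_mul hWc.continuousOn.memLp_road
    have e1 : ∫ y in (0 : ℝ)..P.L, P.gainW a K y * W y = Λ P.L +
        ∫ y in (0 : ℝ)..P.L, (∫ ξ in (0 : ℝ)..P.L, K.n (P.L - ξ) * P.kerQ a g ξ y) * W y := by
      rw [← hΛ _ hLm, ← sub_eq_iff_eq_add']
      rw [← intervalIntegral.integral_sub hgw (hTi _ hLm), intervalIntegral_eq_road hL,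
        intervalIntegral_eq_road hL]
      refine setIntegral_congr_fun measurableSet_Ioo fun y hy => ?_
      simp only [IsKernels.gainW_eq ha hK hg hl hm hy]
      ring
    rw [e1, integral_kernel_swap hL hnr (measurable_kerQ ha hg) hD hWc.measurable hB,
      conv_comm, conv]
    congr 1
    refine intervalIntegral.integral_congr fun x hx => ?_
    rw [uIcc_of_le hL] at hx
    rw [hQ x hx, mul_comm]
  -- the transformed state `η` is `h - A * h`
  have hη : ∀ x ∈ Icc 0 P.L, V x - conv g V x - Λ x + P.routed a h x =
      h x - conv (P.kerA a) h x := by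
    intro x hx
    have hgx : IntervalIntegrable g volume 0 x := hg.intervalIntegrable _ _
    have c1 : Continuous fun y => h y - conv (P.kerH a) h y := hh.sub cHh
    have c2 : Continuous fun y => h y - conv (P.kerH a) h y - P.routed a h y := c1.sub hrt
    have a1 : conv g V x = conv g h x - conv g (conv (P.kerH a) h) x -
        conv g (P.routed a h) x - conv g EW x := by
      rw [hVdef, conv_sub_right hgx (IsPC.of_continuous c2) pEW,
        conv_sub_right hgx (IsPC.of_continuous c1) prt,
        conv_sub_right hgx ph (IsPC.of_continuous cHh)]
    have a2 : conv g EW x = conv (conv P.kerE g) (fun y => P.damp y * W y) x := by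
      rw [hEW, ← IsPC.conv_assoc hx.1 hgx pE pdW]
      exact conv_congr_left hx.1 fun r _ => conv_comm _ _ _
    have a3 : conv g (conv (P.kerH a) h) x = conv g h x + conv P.kerE h x := by
      rw [← IsPC.conv_assoc hx.1 hgx hH ph]
      have : conv (conv g (P.kerH a)) h x = conv (fun y => g y + P.kerE y) h x := by
        refine conv_congr_left hx.1 fun r hr => ?_
        rw [conv_comm]
        linarith [hgs r ⟨hr.1.le, hr.2.le.trans hx.2⟩]
      rw [this, conv, conv, conv, ← intervalIntegral.integral_add
        (ph.intervalIntegrable_mul_sub hgx x)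
        (ph.intervalIntegrable_mul_sub (hE.intervalIntegrable _ _) x)]
      simp only [add_mul]
    have a4 := conv_kerH ha ph x
    simp only [hΛdef, hVdef] at a1 ⊢
    rw [a1, a2, a3]
    linarith
  have hfin := hK.conv_n_sub ha hh
  have hηn : conv K.n (fun x => h x - conv (P.kerA a) h x) P.L =
      conv K.n V P.L - conv K.n (conv g V) P.L + conv K.n (fun x => P.routed a h x - Λ x) P.L := by
    have c1 : Continuous fun y => V y - conv g V y := hVc.sub cgV
    have c2 : Continuous fun y => P.routed a h y - Λ y := hrt.sub hΛc
    rw [← conv_sub_right hn pV pgV, ← conv_add_right hn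
      (IsPC.of_continuous c1) (IsPC.of_continuous c2)]
    refine conv_congr hL (Eventually.of_forall fun _ _ => rfl) fun r hr => ?_
    rw [← hη r ⟨hr.1, hr.2.le⟩]; ring
  have hηL := hη P.L hLm
  rw [ramp, hGV, hGW, delayed_term_eq, hvV _]
  constructor
  · intro h0; linarith
  · intro h0; linarith

end Traffic

/-! ### Translations in `L²(ℝ)` -/

lemma eLpNorm_two_rpow {α : Type*} [MeasurableSpace α] {μ : Measure α} (f : α → ℝ) :
    eLpNorm f 2 μ ^ (2 : ℝ) = ∫⁻ x, ‖f x‖ₑ ^ (2 : ℝ) ∂μ := by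
  rw [eLpNorm_eq_lintegral_rpow_enorm_toReal (by norm_num) (by norm_num), ← ENNReal.rpow_mul]
  simp

/-- Translations act continuously on `L²(ℝ)`. -/
lemma tendsto_eLpNorm_translate_sub {φ : ℝ → ℝ} (hφ : MemLp φ 2 volume) :
    Tendsto (fun δ => eLpNorm (fun s => φ (s + δ) - φ s) 2 volume) (𝓝 0) (𝓝 0) := by
  let G : C(ℝ, C(ℝ, ℝ)) :=
    ContinuousMap.curry ⟨fun p : ℝ × ℝ => p.2 + p.1, by fun_prop⟩
  have hmp : ∀ δ, MeasurePreserving (G δ) volume volume := fun δ =>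
    measurePreserving_add_right volume δ
  have h := (tendsto_const_nhds (x := hφ.toLp)).compMeasurePreservingLp
    (G.continuous.tendsto 0) hmp (hmp 0) (by norm_num)
  rw [Lp.tendsto_Lp_iff_tendsto_eLpNorm'] at h
  refine h.congr fun δ => eLpNorm_congr_ae ?_
  have e1 := Lp.coeFn_compMeasurePreserving hφ.toLp (hmp δ)
  have e2 := Lp.coeFn_compMeasurePreserving hφ.toLp (hmp 0)
  have e3 := (hmp δ).quasiMeasurePreserving.ae_eq_comp hφ.coeFn_toLp
  have e4 := (hmp 0).quasiMeasurePreserving.ae_eq_comp hφ.coeFn_toLp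
  filter_upwards [e1, e2, e3, e4] with s h1 h2 h3 h4
  rw [Pi.sub_apply, h1, h2, h3, h4]
  simp [G]

/-- A difference quotient of a primitive of `φ` deviates from `φ` by an average of translates. -/
lemma eLpNorm_difference_quotient_sub_le {φ H : ℝ → ℝ} (hφ : Measurable φ)
    (hi : ∀ a b, IntervalIntegrable φ volume a b)
    (hH : ∀ s t, H t - H s = ∫ r in s..t, φ r) {δ : ℝ} (hδ : δ ≠ 0) :
    eLpNorm (fun s => δ⁻¹ * (H (s + δ) - H s) - φ s) 2 volume ^ (2 : ℝ) ≤
      ∫⁻ σ in Ioc (0 : ℝ) 1, eLpNorm (fun s => φ (s + δ * σ) - φ s) 2 volume ^ (2 : ℝ) := by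
  have : IsProbabilityMeasure (volume.restrict (Ioc (0 : ℝ) 1)) := ⟨by simp⟩
  have e : ∀ s, δ⁻¹ * (H (s + δ) - H s) - φ s = ∫ σ in Ioc (0 : ℝ) 1, (φ (s + δ * σ) - φ s) := by
    intro s
    have h1 := intervalIntegral.integral_comp_add_mul (a := 0) (b := 1) φ hδ s
    have h2 : IntervalIntegrable (fun σ => φ (s + δ * σ)) volume 0 1 := by
      have := (hi s (s + δ)).comp_add_left s |>.comp_mul_left (c := δ)
      simpa [hδ] using this
    rw [← intervalIntegral.integral_of_le zero_le_one, intervalIntegral.integral_sub h2 (by simp),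
      h1, hH]
    simp
  have hmeas : Measurable fun p : ℝ × ℝ => ‖φ (p.1 + δ * p.2) - φ p.1‖ₑ ^ (2 : ℝ) := by
    have h1 : Measurable fun p : ℝ × ℝ => φ (p.1 + δ * p.2) :=
      hφ.comp (measurable_fst.add (measurable_snd.const_mul δ))
    exact (h1.sub (hφ.comp measurable_fst)).enorm.pow_const _
  rw [eLpNorm_two_rpow]
  calc ∫⁻ s, ‖δ⁻¹ * (H (s + δ) - H s) - φ s‖ₑ ^ (2 : ℝ)
      ≤ ∫⁻ s, ∫⁻ σ in Ioc (0 : ℝ) 1, ‖φ (s + δ * σ) - φ s‖ₑ ^ (2 : ℝ) := by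
        refine lintegral_mono fun s => ?_
        rw [e, ← eLpNorm_two_rpow]
        refine ENNReal.rpow_le_rpow ?_ (by norm_num)
        refine (enorm_integral_le_lintegral_enorm _).trans ?_
        rw [← eLpNorm_one_eq_lintegral_enorm]
        refine eLpNorm_le_eLpNorm_of_exponent_le (by norm_num) ?_
        have h1 : Measurable fun σ : ℝ => φ (s + δ * σ) :=
          hφ.comp (measurable_const.add (measurable_id.const_mul δ))
        exact (h1.sub measurable_const).aestronglyMeasurable
    _ = ∫⁻ σ in Ioc (0 : ℝ) 1, ∫⁻ s, ‖φ (s + δ * σ) - φ s‖ₑ ^ (2 : ℝ) :=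
        lintegral_lintegral_swap hmeas.aemeasurable
    _ = _ := by simp only [eLpNorm_two_rpow]

/-- Primitives of square integrable functions are differentiable along translations. -/
lemma tendsto_eLpNorm_difference_quotient {φ H : ℝ → ℝ} (hφ : Measurable φ)
    (hφ2 : MemLp φ 2 volume) (hi : ∀ a b, IntervalIntegrable φ volume a b)
    (hH : ∀ s t, H t - H s = ∫ r in s..t, φ r) :
    Tendsto (fun δ => eLpNorm (fun s => δ⁻¹ * (H (s + δ) - H s) - φ s) 2 volume) (𝓝[≠] 0)
      (𝓝 0) := by
  rw [ENNReal.tendsto_nhds_zero]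
  intro ε hε
  have h := (ENNReal.tendsto_nhds_zero.1 (tendsto_eLpNorm_translate_sub hφ2)) ε hε
  obtain ⟨η, hη, hball⟩ := Metric.eventually_nhds_iff.1 h
  have h0 : ∀ᶠ δ : ℝ in 𝓝[≠] 0, dist δ 0 < η :=
    (nhdsWithin_le_nhds) (Metric.ball_mem_nhds _ hη)
  filter_upwards [h0, self_mem_nhdsWithin] with δ hδ hne
  have h1 := eLpNorm_difference_quotient_sub_le hφ hi hH hne
  rw [← ENNReal.rpow_le_rpow_iff (z := 2) (by norm_num)]
  refine h1.trans ?_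
  calc ∫⁻ σ in Ioc (0 : ℝ) 1, eLpNorm (fun s => φ (s + δ * σ) - φ s) 2 volume ^ (2 : ℝ)
      ≤ ∫⁻ _ in Ioc (0 : ℝ) 1, ε ^ (2 : ℝ) := by
        refine setLIntegral_mono measurable_const fun σ hσ => ?_
        refine ENNReal.rpow_le_rpow (hball ?_) (by norm_num)
        rw [Real.dist_eq, sub_zero] at hδ ⊢
        rw [abs_mul, abs_of_pos hσ.1]
        exact (mul_le_of_le_one_right (abs_nonneg _) hσ.2).trans_lt hδ
    _ = ε ^ (2 : ℝ) := by simp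

/-! ### Bounded operators from histories to road profiles -/

/-- Integrability on all bounded intervals. -/
def LocInt (g : ℝ → ℝ) : Prop := ∀ a b, IntervalIntegrable g volume a b

namespace LocInt

variable {g h : ℝ → ℝ}

lemma comb (hg : LocInt g) (hh : LocInt h) (p q : ℝ) : LocInt fun s => p * g s + q * h s :=
  fun a b => ((hg a b).const_mul p).add ((hh a b).const_mul q)

lemma shift (hg : LocInt g) (t : ℝ) : LocInt fun s => g (t + s) := fun a b => by
  simpa using (hg (t + a) (t + b)).comp_add_left t

lemma aestronglyMeasurable (hg : LocInt g) : AEStronglyMeasurable g volume := by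
  have h : LocallyIntegrable g volume := by
    refine locallyIntegrable_iff.2 fun k hk => ?_
    obtain ⟨R, hR⟩ := hk.isBounded.subset_closedBall 0
    rw [Real.closedBall_eq_Icc] at hR
    rcases lt_or_ge R 0 with h | h
    · have : k = ∅ := by
        rw [Icc_eq_empty (by linarith)] at hR
        exact subset_empty_iff.1 hR
      simp [this]
    · exact ((intervalIntegrable_iff_integrableOn_Icc_of_le (by linarith)).1
        (hg (0 - R) (0 + R))).mono_set hR
  exact h.aestronglyMeasurable

end LocInt

/-- Lebesgue measure on the window `(-ℓ, L)`. -/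
abbrev window (ℓ L : ℝ) : Measure ℝ := volume.restrict (Ioo (-ℓ) L)

/-- `R` maps functions on the line linearly to functions on the road, and is bounded from
`L²(-ℓ, L)` to `L²(0, L)`. -/
structure IsTraceOp (ℓ L : ℝ) (R : (ℝ → ℝ) → ℝ → ℝ) : Prop where
  comb : ∀ g h, LocInt g → LocInt h → ∀ p q x,
    R (fun s => p * g s + q * h s) x = p * R g x + q * R h x
  meas : ∀ g, LocInt g → AEStronglyMeasurable (R g) (road L)
  bound : ∃ C : ENNReal, C ≠ ⊤ ∧ ∀ g, LocInt g →
    eLpNorm (R g) 2 (road L) ≤ C * eLpNorm g 2 (window ℓ L)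

section

variable {k : ℝ}

lemma measurableEmbedding_neg_mul (hk : 0 < k) : MeasurableEmbedding fun x : ℝ => -k * x :=
  (Homeomorph.mulLeft₀ (-k) (neg_lt_zero.2 hk).ne).measurableEmbedding

lemma map_neg_mul_restrict (hk : 0 < k) (a b : ℝ) :
    Measure.map (fun x => -k * x) (volume.restrict (Ioo a b)) =
      ENNReal.ofReal |(-k)⁻¹| • volume.restrict (Ioo (-(k * b)) (-(k * a))) := by
  have : (fun x => -k * x) ⁻¹' Ioo (-(k * b)) (-(k * a)) = Ioo a b := by
    ext x
    simp only [mem_preimage, mem_Ioo]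
    constructor
    · rintro ⟨h1, h2⟩; constructor <;> nlinarith
    · rintro ⟨h1, h2⟩; constructor <;> nlinarith
  rw [← this, ← (measurableEmbedding_neg_mul hk).restrict_map,
    Real.map_volume_mul_left (neg_lt_zero.2 hk).ne, Measure.restrict_smul]

lemma eLpNorm_reflect (hk : 0 < k) (a b : ℝ) (g : ℝ → ℝ) :
    eLpNorm (fun x => g (-(k * x))) 2 (volume.restrict (Ioo a b)) =
      ENNReal.ofReal |(-k)⁻¹| ^ (1 / (2 : ENNReal)).toReal *
        eLpNorm g 2 (volume.restrict (Ioo (-(k * b)) (-(k * a)))) := by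
  have e : (fun x => g (-(k * x))) = g ∘ fun x => -k * x := by ext x; simp
  rw [e, ← (measurableEmbedding_neg_mul hk).eLpNorm_map_measure, map_neg_mul_restrict hk,
    eLpNorm_smul_measure_of_ne_top (by norm_num), smul_eq_mul]

lemma aestronglyMeasurable_reflect (hk : 0 < k) {a b : ℝ} {g : ℝ → ℝ}
    (hg : AEStronglyMeasurable g (volume.restrict (Ioo (-(k * b)) (-(k * a))))) :
    AEStronglyMeasurable (fun x => g (-(k * x))) (volume.restrict (Ioo a b)) := by
  have h := (measurableEmbedding_neg_mul hk).aestronglyMeasurable_map_iff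
    (μ := volume.restrict (Ioo a b)) (g := g)
  have e : (fun x => g (-(k * x))) = g ∘ fun x => -k * x := by ext x; simp
  rw [e, ← h, map_neg_mul_restrict hk]
  exact hg.smul_measure _

end

lemma continuous_memory {K b g : ℝ → ℝ} (hK : IsPC K) (hb : Continuous b) (hg : LocInt g) :
    Continuous (memory K b g) := by
  have hc := continuous_integral_mul_sub hg hK
  have e : memory K b g = fun x => (∫ r in (0 : ℝ)..x, g r * K (x - r)) -
      ∫ r in (0 : ℝ)..(b x), g r * K (x - r) := by
    ext x
    have hI := fun c => hK.intervalIntegrable_mul_sub (hg 0 c) x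
    rw [intervalIntegral.integral_interval_sub_left (hI _) (hI _)]
    rfl
  rw [e]
  exact (hc.comp (f := fun x : ℝ => (x, x)) (by fun_prop)).sub
    (hc.comp (f := fun x : ℝ => (x, b x)) (by fun_prop))

namespace IsTraceOp

variable {ℓ L : ℝ} {R S : (ℝ → ℝ) → ℝ → ℝ}

/-- Memory terms are bounded by the Cauchy–Schwarz inequality, provided that the memory reaches no
further back than the window. -/
lemma of_memory {K b : ℝ → ℝ} (hK : IsPC K) (hb : Continuous b)
    (hbl : ∀ x ∈ Icc 0 L, -ℓ ≤ b x ∧ b x ≤ x) : IsTraceOp ℓ L (memory K b) where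
  comb g h hg hh p q x := by
    rw [memory, memory, memory, ← intervalIntegral.integral_const_mul,
      ← intervalIntegral.integral_const_mul, ← intervalIntegral.integral_add
      ((hK.intervalIntegrable_mul_sub (hg _ _) x).const_mul _)
      ((hK.intervalIntegrable_mul_sub (hh _ _) x).const_mul _)]
    congr 1; ext s; ring
  meas g hg := (continuous_memory hK hb hg).aestronglyMeasurable
  bound := by
    obtain ⟨C, hC⟩ := hK.bounded (L + ℓ)
    refine ⟨ENNReal.ofReal C * volume (Ioo (-ℓ) L) ^ (1 / (1 : ENNReal).toReal -
      1 / (2 : ENNReal).toReal) * road L Set.univ ^ (2 : ENNReal).toReal⁻¹, ?_, fun g hg => ?_⟩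
    · refine ENNReal.mul_ne_top (ENNReal.mul_ne_top ENNReal.ofReal_ne_top ?_) ?_ <;>
        refine ENNReal.rpow_ne_top_of_nonneg (by norm_num) ?_ <;> simp
    have hpt : ∀ᵐ x ∂(road L), ‖memory K b g x‖ₑ ≤
        ENNReal.ofReal C * eLpNorm g 1 (window ℓ L) := by
      refine (ae_restrict_mem measurableSet_Ioo).mono fun x hx => ?_
      have hbx := hbl x (Ioo_subset_Icc_self hx)
      rw [memory, intervalIntegral.integral_of_le hbx.2, eLpNorm_one_eq_lintegral_enorm,
        ← lintegral_const_mul' _ _ ENNReal.ofReal_ne_top]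
      refine (enorm_integral_le_lintegral_enorm _).trans ?_
      refine (lintegral_mono_ae (g := fun s => ENNReal.ofReal C * ‖g s‖ₑ) ?_).trans
        (lintegral_mono' (Measure.restrict_mono ?_ le_rfl) le_rfl)
      · refine (ae_restrict_mem measurableSet_Ioc).mono fun s hs => ?_
        rw [enorm_mul, mul_comm]
        refine mul_le_mul_left ?_ _
        rw [← ofReal_norm]
        refine ENNReal.ofReal_le_ofReal (hC _ ?_)
        rw [abs_of_nonneg (by linarith [hs.2])]
        linarith [hs.1, hx.2, hbx.1]
      · exact fun s hs => ⟨lt_of_le_of_lt hbx.1 hs.1, lt_of_le_of_lt hs.2 hx.2⟩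
    refine (eLpNorm_le_of_ae_enorm_bound hpt).trans ?_
    have h2 := eLpNorm_le_eLpNorm_mul_rpow_measure_univ (μ := window ℓ L) (p := 1) (q := 2)
      (by norm_num) (hg.aestronglyMeasurable.mono_measure Measure.restrict_le_self)
    rw [Measure.restrict_apply_univ] at h2
    rw [smul_eq_mul]
    calc _ ≤ ENNReal.ofReal C * (eLpNorm g 2 (window ℓ L) * volume (Ioo (-ℓ) L) ^
          (1 / (1 : ENNReal).toReal - 1 / (2 : ENNReal).toReal)) * _ := by gcongr
      _ = _ := by ring

lemma of_eval (hℓ : 0 ≤ ℓ) : IsTraceOp ℓ L fun g => g where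
  comb _ _ _ _ _ _ _ := rfl
  meas g hg := hg.aestronglyMeasurable.mono_measure Measure.restrict_le_self
  bound := ⟨1, by simp, fun g _ => by
    rw [one_mul]
    exact eLpNorm_mono_measure _ (Measure.restrict_mono (Ioo_subset_Ioo_left (by linarith)) le_rfl)⟩

lemma of_reflect (hL : 0 ≤ L) {k : ℝ} (hk : 0 < k) :
    IsTraceOp (k * L) L fun g x => g (-(k * x)) where
  comb _ _ _ _ _ _ _ := rfl
  meas g hg := aestronglyMeasurable_reflect hk
    (hg.aestronglyMeasurable.mono_measure Measure.restrict_le_self)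
  bound := ⟨ENNReal.ofReal |(-k)⁻¹| ^ (1 / (2 : ENNReal)).toReal,
    ENNReal.rpow_ne_top_of_nonneg (by norm_num) (by simp), fun g _ => by
    rw [road, eLpNorm_reflect hk, mul_zero, neg_zero]
    exact mul_le_mul_right (eLpNorm_mono_measure _ (Measure.restrict_mono
      (Ioo_subset_Ioo_right hL) le_rfl)) _⟩

lemma add (hR : IsTraceOp ℓ L R) (hS : IsTraceOp ℓ L S) :
    IsTraceOp ℓ L fun g x => R g x + S g x where
  comb g h hg hh p q x := by rw [hR.comb g h hg hh, hS.comb g h hg hh]; ring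
  meas g hg := (hR.meas g hg).add (hS.meas g hg)
  bound := by
    obtain ⟨C, hC, hCb⟩ := hR.bound
    obtain ⟨D, hD, hDb⟩ := hS.bound
    refine ⟨C + D, ENNReal.add_ne_top.2 ⟨hC, hD⟩, fun g hg => ?_⟩
    rw [add_mul]
    exact (eLpNorm_add_le (hR.meas g hg) (hS.meas g hg) (by norm_num)).trans
      (add_le_add (hCb g hg) (hDb g hg))

lemma mul {r : ℝ → ℝ} (hr : Continuous r) (hR : IsTraceOp ℓ L R) :
    IsTraceOp ℓ L fun g x => r x * R g x where
  comb g h hg hh p q x := by rw [hR.comb g h hg hh]; ring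
  meas g hg := hr.aestronglyMeasurable.mul (hR.meas g hg)
  bound := by
    obtain ⟨C, hC, hCb⟩ := hR.bound
    obtain ⟨D, -, hDb⟩ := exists_eLpNorm_mul_le (L := L) hr
    refine ⟨ENNReal.ofReal D * C, ENNReal.mul_ne_top ENNReal.ofReal_ne_top hC, fun g hg => ?_⟩
    rw [mul_assoc]
    exact (hDb _).trans (by gcongr; exact hCb g hg)

lemma memLp (hR : IsTraceOp ℓ L R) {g : ℝ → ℝ} (hg : LocInt g)
    (hg2 : eLpNorm g 2 (window ℓ L) ≠ ⊤) : MemLp (R g) 2 (road L) := by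
  obtain ⟨C, hC, hCb⟩ := hR.bound
  exact ⟨hR.meas g hg, (hCb g hg).trans_lt (ENNReal.mul_lt_top hC.lt_top hg2.lt_top)⟩

end IsTraceOp

/-! ### Evolutions driven by a history function -/

/-- `H` is a primitive of the square integrable function `φ`. -/
structure IsHistory (φ H : ℝ → ℝ) : Prop where
  measurable : Measurable φ
  memLp : MemLp φ 2 volume
  sub_eq : ∀ s t, H t - H s = ∫ r in s..t, φ r

namespace IsHistory

variable {φ H : ℝ → ℝ}

lemma locInt (h : IsHistory φ H) : LocInt φ := fun a b =>
  ((h.memLp.locallyIntegrable (by norm_num)).integrableOn_isCompact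
    isCompact_uIcc).intervalIntegrable

lemma continuous (h : IsHistory φ H) : Continuous H := by
  have e : H = fun t => H 0 + ∫ r in (0 : ℝ)..t, φ r := by
    ext t; rw [← h.sub_eq]; ring
  rw [e]
  exact continuous_const.add (intervalIntegral.continuous_primitive h.locInt 0)

lemma locInt_primitive (h : IsHistory φ H) : LocInt H := fun a b =>
  h.continuous.intervalIntegrable a b

lemma tendsto_quotient (h : IsHistory φ H) :
    Tendsto (fun δ => eLpNorm (fun s => δ⁻¹ * (H (s + δ) - H s) - φ s) 2 volume) (𝓝[≠] 0)
      (𝓝 0) :=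
  tendsto_eLpNorm_difference_quotient h.measurable h.memLp h.locInt h.sub_eq

/-- Although `H` itself need not be square integrable, its increments are, and they tend to zero in
`L²` with the length of the step. -/
lemma tendsto_translate_sub (h : IsHistory φ H) :
    Tendsto (fun δ => eLpNorm (fun s => H (s + δ) - H s) 2 volume) (𝓝 0) (𝓝 0) := by
  have h0 : eLpNorm (fun s => H (s + 0) - H s) 2 volume = 0 := by simp
  have key : Tendsto (fun δ => eLpNorm (fun s => H (s + δ) - H s) 2 volume) (𝓝[≠] 0) (𝓝 0) := by
    have hb : Tendsto (fun δ : ℝ => ‖δ‖ₑ * (eLpNorm (fun s => δ⁻¹ * (H (s + δ) - H s) - φ s) 2 volume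
        + eLpNorm φ 2 volume)) (𝓝[≠] 0) (𝓝 0) := by
      have h1 : Tendsto (fun δ : ℝ => ‖δ‖ₑ) (𝓝[≠] 0) (𝓝 0) := by
        have := (continuous_enorm (E := ℝ)).tendsto 0
        rw [enorm_zero] at this
        exact this.mono_left nhdsWithin_le_nhds
      have h2 := ENNReal.Tendsto.mul h1 (Or.inr (by simpa using h.memLp.2.ne))
        (h.tendsto_quotient.add (tendsto_const_nhds (x := eLpNorm φ 2 volume))) (Or.inr (by simp))
      simpa using h2
    refine tendsto_of_tendsto_of_tendsto_of_le_of_le' tendsto_const_nhds hb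
      (Eventually.of_forall fun _ => zero_le) ?_
    filter_upwards [self_mem_nhdsWithin] with δ hδ
    have e : (fun s => H (s + δ) - H s) =
        δ • ((fun s => δ⁻¹ * (H (s + δ) - H s) - φ s) + φ) := by
      ext s
      simp only [Pi.smul_apply, Pi.add_apply, smul_eq_mul, sub_add_cancel]
      rw [mul_inv_cancel_left₀ hδ]
    have hc := h.continuous
    have hm : AEStronglyMeasurable (fun s => δ⁻¹ * (H (s + δ) - H s) - φ s) volume := by
      have : Continuous fun s => δ⁻¹ * (H (s + δ) - H s) := by fun_prop
      exact this.aestronglyMeasurable.sub h.memLp.1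
    rw [e, eLpNorm_const_smul]
    exact mul_le_mul_right (eLpNorm_add_le hm h.memLp.1 (by norm_num)) _
  have := (continuousAt_iff_punctured_nhds (a := (0 : ℝ))
    (f := fun δ => eLpNorm (fun s => H (s + δ) - H s) 2 volume)).2 (by rw [h0]; exact key)
  rw [ContinuousAt, h0] at this
  exact this

/-- The state profiles read off from a moving window of a history function form an evolution. -/
lemma isEvolution (h : IsHistory φ H) {ℓ L lam : ℝ} (hL : 0 ≤ L) (hlam : lam ≠ 0)
    {R S Q : (ℝ → ℝ) → ℝ → ℝ} (hR : IsTraceOp ℓ L R) (hS : IsTraceOp ℓ L S)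
    (hQ : IsTraceOp ℓ L Q)
    (hd : ∀ t, ∀ x ∈ Icc 0 L, R (fun s => H (t + s)) x = R (fun s => H (t + s)) 0 +
      ∫ y in (0 : ℝ)..x, (S (fun s => φ (t + s)) y + Q (fun s => H (t + s)) y)) :
    (∀ t, IsH1 L (R fun s => H (t + s)) ∧ deriv (R fun s => H (t + s)) =ᵐ[road L]
      fun y => S (fun s => φ (t + s)) y + Q (fun s => H (t + s)) y) ∧
    ∀ T, IsEvolution L T (fun t => R fun s => H (lam * t + s))
      (fun t x => lam * R (fun s => φ (lam * t + s)) x) := by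
  have hφw : ∀ t, eLpNorm (fun s => φ (t + s)) 2 (window ℓ L) ≠ ⊤ := fun t => by
    have := (h.memLp.comp_measurePreserving (measurePreserving_add_left volume t)).2
    exact ((eLpNorm_mono_measure _ Measure.restrict_le_self).trans_lt this).ne
  have hHw : ∀ t, eLpNorm (fun s => H (t + s)) 2 (window ℓ L) ≠ ⊤ := fun t => by
    have hc : Continuous fun s => H (t + s) := by have := h.continuous; fun_prop
    obtain ⟨C, hC⟩ := isCompact_Icc.exists_bound_of_continuousOn (hc.continuousOn (s := Icc (-ℓ) L))
    refine (MemLp.of_bound hc.aestronglyMeasurable C ?_).2.ne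
    exact (ae_restrict_mem measurableSet_Ioo).mono fun x hx => hC x (Ioo_subset_Icc_self hx)
  have hlφ := fun t => h.locInt.shift t
  have hlH := fun t => h.locInt_primitive.shift t
  have hH1 : ∀ t, IsH1 L (R fun s => H (t + s)) ∧ deriv (R fun s => H (t + s)) =ᵐ[road L]
      fun y => S (fun s => φ (t + s)) y + Q (fun s => H (t + s)) y := fun t =>
    IsH1.of_density hL ((hS.memLp (hlφ t) (hφw t)).add (hQ.memLp (hlH t) (hHw t))) (hd t)
  -- window norms of increments are controlled by translations on the whole line
  have hwin : ∀ (u : ℝ → ℝ) (t : ℝ), AEStronglyMeasurable u volume →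
      eLpNorm (fun s => u (t + s)) 2 (window ℓ L) ≤ eLpNorm u 2 volume := fun u t hu => by
    refine (eLpNorm_mono_measure _ Measure.restrict_le_self).trans (le_of_eq ?_)
    exact eLpNorm_comp_measurePreserving hu (measurePreserving_add_left volume t)
  have hop : ∀ {O : (ℝ → ℝ) → ℝ → ℝ}, IsTraceOp ℓ L O → ∀ {l : Filter ℝ} {u : ℝ → ℝ → ℝ},
      (∀ s, LocInt (u s)) → Tendsto (fun s => eLpNorm (u s) 2 (window ℓ L)) l (𝓝 0) →
      Tendsto (fun s => eLpNorm (O (u s)) 2 (road L)) l (𝓝 0) := by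
    intro O hO l u hu hl
    obtain ⟨C, hC, hCb⟩ := hO.bound
    have h1 := ENNReal.Tendsto.const_mul hl (Or.inr hC)
    rw [mul_zero] at h1
    exact tendsto_of_tendsto_of_tendsto_of_le_of_le tendsto_const_nhds h1
      (fun _ => zero_le) fun s => hCb _ (hu s)
  have hδ : ∀ t, Tendsto (fun s => lam * (s - t)) (𝓝 t) (𝓝 0) := fun t => by
    have : Continuous fun s => lam * (s - t) := by fun_prop
    simpa using this.tendsto t
  have hmH : ∀ δ, AEStronglyMeasurable (fun s => H (s + δ) - H s) volume := fun δ => by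
    have := h.continuous
    exact (by fun_prop : Continuous fun s => H (s + δ) - H s).aestronglyMeasurable
  have hmφ : ∀ δ, AEStronglyMeasurable (fun s => φ (s + δ) - φ s) volume := fun δ =>
    ((h.measurable.comp (measurable_id.add_const δ)).sub h.measurable).aestronglyMeasurable
  have hincr : ∀ (u : ℝ → ℝ) (t s r : ℝ), u (lam * s + r) - u (lam * t + r) =
      u (lam * t + r + lam * (s - t)) - u (lam * t + r) := fun u t s r => by ring_nf
  have hwH : ∀ t, Tendsto (fun s => eLpNorm (fun r => H (lam * s + r) - H (lam * t + r)) 2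
      (window ℓ L)) (𝓝 t) (𝓝 0) := fun t => by
    refine tendsto_of_tendsto_of_tendsto_of_le_of_le tendsto_const_nhds
      (h.tendsto_translate_sub.comp (hδ t)) (fun _ => zero_le) fun s => ?_
    simp only [hincr]
    exact hwin (fun r => H (r + lam * (s - t)) - H r) (lam * t) (hmH (lam * (s - t)))
  have hwφ : ∀ t, Tendsto (fun s => eLpNorm (fun r => φ (lam * s + r) - φ (lam * t + r)) 2
      (window ℓ L)) (𝓝 t) (𝓝 0) := fun t => by
    refine tendsto_of_tendsto_of_tendsto_of_le_of_le tendsto_const_nhds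
      ((tendsto_eLpNorm_translate_sub h.memLp).comp (hδ t)) (fun _ => zero_le) fun s => ?_
    simp only [hincr]
    exact hwin (fun r => φ (r + lam * (s - t)) - φ r) (lam * t) (hmφ (lam * (s - t)))
  have hsub : ∀ {O : (ℝ → ℝ) → ℝ → ℝ}, IsTraceOp ℓ L O → ∀ {g k : ℝ → ℝ}, LocInt g → LocInt k →
      ∀ x, O (fun r => g r - k r) x = O g x - O k x := by
    intro O hO g k hg hk x
    have := hO.comb g k hg hk 1 (-1) x
    simpa [sub_eq_add_neg] using this
  have hls : ∀ {g k : ℝ → ℝ}, LocInt g → LocInt k → LocInt fun r => g r - k r :=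
    fun hg hk a b => (hg a b).sub (hk a b)
  refine ⟨hH1, fun T => ⟨fun t _ => (hH1 _).1, fun t _ => ?_, fun t _ => ?_⟩⟩
  · rw [tendsto_h1Norm_zero_iff hL
      (Eventually.of_forall fun s => ((hH1 (lam * s)).1.sub hL (hH1 (lam * t)).1).1)]
    constructor
    · have h1 := (ENNReal.tendsto_toReal ENNReal.zero_ne_top).comp
        (hop hR (fun s => hls (hlH (lam * s)) (hlH (lam * t))) (hwH t))
      refine (h1.mono_left nhdsWithin_le_nhds).congr fun s => ?_
      simp only [Function.comp, l2]
      congr 2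
      ext x
      exact hsub hR (hlH _) (hlH _) x
    · have h1 := (hop hS (fun s => hls (hlφ (lam * s)) (hlφ (lam * t))) (hwφ t)).add
        (hop hQ (fun s => hls (hlH (lam * s)) (hlH (lam * t))) (hwH t))
      rw [add_zero] at h1
      have h2 : Tendsto (fun s => eLpNorm (deriv fun x => R (fun r => H (lam * s + r)) x -
          R (fun r => H (lam * t + r)) x) 2 (road L)) (𝓝 t) (𝓝 0) := by
        refine tendsto_of_tendsto_of_tendsto_of_le_of_le tendsto_const_nhds h1
          (fun _ => zero_le) fun s => ?_
        refine le_trans (le_of_eq (eLpNorm_congr_ae ?_)) (eLpNorm_add_le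
          (hS.meas _ (hls (hlφ (lam * s)) (hlφ (lam * t))))
          (hQ.meas _ (hls (hlH (lam * s)) (hlH (lam * t)))) (by norm_num))
        filter_upwards [(hH1 (lam * s)).2, (hH1 (lam * t)).2,
          ((hH1 (lam * s)).1.sub hL (hH1 (lam * t)).1).2] with x h3 h4 h5
        rw [h5, h3, h4, Pi.add_apply, hsub hS (hlφ _) (hlφ _),
          hsub hQ (hlH _) (hlH _)]
        ring
      have h3 := (ENNReal.tendsto_toReal ENNReal.zero_ne_top).comp h2
      exact h3.mono_left nhdsWithin_le_nhds
  -- the difference quotient in time is `R` applied to the difference quotient of the history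
  · set u : ℝ → ℝ → ℝ := fun s r =>
      1 * ((s - t)⁻¹ * H (lam * s + r) + (-(s - t)⁻¹) * H (lam * t + r)) +
        (-lam) * φ (lam * t + r) with hu
    have hlu : ∀ s, LocInt (u s) := fun s =>
      LocInt.comb ((hlH _).comb (hlH _) _ _) (hlφ _) _ _
    have hRu : ∀ s x, R (u s) x = (s - t)⁻¹ * (R (fun r => H (lam * s + r)) x -
        R (fun r => H (lam * t + r)) x) - lam * R (fun r => φ (lam * t + r)) x := fun s x => by
      rw [hu, hR.comb _ _ ((hlH _).comb (hlH _) _ _) (hlφ _), hR.comb _ _ (hlH _) (hlH _)]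
      ring
    have hlim : Tendsto (fun s => eLpNorm (u s) 2 (window ℓ L)) (𝓝[≠] t) (𝓝 0) := by
      have h1 : Tendsto (fun s => lam * (s - t)) (𝓝[≠] t) (𝓝[≠] 0) := by
        refine tendsto_nhdsWithin_iff.2 ⟨(hδ t).mono_left nhdsWithin_le_nhds, ?_⟩
        filter_upwards [self_mem_nhdsWithin] with s hs
        exact mul_ne_zero hlam (sub_ne_zero.2 hs)
      have h2 := ENNReal.Tendsto.const_mul (a := ‖lam‖ₑ) (h.tendsto_quotient.comp h1)
        (Or.inr (by simp))
      rw [mul_zero] at h2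
      refine tendsto_of_tendsto_of_tendsto_of_le_of_le' tendsto_const_nhds h2
        (Eventually.of_forall fun _ => zero_le) ?_
      filter_upwards [self_mem_nhdsWithin] with s hs
      have hs' : s - t ≠ 0 := sub_ne_zero.2 hs
      have e : u s = fun r => (lam • fun y => (lam * (s - t))⁻¹ * (H (y + lam * (s - t)) - H y) - φ y)
          (lam * t + r) := by
        ext r
        have := hincr H t s r
        simp only [hu, Pi.smul_apply, smul_eq_mul]
        rw [← this]
        field_simp
        ring
      rw [e]
      simp only [Function.comp]
      rw [← eLpNorm_const_smul]
      exact hwin (lam • fun y => (lam * (s - t))⁻¹ * (H (y + lam * (s - t)) - H y) - φ y) _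
        ((((hmH _).const_mul _).sub h.measurable.aestronglyMeasurable).const_smul _)
    have h1 := (hop hR hlu hlim).mono_left (nhdsWithin_mono t (s := timeInterval T \ {t})
      fun s hs => hs.2)
    refine h1.congr fun s => ?_
    congr 1
    ext x
    exact hRu s x

end IsHistory

/-! ### Velocity and flow read off from a history function -/

namespace IsHistory

variable {φ H : ℝ → ℝ}

lemma shift (h : IsHistory φ H) (t : ℝ) :
    IsHistory (fun s => φ (t + s)) (fun s => H (t + s)) where
  measurable := h.measurable.comp (measurable_const.add measurable_id)
  memLp := h.memLp.comp_measurePreserving (measurePreserving_add_left volume t)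
  sub_eq s r := by
    rw [h.sub_eq, intervalIntegral.integral_comp_add_left φ t]

/-- Integration by parts against a smooth function. -/
lemma integral_mul_smooth (h : IsHistory φ H) {u u' : ℝ → ℝ} (hu : ∀ s, HasDerivAt u (u' s) s)
    (hu' : Continuous u') (a b : ℝ) :
    ∫ s in a..b, φ s * u s = H b * u b - H a * u a - ∫ s in a..b, H s * u' s := by
  have hHac : AbsolutelyContinuousOnInterval H a b := by
    have h1 : AbsolutelyContinuousOnInterval (fun x => ∫ r in a..x, φ r) a b :=
      (h.locInt a b).absolutelyContinuousOnInterval_intervalIntegral (c := a) (by simp)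
    have h2 : AbsolutelyContinuousOnInterval (fun _ : ℝ => H a) a b :=
      (LipschitzWith.const (H a)).lipschitzOnWith.absolutelyContinuousOnInterval
    have h3 := h2.fun_add h1
    have e : (fun x => H a + ∫ r in a..x, φ r) = H := by
      ext x; rw [← h.sub_eq]; ring
    rwa [e] at h3
  have hd : deriv u = u' := by ext s; exact (hu s).deriv
  have huac : AbsolutelyContinuousOnInterval u a b := by
    have : ContDiff ℝ 1 u := contDiff_one_iff_deriv.2 ⟨fun s => (hu s).differentiableAt, by rwa [hd]⟩
    exact this.contDiffOn.absolutelyContinuousOnInterval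
  have hdH : ∀ᵐ x, x ∈ uIoc a b → deriv H x = φ x := by
    filter_upwards [(h.locInt a b).ae_hasDerivAt_integral] with x hx hxm
    have h1 := hx (uIoc_subset_uIcc hxm) a (by simp)
    have e : (fun x => H a + ∫ r in a..x, φ r) = H := by
      ext x; rw [← h.sub_eq]; ring
    have h2 := h1.const_add (H a)
    rw [e] at h2
    exact h2.deriv
  have key := huac.integral_mul_deriv_eq_deriv_mul hHac
  rw [hd] at key
  have e1 : ∫ s in a..b, u s * deriv H s = ∫ s in a..b, φ s * u s :=
    intervalIntegral.integral_congr_ae (hdH.mono fun x hx hm => by rw [hx hm, mul_comm])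
  rw [e1] at key
  rw [key]
  simp only [mul_comm]

/-- Convolution with a bounded kernel commutes with taking primitives. -/
lemma conv_eq (h : IsHistory φ H) {K : ℝ → ℝ} (hK : IsPC K) {z : ℝ} (hz : 0 ≤ z) :
    conv H K z = H 0 * (∫ r in (0 : ℝ)..z, K r) + ∫ y in (0 : ℝ)..z, conv φ K y := by
  have h1 : IsPC fun _ : ℝ => (1 : ℝ) := IsPC.of_continuous continuous_const
  have hi := h.locInt
  have hone : ∀ f : ℝ → ℝ, ∀ x, conv f (fun _ => 1) x = ∫ r in (0 : ℝ)..x, f r := fun f x => by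
    simp [conv]
  have hP : Continuous (conv φ fun _ => 1) := continuous_conv hi h1
  have e : H = fun t => H 0 + conv φ (fun _ => 1) t := by
    ext t; rw [hone, ← h.sub_eq]; ring
  have e1 : conv H K z = conv (fun _ => H 0) K z + conv (conv φ fun _ => 1) K z := by
    rw [conv, conv, conv, ← intervalIntegral.integral_add
      (hK.intervalIntegrable_mul_sub (intervalIntegrable_const) z)
      (hK.intervalIntegrable_mul_sub (hP.intervalIntegrable _ _) z)]
    refine intervalIntegral.integral_congr fun r _ => ?_
    rw [congrFun e r]; ring
  have e2 : conv (fun _ => H 0) K z = H 0 * ∫ r in (0 : ℝ)..z, K r := by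
    rw [conv_comm, conv, ← intervalIntegral.integral_const_mul]
    exact intervalIntegral.integral_congr fun r _ => mul_comm _ _
  rw [e1, e2, IsPC.conv_assoc hz (hi _ _) h1 hK, ← hone (conv φ K),
    IsPC.conv_assoc hz (hi _ _) hK h1]
  congr 2
  ext x
  exact conv_comm _ _ _

end IsHistory

namespace Traffic

variable {P : Traffic} {a : ℝ → ℝ} {K : Kernels} {φ H : ℝ → ℝ}

lemma isTraceOp_opV (ha : ContinuousOn a (Icc 0 P.L)) : IsTraceOp (P.k1 * P.L) P.L (P.opV a) := by
  have hk := P.k1_pos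
  have h0 : 0 ≤ P.k1 * P.L := mul_nonneg hk.le P.L_pos.le
  have hA : IsTraceOp (P.k1 * P.L) P.L (P.memA a) := IsTraceOp.of_memory (isPC_kerA ha)
    continuous_const fun x hx => ⟨le_rfl, by linarith [hx.1]⟩
  have hE : IsTraceOp (P.k1 * P.L) P.L P.memE :=
    IsTraceOp.of_memory (IsPC.of_continuous continuous_kerE) (by fun_prop) fun x hx =>
      ⟨neg_le_neg (mul_le_mul_of_nonneg_left hx.2 hk.le), by
        linarith [mul_nonneg hk.le hx.1, hx.1]⟩
  have h := (IsTraceOp.of_eval (L := P.L) h0).add ((hA.add hE).mul (r := fun _ => -1)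
    continuous_const)
  have e : P.opV a = fun g x => g x + -1 * (P.memA a g x + P.memE g x) := by
    ext g x; rw [opV]; ring
  rw [e]; exact h

lemma isTraceOp_opW : IsTraceOp (P.k1 * P.L) P.L P.opW :=
  (IsTraceOp.of_reflect P.L_pos.le P.k1_pos).mul (r := fun _ => P.k1) continuous_const

lemma memA_eq_conv (g : ℝ → ℝ) (x : ℝ) :
    P.memA a g x = conv (fun s => g (-(P.k1 * P.L) + s)) (P.kerA a) (P.k1 * P.L + x) := by
  have := intervalIntegral.integral_comp_add_left (a := 0) (b := P.k1 * P.L + x)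
    (fun s => g s * P.kerA a (x - s)) (-(P.k1 * P.L))
  rw [memA, memory, conv]
  rw [add_zero, neg_add_cancel_left] at this
  rw [← this]
  refine intervalIntegral.integral_congr fun s _ => ?_
  ring_nf

/-- The routing term differentiated: `A` vanishes beyond `k₁L`, so the lower end of the memory
interval contributes nothing. -/
lemma memA_sub (ha : ContinuousOn a (Icc 0 P.L)) (h : IsHistory φ H) {x : ℝ} (hx : 0 ≤ x) :
    P.memA a H x - P.memA a H 0 = ∫ y in (0 : ℝ)..x, P.memA a φ y := by
  set ℓ := P.k1 * P.L with hℓ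
  have h0 : 0 ≤ ℓ := mul_nonneg P.k1_pos.le P.L_pos.le
  have hA := isPC_kerA ha
  have hs := h.shift (-ℓ)
  have hc : Continuous (conv (fun s => φ (-ℓ + s)) (P.kerA a)) :=
    continuous_conv hs.locInt hA
  have e1 : ∫ y in (0 : ℝ)..x, P.memA a φ y =
      ∫ y in (ℓ + 0)..(ℓ + x), conv (fun s => φ (-ℓ + s)) (P.kerA a) y := by
    rw [← intervalIntegral.integral_comp_add_left]
    exact intervalIntegral.integral_congr fun y _ => memA_eq_conv φ y
  have e2 : ∫ r in ℓ..(ℓ + x), P.kerA a r = 0 := by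
    refine intervalIntegral.integral_zero_ae (Eventually.of_forall fun r hr => ?_)
    rw [uIoc_of_le (by linarith)] at hr
    exact kerA_of_gt hr.1
  rw [e1, memA_eq_conv, memA_eq_conv, ← hℓ, hs.conv_eq hA (by linarith), hs.conv_eq hA (by linarith),
    ← intervalIntegral.integral_interval_sub_left (hc.intervalIntegrable 0 (ℓ + x))
      (hc.intervalIntegrable 0 (ℓ + 0)), add_zero, ← intervalIntegral.integral_add_adjacent_intervals
      (hA.intervalIntegrable 0 ℓ) (hA.intervalIntegrable ℓ (ℓ + x)), e2]
  ring_nf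

/-- The boundary term that the moving lower end of the memory interval produces is the in-domain
coupling. -/
lemma one_add_k1_mul_kerE (x : ℝ) :
    (1 + P.k1) * P.kerE ((1 + P.k1) * x) = 1 / P.vs * P.c x := by
  have h := kap_mul_one_add_k1 P
  have h1 : (1 + P.k1) / (P.γ * P.ps) = 1 / P.vs := by
    have hγ := P.gamma_ps_pos.ne'
    have hv := P.vs_pos.ne'
    rw [kap] at h
    field_simp at h ⊢
    linarith
  rw [kerE, ← mul_assoc, h, one_mul, ← h1]; ring

/-- The coupling term differentiated by parts: both ends of the memory interval move. -/
lemma hasDerivAt_memE (h : IsHistory φ H) (x : ℝ) :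
    HasDerivAt (P.memE H) (P.memE φ x + 1 / P.vs * P.c x * H (-(P.k1 * x))) x := by
  set β := P.kap / (P.τ * P.vs) with hβ
  have hHc := h.continuous
  have hdE : ∀ s, HasDerivAt (fun s => P.kerE (x - s)) (β * P.kerE (x - s)) s := fun s => by
    have := (hasDerivAt_kerE (P := P) (x - s)).comp s ((hasDerivAt_id s).const_sub x)
    refine this.congr_deriv ?_
    ring
  have hcE : Continuous fun s => β * P.kerE (x - s) := by
    have := continuous_kerE (P := P); fun_prop
  have hip := h.integral_mul_smooth hdE hcE (-(P.k1 * x)) x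
  have hφ : P.memE φ x = H x * P.kerE 0 - H (-(P.k1 * x)) * P.kerE ((1 + P.k1) * x) -
      β * P.memE H x := by
    rw [memE, memory, hip, memory, ← intervalIntegral.integral_const_mul, sub_self]
    have : x - -(P.k1 * x) = (1 + P.k1) * x := by ring
    rw [this]
    congr 1
    refine intervalIntegral.integral_congr fun s _ => ?_
    ring_nf
  have hc : Continuous fun r => H r * P.damp (-(P.kap * r)) :=
    hHc.mul (continuous_damp.comp (by fun_prop))
  have e : P.memE H = fun y => P.kerE y * ((∫ r in (0 : ℝ)..y, H r * P.damp (-(P.kap * r))) -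
      ∫ r in (0 : ℝ)..(-(P.k1 * y)), H r * P.damp (-(P.kap * r))) := by
    ext y
    rw [intervalIntegral.integral_interval_sub_left (hc.intervalIntegrable _ _)
      (hc.intervalIntegrable _ _), memE, memory, ← intervalIntegral.integral_const_mul]
    refine intervalIntegral.integral_congr fun r _ => ?_
    rw [kerE_eq, kerE_eq y, mul_sub, sub_eq_add_neg, damp_add]; ring
  have d1 := (hc.integral_hasStrictDerivAt 0 x).hasDerivAt
  have d2 := HasDerivAt.comp (h₂ := fun y => ∫ r in (0 : ℝ)..y, H r * P.damp (-(P.kap * r))) x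
    (hc.integral_hasStrictDerivAt 0 (-(P.k1 * x))).hasDerivAt
    (((hasDerivAt_id x).const_mul P.k1).neg)
  have d3 := (hasDerivAt_kerE (P := P) x).mul (d1.sub d2)
  have hval : P.memE H x = P.kerE x * ((∫ r in (0 : ℝ)..x, H r * P.damp (-(P.kap * r))) -
      ∫ r in (0 : ℝ)..(-(P.k1 * x)), H r * P.damp (-(P.kap * r))) := congrFun e x
  have hd0 : P.kerE x * P.damp (-(P.kap * x)) = P.kerE 0 := by
    rw [kerE_eq x, mul_assoc, ← damp_add]; simp [damp]
  have hd1 : P.kerE x * P.damp (-(P.kap * -(P.k1 * x))) = P.kerE ((1 + P.k1) * x) := by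
    rw [kerE_eq x, mul_assoc, ← damp_add, kerE_eq ((1 + P.k1) * x)]
    congr 2; ring
  rw [e]
  refine d3.congr_deriv ?_
  rw [hφ, hval, ← one_add_k1_mul_kerE, ← hd0, ← hd1]
  simp only [Pi.sub_apply, Pi.neg_apply, Function.comp, id, hβ]
  ring

/-- The spatial derivative of the velocity profile. -/
lemma opV_density (ha : ContinuousOn a (Icc 0 P.L)) (h : IsHistory φ H) {x : ℝ} (hx : 0 ≤ x) :
    P.opV a H x = P.opV a H 0 +
      ∫ y in (0 : ℝ)..x, (P.opV a φ y + -(1 / P.vs) * P.c y * H (-(P.k1 * y))) := by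
  have hcA : Continuous (P.memA a φ) := continuous_memory (isPC_kerA ha) continuous_const h.locInt
  have hcE : Continuous (P.memE φ) :=
    continuous_memory (IsPC.of_continuous continuous_kerE) (by fun_prop) h.locInt
  have hcH : Continuous fun y => 1 / P.vs * P.c y * H (-(P.k1 * y)) := by
    have := h.continuous
    have := P.continuous_c
    fun_prop
  have hcs : Continuous fun y => P.memE φ y + 1 / P.vs * P.c y * H (-(P.k1 * y)) := hcE.add hcH
  have hE : P.memE H x - P.memE H 0 =
      ∫ y in (0 : ℝ)..x, (P.memE φ y + 1 / P.vs * P.c y * H (-(P.k1 * y))) :=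
    (intervalIntegral.integral_eq_sub_of_hasDerivAt (fun y _ => hasDerivAt_memE h y)
      (hcs.intervalIntegrable _ _)).symm
  have hA := memA_sub ha h hx
  have hH := h.sub_eq 0 x
  have e : ∫ y in (0 : ℝ)..x, (P.opV a φ y + -(1 / P.vs) * P.c y * H (-(P.k1 * y))) =
      (∫ y in (0 : ℝ)..x, φ y) - (∫ y in (0 : ℝ)..x, P.memA a φ y) -
      ∫ y in (0 : ℝ)..x, (P.memE φ y + 1 / P.vs * P.c y * H (-(P.k1 * y))) := by
    rw [← intervalIntegral.integral_sub (h.locInt _ _) (hcA.intervalIntegrable _ _),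
      ← intervalIntegral.integral_sub ((h.locInt _ _).sub (hcA.intervalIntegrable _ _))
        (hcs.intervalIntegrable _ _)]
    refine intervalIntegral.integral_congr fun y _ => ?_
    rw [opV]; ring
  rw [e, ← hE, ← hA, ← hH, opV, opV]; ring

/-- The spatial derivative of the flow profile. -/
lemma opW_density (h : IsHistory φ H) (x : ℝ) :
    P.opW H x = P.opW H 0 + ∫ y in (0 : ℝ)..x, -P.k1 * P.opW φ y := by
  have hne : -P.k1 ≠ 0 := (neg_lt_zero.2 P.k1_pos).ne
  have e := intervalIntegral.integral_comp_mul_left (a := 0) (b := x) φ hne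
  have e1 : ∫ y in (0 : ℝ)..x, -P.k1 * P.opW φ y = P.k1 * (-P.k1 * ∫ y in (0 : ℝ)..x, φ (-P.k1 * y)) := by
    rw [← intervalIntegral.integral_const_mul, ← intervalIntegral.integral_const_mul]
    refine intervalIntegral.integral_congr fun y _ => ?_
    rw [opW, neg_mul_eq_neg_mul]; ring
  rw [e1, e, smul_eq_mul, mul_inv_cancel_left₀ hne, mul_zero, ← h.sub_eq, opW, opW,
    neg_mul_eq_neg_mul, mul_zero, neg_zero]
  ring

end Traffic

/-! ### Closed-loop solutions from history functions -/

namespace Traffic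

variable {P : Traffic} {a : ℝ → ℝ} {K : Kernels} {φ H : ℝ → ℝ}

lemma memE_zero (g : ℝ → ℝ) : P.memE g 0 = 0 := by
  simp [memE, memory]

/-- The inlet condition holds for every history function. -/
lemma inletCondition_op (g : ℝ → ℝ) :
    P.InletCondition a (P.opV a g) (P.opW g) := by
  have hL := P.L_pos.le
  have hk := P.k1_pos
  have e := intervalIntegral.integral_comp_mul_left (a := 0) (b := P.L)
    (fun s => g s * P.kerA a (0 - s)) (neg_ne_zero.2 hk.ne')
  have e1 : ∫ y in (0 : ℝ)..P.L, g (-P.k1 * y) * P.kerA a (0 - -P.k1 * y) =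
      P.mu * ∫ y in (0 : ℝ)..P.L, a y * g (-(P.k1 * y)) := by
    rw [← intervalIntegral.integral_const_mul]
    refine intervalIntegral.integral_congr fun y hy => ?_
    rw [uIcc_of_le hL] at hy
    have : 0 - -P.k1 * y = P.k1 * y := by ring
    simp only [this]
    rw [kerA_k1_mul hy, neg_mul]; ring
  have e2 : P.memA a g 0 = P.k1 * (P.mu * ∫ y in (0 : ℝ)..P.L, a y * g (-(P.k1 * y))) := by
    rw [← e1, e, memA, memory, mul_zero, smul_eq_mul, intervalIntegral.integral_symm, neg_mul]
    field_simp
  have e3 : ∫ y in (0 : ℝ)..P.L, a y * P.opW g y =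
      P.k1 * ∫ y in (0 : ℝ)..P.L, a y * g (-(P.k1 * y)) := by
    rw [← intervalIntegral.integral_const_mul]
    refine intervalIntegral.integral_congr fun y _ => ?_
    rw [opW]; ring
  rw [InletCondition, e3, opV, memE_zero, e2, opW]
  have h1 := mu_mul_k1 P
  have : P.k1 * (P.mu * ∫ y in (0 : ℝ)..P.L, a y * g (-(P.k1 * y))) =
      ∫ y in (0 : ℝ)..P.L, a y * g (-(P.k1 * y)) := by
    rw [← mul_assoc, mul_comm P.k1, h1, one_mul]
  rw [this, mul_zero, neg_zero]; ring

/-- The evolution of the profiles read off from a history function. -/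
lemma history_isEvolution (ha : ContinuousOn a (Icc 0 P.L)) (h : IsHistory φ H) :
    ((∀ t, IsH1 P.L (P.opV a fun s => H (t + s)) ∧
      deriv (P.opV a fun s => H (t + s)) =ᵐ[road P.L] fun y =>
        P.opV a (fun s => φ (t + s)) y + -(1 / P.vs) * P.c y * H (t + -(P.k1 * y))) ∧
      ∀ T, IsEvolution P.L T (fun t => P.opV a fun s => H (P.lam * t + s))
        (fun t x => P.lam * P.opV a (fun s => φ (P.lam * t + s)) x)) ∧
    (∀ t, IsH1 P.L (P.opW fun s => H (t + s)) ∧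
      deriv (P.opW fun s => H (t + s)) =ᵐ[road P.L] fun y =>
        -P.k1 * P.opW (fun s => φ (t + s)) y) ∧
      ∀ T, IsEvolution P.L T (fun t => P.opW fun s => H (P.lam * t + s))
        (fun t x => P.lam * P.opW (fun s => φ (P.lam * t + s)) x) := by
  have hL := P.L_pos.le
  have hc := P.continuous_c
  have hV := isTraceOp_opV ha
  have hW := isTraceOp_opW (P := P)
  have hQ : IsTraceOp (P.k1 * P.L) P.L fun g x => -(1 / P.vs) * P.c x * g (-(P.k1 * x)) :=
    (IsTraceOp.of_reflect hL P.k1_pos).mul (r := fun x => -(1 / P.vs) * P.c x) (by fun_prop)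
  have hS := hW.mul (r := fun _ => -P.k1) continuous_const
  have hZ := hW.mul (r := fun _ => 0) continuous_const
  have h1 := h.isEvolution hL P.lam_pos.ne' hV hV hQ fun t x hx => opV_density ha (h.shift t) hx.1
  have h2 := h.isEvolution hL P.lam_pos.ne' hW hS hZ fun t x _ => by
    simpa using opW_density (h.shift t) x
  refine ⟨h1, fun t => ⟨(h2.1 t).1, (h2.1 t).2.trans (Eventually.of_forall fun x => ?_)⟩, h2.2⟩
  simp

/-- A history function that equals `α` at the end of each window yields a closed-loop solution. -/
lemma isClosedLoop_op (ha : ContinuousOn a (Icc 0 P.L)) (hK : P.IsKernels a K)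
    (h : IsHistory φ H) {k3 : ℝ} {T : EReal} {α : ℝ → ℝ}
    (hα : ∀ t ∈ timeInterval T, H (P.lam * t + P.L) = α t)
    (hext : ∀ t ∈ timeInterval T, HasDerivWithinAt α (-k3 * α t) (timeInterval T) t) :
    P.IsClosedLoop a K k3 T (fun t => P.opV a fun s => H (P.lam * t + s))
      (fun t => P.opW fun s => H (P.lam * t + s)) α := by
  obtain ⟨⟨hV1, hV2⟩, hW1, hW2⟩ := history_isEvolution ha h
  have hv := P.vs_pos.ne'
  refine ⟨⟨(hW2 T).congr fun t _ => ?_, (hV2 T).congr fun t _ => ?_⟩,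
    fun t _ => inletCondition_op _, fun t ht => ?_, hext⟩
  · filter_upwards [(hW1 (P.lam * t)).2] with x hx
    rw [hx, ← k1_mul_vs]; ring
  · filter_upwards [(hV1 (P.lam * t)).2] with x hx
    rw [hx, opW, ← k1_mul_vs]
    field_simp
    ring
  · have hc := h.continuous
    exact (ramp_iff ha hK (by fun_prop) _).2 (hα t ht)

end Traffic

/-! ### The history function of an initial state -/

namespace IsHistory

variable {φ H : ℝ → ℝ}

/-- A primitive of a square integrable function with prescribed value at the origin. -/
lemma of_integral (hm : Measurable φ) (h2 : MemLp φ 2 volume) (c : ℝ) :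
    IsHistory φ fun t => c + ∫ r in (0 : ℝ)..t, φ r where
  measurable := hm
  memLp := h2
  sub_eq s t := by
    have hi : ∀ a b, IntervalIntegrable φ volume a b := fun a b =>
      ((h2.locallyIntegrable (by norm_num)).integrableOn_isCompact isCompact_uIcc).intervalIntegrable
    rw [add_sub_add_left_eq_sub, intervalIntegral.integral_interval_sub_left (hi _ _) (hi _ _)]

end IsHistory

lemma memLp_exp_tail {κ : ℝ} (hκ : 0 < κ) (L : ℝ) :
    MemLp ((Ioi L).indicator fun s => Real.exp (-κ * (s - L))) 2 volume := by
  rw [memLp_indicator_iff_restrict measurableSet_Ioi]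
  have hc : Continuous fun s => Real.exp (-κ * (s - L)) := by fun_prop
  rw [memLp_two_iff_integrable_sq hc.aestronglyMeasurable]
  have h := (integrableOn_exp_mul_Ioi (a := -(2 * κ)) (by linarith) L).const_mul
    (Real.exp (2 * κ * L))
  refine h.congr (Eventually.of_forall fun s => ?_)
  simp only [← Real.exp_add, ← Real.exp_nat_mul]
  congr 1; push_cast; ring

/-- Volterra equations of the second kind are well posed in `L²`. -/
lemma exists_volterra_l2 {L : ℝ} (hL : 0 ≤ L) {H : ℝ → ℝ} (hH : IsPC H) :
    ∃ C : ENNReal, C ≠ ⊤ ∧ ∀ f : ℝ → ℝ, Measurable f → MemLp f 2 (road L) →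
      ∃ p : ℝ → ℝ, Measurable p ∧ (∀ x ∉ Ioo 0 L, p x = 0) ∧
        (∀ x ∈ Ioo 0 L, p x = f x + conv p H x) ∧
        eLpNorm p 2 volume ≤ C * eLpNorm f 2 (road L) := by
  obtain ⟨ρ, hρ, hres⟩ := exists_resolvent hL hH
  have hop : IsTraceOp 0 L (memory ρ fun _ => 0) :=
    IsTraceOp.of_memory hρ continuous_const fun x hx => ⟨by simp, hx.1⟩
  obtain ⟨C, hC, hCb⟩ := hop.bound
  refine ⟨1 + C, ENNReal.add_ne_top.2 ⟨ENNReal.one_ne_top, hC⟩, fun f hfm hf => ?_⟩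
  set f' := (Ioo 0 L).indicator f with hf'
  have hfm' : Measurable f' := hfm.indicator measurableSet_Ioo
  have hf2 : MemLp f' 2 volume := (memLp_indicator_iff_restrict measurableSet_Ioo).2 hf
  have hfi : LocInt f' := (IsHistory.of_integral hfm' hf2 0).locInt
  have hcc : Continuous (conv f' ρ) := continuous_conv hfi hρ
  set p := (Ioo 0 L).indicator fun x => f' x + conv f' ρ x with hp
  have hff : f' =ᵐ[road L] f := (ae_restrict_mem measurableSet_Ioo).mono fun x hx =>
    indicator_of_mem hx _
  refine ⟨p, (hfm'.add hcc.measurable).indicator measurableSet_Ioo,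
    fun x hx => indicator_of_notMem hx _, fun x hx => ?_, ?_⟩
  · have h1 := conv_resolvent hH hρ hres hfi (Ioo_subset_Icc_self hx)
    have h2 : conv p H x = conv (fun y => f' y + conv f' ρ y) H x :=
      conv_congr_left hx.1.le fun r hr => by
        rw [hp, indicator_of_mem (s := Ioo 0 L) ⟨hr.1, hr.2.trans hx.2⟩]
    rw [h2, hp, indicator_of_mem hx, h1, hf', indicator_of_mem hx]
  · rw [hp, eLpNorm_indicator_eq_eLpNorm_restrict measurableSet_Ioo, add_mul, one_mul]
    refine (eLpNorm_add_le (hfm'.aestronglyMeasurable) hcc.aestronglyMeasurable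
      (by norm_num)).trans (add_le_add (le_of_eq (eLpNorm_congr_ae hff)) ?_)
    have h1 := hCb f' hfi
    rw [window, neg_zero, eLpNorm_congr_ae hff] at h1
    exact h1

namespace Traffic

variable {P : Traffic} {a : ℝ → ℝ} {φ H : ℝ → ℝ}

/-- The past of the history function is determined by the initial flow profile. -/
lemma exists_past (P : Traffic) : ∃ C : ENNReal, C ≠ ⊤ ∧ ∀ w : ℝ → ℝ, IsH1 P.L w →
    ∃ φ H : ℝ → ℝ, IsHistory φ H ∧ (∀ s ∉ Ioo (-(P.k1 * P.L)) 0, φ s = 0) ∧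
      (∀ x ∈ Icc 0 P.L, P.opW H x = w x) ∧
      eLpNorm φ 2 volume ≤ C * eLpNorm (deriv w) 2 (road P.L) := by
  have hk := P.k1_pos
  have hμ := P.mu_pos
  have hL := P.L_pos.le
  have hμk := P.mu_mul_k1
  have hℓ : P.mu * (P.k1 * P.L) = P.L := by rw [← mul_assoc, hμk, one_mul]
  set D := ENNReal.ofReal |(-P.mu)⁻¹| ^ (1 / (2 : ENNReal)).toReal
  refine ⟨‖-(P.mu * P.mu)‖ₑ * D, ENNReal.mul_ne_top enorm_ne_top
    (ENNReal.rpow_ne_top_of_nonneg (by norm_num) (by simp)), fun w hw => ?_⟩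
  set u : ℝ → ℝ := fun s => deriv w (-(P.mu * s)) with hu
  have hum : Measurable u := (measurable_deriv w).comp (measurable_id.const_mul _).neg
  set φ := (Ioo (-(P.k1 * P.L)) 0).indicator (-(P.mu * P.mu) • u) with hφ
  have hφm : Measurable φ := (hum.const_smul _).indicator measurableSet_Ioo
  have hn : eLpNorm φ 2 volume = ‖-(P.mu * P.mu)‖ₑ * D * eLpNorm (deriv w) 2 (road P.L) := by
    rw [hφ, eLpNorm_indicator_eq_eLpNorm_restrict measurableSet_Ioo, eLpNorm_const_smul, hu,
      eLpNorm_reflect hμ, mul_neg, neg_neg, hℓ, mul_zero, neg_zero, mul_assoc]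
  have hφ2 : MemLp φ 2 volume := by
    refine ⟨hφm.aestronglyMeasurable, ?_⟩
    rw [hn]
    exact ENNReal.mul_lt_top (ENNReal.mul_lt_top enorm_lt_top
      (ENNReal.rpow_lt_top_of_nonneg (by norm_num) (by simp))) hw.2.2
  have hh := IsHistory.of_integral hφm hφ2 (P.mu * w 0)
  refine ⟨φ, _, hh, fun s hs => indicator_of_notMem hs _, fun x hx => ?_, hn.le⟩
  have h0 : P.opW (fun t => P.mu * w 0 + ∫ r in (0 : ℝ)..t, φ r) 0 = w 0 := by
    simp only [opW, mul_zero, neg_zero, intervalIntegral.integral_same, add_zero]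
    rw [← mul_assoc, mul_comm P.k1, hμk, one_mul]
  have h1 : ∫ y in (0 : ℝ)..x, -P.k1 * P.opW φ y = ∫ y in (0 : ℝ)..x, deriv w y := by
    rw [intervalIntegral.integral_of_le hx.1, intervalIntegral.integral_of_le hx.1,
      integral_Ioc_eq_integral_Ioo, integral_Ioc_eq_integral_Ioo]
    refine setIntegral_congr_fun measurableSet_Ioo fun y hy => ?_
    have hm : -(P.k1 * y) ∈ Ioo (-(P.k1 * P.L)) 0 :=
      ⟨neg_lt_neg (mul_lt_mul_of_pos_left (hy.2.trans_le hx.2) hk), by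
        linarith [mul_pos hk hy.1]⟩
    have h2 : -(P.mu * -(P.k1 * y)) = y := by linear_combination y * hμk
    simp only [opW, hφ, indicator_of_mem hm, Pi.smul_apply, smul_eq_mul, hu, h2]
    linear_combination (P.mu * P.k1 + 1) * deriv w y * hμk
  rw [opW_density hh, h0, h1, ← hw.sub_eq_integral hL hx ⟨le_rfl, hL⟩]
  ring

end Traffic

namespace IsHistory

variable {φ H : ℝ → ℝ}

/-- Hölder continuity of primitives of square integrable functions. -/
lemma enorm_sub_le (h : IsHistory φ H) (r s : ℝ) :
    ‖H s - H r‖ₑ ≤ ENNReal.ofReal |s - r| ^ (1 / 2 : ℝ) * eLpNorm φ 2 volume := by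
  have h1 : ‖H s - H r‖ₑ ≤ eLpNorm φ 1 (volume.restrict (uIoc r s)) := by
    rw [h.sub_eq, eLpNorm_one_eq_lintegral_enorm]
    refine le_trans (le_of_eq ?_) (enorm_integral_le_lintegral_enorm _)
    rw [← ofReal_norm, ← ofReal_norm, intervalIntegral.norm_intervalIntegral_eq]
  refine h1.trans ((eLpNorm_le_eLpNorm_mul_rpow_measure_univ (p := 1) (q := 2) (by norm_num)
    h.measurable.aestronglyMeasurable).trans ?_)
  have h2 : (1 / (1 : ENNReal).toReal - 1 / (2 : ENNReal).toReal) = (1 / 2 : ℝ) := by norm_num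
  rw [Measure.restrict_apply_univ, h2, Real.volume_uIoc, mul_comm]
  exact mul_le_mul_right (eLpNorm_mono_measure _ Measure.restrict_le_self) _

lemma enorm_le (h : IsHistory φ H) {R s : ℝ} (hs : |s| ≤ R) :
    ‖H s‖ₑ ≤ ‖H 0‖ₑ + ENNReal.ofReal R ^ (1 / 2 : ℝ) * eLpNorm φ 2 volume := by
  have h1 := h.enorm_sub_le 0 s
  rw [sub_zero] at h1
  calc ‖H s‖ₑ = ‖H 0 + (H s - H 0)‖ₑ := by rw [add_sub_cancel]
    _ ≤ ‖H 0‖ₑ + ‖H s - H 0‖ₑ := enorm_add_le _ _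
    _ ≤ _ := add_le_add le_rfl (h1.trans (by gcongr))

/-- Two histories with the same value at the origin agree up to the time at which their densities
differ. -/
lemma congr_of_le {ψ G : ℝ → ℝ} (h : IsHistory φ H) (h' : IsHistory ψ G) (h0 : H 0 = G 0)
    {X : ℝ} (hX : 0 ≤ X) (he : ∀ s < X, φ s = ψ s) {s : ℝ} (hs : s ≤ X) : H s = G s := by
  have e1 := h.sub_eq 0 s
  have e2 := h'.sub_eq 0 s
  have e3 : ∫ r in (0 : ℝ)..s, φ r = ∫ r in (0 : ℝ)..s, ψ r := by
    refine intervalIntegral.integral_congr_ae ?_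
    have : ∀ᵐ r : ℝ, r ≠ X := by simp [ae_iff]
    filter_upwards [this] with r hr hrm
    exact he r (lt_of_le_of_ne (hrm.2.trans (max_le hX hs)) hr)
  linarith

end IsHistory

lemma memory_eq_conv {K b p : ℝ → ℝ} (hp : ∀ s ≤ 0, p s = 0) {x : ℝ} (hb : b x ≤ 0)
    (hint : ∀ u v, IntervalIntegrable (fun s => p s * K (x - s)) volume u v) :
    memory K b p x = conv p K x := by
  rw [memory, conv, ← intervalIntegral.integral_add_adjacent_intervals (hint (b x) 0) (hint 0 x)]
  have : ∫ s in (b x)..0, p s * K (x - s) = 0 := by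
    refine intervalIntegral.integral_zero_ae (Eventually.of_forall fun s hs => ?_)
    rw [uIoc_of_le hb] at hs
    rw [hp s hs.2, zero_mul]
  rw [this, zero_add]

lemma memory_eq_zero {K b p : ℝ → ℝ} {x : ℝ} (hb : b x ≤ x) (hp : ∀ s ≤ x, p s = 0) :
    memory K b p x = 0 := by
  refine intervalIntegral.integral_zero_ae (Eventually.of_forall fun s hs => ?_)
  rw [uIoc_of_le hb] at hs
  rw [hp s hs.2, zero_mul]

lemma eLpNorm_eq_ofReal_l2 {L : ℝ} {f : ℝ → ℝ} (hf : MemLp f 2 (road L)) :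
    eLpNorm f 2 (road L) = ENNReal.ofReal (l2 L f) := (ENNReal.ofReal_toReal hf.2.ne).symm

namespace Traffic

variable {P : Traffic} {a : ℝ → ℝ} {φ H : ℝ → ℝ}

lemma opV_add (ha : ContinuousOn a (Icc 0 P.L)) {g h : ℝ → ℝ} (hg : LocInt g) (hh : LocInt h)
    (x : ℝ) : P.opV a (fun s => g s + h s) x = P.opV a g x + P.opV a h x := by
  simpa using (isTraceOp_opV ha).comb g h hg hh 1 1 x

/-- On functions that vanish in the past, reading off `v` is the Volterra operator `1 - (A + E) *`. -/
lemma opV_eq_sub_conv (ha : ContinuousOn a (Icc 0 P.L)) {p : ℝ → ℝ} (hi : LocInt p)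
    (hp : ∀ s ≤ 0, p s = 0) {x : ℝ} (hx : 0 ≤ x) :
    P.opV a p x = p x - conv p (P.kerH a) x := by
  have hA := isPC_kerA ha
  have hE := IsPC.of_continuous (continuous_kerE (P := P))
  have hb := mul_nonneg P.k1_pos.le P.L_pos.le
  have hbx := mul_nonneg P.k1_pos.le hx
  have iA := fun u v => hA.intervalIntegrable_mul_sub (hi u v) x
  have iE := fun u v => hE.intervalIntegrable_mul_sub (hi u v) x
  rw [opV, memA, memE, memory_eq_conv hp (by linarith) iA, memory_eq_conv hp (by linarith) iE,
    conv, conv, conv, ← intervalIntegral.integral_add (iA _ _) (iE _ _)]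
  simp only [kerH, mul_add]

/-- Reading off `v` at `x` uses only the history up to `x`. -/
lemma opV_eq_zero {p : ℝ → ℝ} {x : ℝ} (hx : 0 ≤ x) (hp : ∀ s ≤ x, p s = 0) :
    P.opV a p x = 0 := by
  have hb := mul_nonneg P.k1_pos.le P.L_pos.le
  have hbx := mul_nonneg P.k1_pos.le hx
  rw [opV, memA, memE, memory_eq_zero (by linarith) hp, memory_eq_zero (by linarith) hp,
    hp x le_rfl]
  simp

lemma measurable_opV (ha : ContinuousOn a (Icc 0 P.L)) {p : ℝ → ℝ} (hi : LocInt p)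
    (hp : Measurable p) : Measurable (P.opV a p) :=
  hp.sub (((continuous_memory (isPC_kerA ha) continuous_const hi).add
    (continuous_memory (IsPC.of_continuous continuous_kerE) (by fun_prop) hi)).measurable)

/-- Every compatible initial state is read off from a history function, which may be continued
arbitrarily beyond `L`, here by exponential decay. -/
lemma exists_history (ha : ContinuousOn a (Icc 0 P.L)) {κ : ℝ} (hκ : 0 < κ) :
    ∃ C : ENNReal, C ≠ ⊤ ∧ ∀ v w : ℝ → ℝ, IsH1 P.L v → IsH1 P.L w → P.InletCondition a v w →
      ∃ φ H : ℝ → ℝ, IsHistory φ H ∧ EqOn (P.opV a H) v (Icc 0 P.L) ∧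
        EqOn (P.opW H) w (Icc 0 P.L) ∧
        (∀ s, P.L < s → φ s = -κ * H P.L * Real.exp (-κ * (s - P.L))) ∧
        (∀ s, P.L ≤ s → H s = H P.L * Real.exp (-κ * (s - P.L))) ∧
        eLpNorm φ 2 volume ≤ C * ENNReal.ofReal (h1Norm P.L v w) ∧
        ∀ s, |s| ≤ P.k1 * P.L + P.L → ‖H s‖ₑ ≤ C * ENNReal.ofReal (h1Norm P.L v w) := by
  have hL := P.L_pos
  have hk := P.k1_pos
  have hμ := P.mu_pos
  have hℓ : 0 < P.k1 * P.L := mul_pos hk hL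
  obtain ⟨C₁, hC₁, hpast⟩ := exists_past P
  obtain ⟨C₂, hC₂, hvolt⟩ := exists_volterra_l2 hL.le (isPC_kerH ha)
  obtain ⟨C₃, hC₃, hV⟩ := (isTraceOp_opV ha).bound
  have hcc : Continuous fun y => 1 / P.vs * P.mu * P.c y := by
    have := P.continuous_c; fun_prop
  obtain ⟨C₄, -, hcw⟩ := exists_eLpNorm_mul_le (L := P.L) hcc
  have hg2 := memLp_exp_tail hκ P.L
  -- `g` is the shape of the tail; the constants bound, in order, the Sobolev factor, the data and the
  -- density of the Volterra equation, the value at the outlet, and the complete density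
  set g := (Ioi P.L).indicator fun s => Real.exp (-κ * (s - P.L)) with hg
  set S := P.mu * (Real.sqrt P.L / P.L + Real.sqrt P.L) with hS
  set Cf : ENNReal := 1 + C₃ * C₁ + ENNReal.ofReal C₄ with hCf
  set Cp : ENNReal := C₁ + C₂ * Cf with hCp
  set Rt : ENNReal := ENNReal.ofReal (P.k1 * P.L + P.L) ^ (1 / 2 : ℝ) with hRt
  set CH : ENNReal := ENNReal.ofReal S + Rt * Cp with hCH
  set Cφ : ENNReal := Cp + ‖-κ‖ₑ * CH * eLpNorm g 2 volume with hCφ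
  have hRtop : Rt ≠ ⊤ := ENNReal.rpow_ne_top_of_nonneg (by norm_num) ENNReal.ofReal_ne_top
  have hCf' : Cf ≠ ⊤ := by
    simp only [hCf, Ne, ENNReal.add_eq_top, ENNReal.one_ne_top, ENNReal.ofReal_ne_top, or_false,
      false_or]
    exact ENNReal.mul_ne_top hC₃ hC₁
  have hCp' : Cp ≠ ⊤ := ENNReal.add_ne_top.2 ⟨hC₁, ENNReal.mul_ne_top hC₂ hCf'⟩
  have hCH' : CH ≠ ⊤ := ENNReal.add_ne_top.2
    ⟨ENNReal.ofReal_ne_top, ENNReal.mul_ne_top hRtop hCp'⟩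
  have hCφ' : Cφ ≠ ⊤ := ENNReal.add_ne_top.2
    ⟨hCp', ENNReal.mul_ne_top (ENNReal.mul_ne_top enorm_ne_top hCH') hg2.2.ne⟩
  set CT : ENNReal := ENNReal.ofReal S + Rt * Cφ with hCT
  refine ⟨Cφ + CT, ENNReal.add_ne_top.2 ⟨hCφ', ENNReal.add_ne_top.2
    ⟨ENNReal.ofReal_ne_top, ENNReal.mul_ne_top hRtop hCφ'⟩⟩, fun v w hv hw hin => ?_⟩
  set N := ENNReal.ofReal (h1Norm P.L v w) with hN
  obtain ⟨n1, n2, n3, n4⟩ := l2_le_h1Norm hL.le hv hw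
  obtain ⟨φ₀, H₀, hh₀, hφ₀, hw₀, hn₀⟩ := hpast w hw
  have hn₀' : eLpNorm φ₀ 2 volume ≤ C₁ * N := by
    refine hn₀.trans ?_
    rw [eLpNorm_eq_ofReal_l2 hw.2]
    gcongr
    exact ENNReal.ofReal_le_ofReal n4
  -- the value at the origin is controlled by the Sobolev inequality
  have hH₀ : H₀ 0 = P.mu * w 0 := by
    have h1 := hw₀ 0 ⟨le_rfl, hL.le⟩
    rw [opW, mul_zero, neg_zero] at h1
    rw [← h1, ← mul_assoc, mu_mul_k1, one_mul]
  have hH₀n : ‖H₀ 0‖ₑ ≤ ENNReal.ofReal S * N := by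
    rw [hH₀, ← ofReal_norm, hN, ← ENNReal.ofReal_mul (by positivity)]
    refine ENNReal.ofReal_le_ofReal ?_
    rw [Real.norm_eq_abs, abs_mul, abs_of_pos hμ, hS, mul_assoc]
    refine mul_le_mul_of_nonneg_left ((hw.abs_le hL ⟨le_rfl, hL.le⟩).trans ?_) hμ.le
    rw [add_mul]
    gcongr
  -- the part of the history on the road solves a Volterra equation
  set f := fun y => deriv v y - P.opV a φ₀ y + 1 / P.vs * P.c y * H₀ (-(P.k1 * y)) with hf
  have hfm : Measurable f := by
    have h1 : Continuous fun y => 1 / P.vs * P.c y * H₀ (-(P.k1 * y)) := by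
      have := P.continuous_c
      have := hh₀.continuous
      fun_prop
    exact ((measurable_deriv v).sub (measurable_opV ha hh₀.locInt hh₀.measurable)).add h1.measurable
  have hfn : eLpNorm f 2 (road P.L) ≤ Cf * N := by
    have e1 : f =ᵐ[road P.L] ((deriv v - P.opV a φ₀) + fun y => 1 / P.vs * P.mu * P.c y * w y) := by
      refine (ae_restrict_mem measurableSet_Ioo).mono fun y hy => ?_
      have h1 := hw₀ y (Ioo_subset_Icc_self hy)
      have h2 := P.mu_mul_k1
      rw [opW] at h1
      simp only [hf, Pi.add_apply, Pi.sub_apply, ← h1]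
      linear_combination -(1 / P.vs * P.c y * H₀ (-(P.k1 * y))) * h2
    have m1 : AEStronglyMeasurable (P.opV a φ₀) (road P.L) :=
      (measurable_opV ha hh₀.locInt hh₀.measurable).aestronglyMeasurable
    have m2 : AEStronglyMeasurable (fun y => 1 / P.vs * P.mu * P.c y * w y) (road P.L) :=
      (continuous_mul_memLp hcc (hw.memLp hL.le)).aestronglyMeasurable
    have b1 : eLpNorm (deriv v) 2 (road P.L) ≤ N := by
      rw [eLpNorm_eq_ofReal_l2 hv.2]; exact ENNReal.ofReal_le_ofReal n2
    have b2 : eLpNorm (P.opV a φ₀) 2 (road P.L) ≤ C₃ * C₁ * N := by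
      refine (hV φ₀ hh₀.locInt).trans ?_
      rw [mul_assoc]
      gcongr
      exact (eLpNorm_mono_measure _ Measure.restrict_le_self).trans hn₀'
    have b3 : eLpNorm (fun y => 1 / P.vs * P.mu * P.c y * w y) 2 (road P.L) ≤
        ENNReal.ofReal C₄ * N := by
      refine (hcw w).trans ?_
      gcongr
      rw [eLpNorm_eq_ofReal_l2 (hw.memLp hL.le)]; exact ENNReal.ofReal_le_ofReal n3
    rw [eLpNorm_congr_ae e1, hCf, add_mul, add_mul, one_mul]
    exact (eLpNorm_add_le (hv.2.aestronglyMeasurable.sub m1) m2 (by norm_num)).trans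
      (add_le_add ((eLpNorm_sub_le hv.2.aestronglyMeasurable m1 (by norm_num)).trans
        (add_le_add b1 b2)) b3)
  have hf2 : MemLp f 2 (road P.L) := ⟨hfm.aestronglyMeasurable,
    hfn.trans_lt (ENNReal.mul_lt_top hCf'.lt_top ENNReal.ofReal_lt_top)⟩
  obtain ⟨p, hpm, hp0, hpe, hpn⟩ := hvolt f hfm hf2
  have hpn' : eLpNorm p 2 volume ≤ C₂ * Cf * N := by
    refine hpn.trans ?_
    rw [mul_assoc]
    gcongr
  have hp2 : MemLp p 2 volume := ⟨hpm.aestronglyMeasurable, hpn'.trans_lt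
    (ENNReal.mul_lt_top (ENNReal.mul_lt_top hC₂.lt_top hCf'.lt_top) ENNReal.ofReal_lt_top)⟩
  have hpi : LocInt p := (IsHistory.of_integral hpm hp2 0).locInt
  have hφ₁2 : MemLp (fun s => φ₀ s + p s) 2 volume := hh₀.memLp.add hp2
  have hφ₁m : Measurable fun s => φ₀ s + p s := hh₀.measurable.add hpm
  have hh₁ := IsHistory.of_integral hφ₁m hφ₁2 (H₀ 0)
  set H₁ := fun t => H₀ 0 + ∫ r in (0 : ℝ)..t, (φ₀ r + p r) with hH₁
  have hH₁0 : H₁ 0 = H₀ 0 := by simp [hH₁]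
  have hφ₁n : eLpNorm (fun s => φ₀ s + p s) 2 volume ≤ Cp * N := by
    rw [hCp, add_mul]
    exact (eLpNorm_add_le hh₀.memLp.1 hp2.1 (by norm_num)).trans (add_le_add hn₀' hpn')
  have hH₁n : ‖H₁ P.L‖ₑ ≤ CH * N := by
    have h1 := hh₁.enorm_le (R := P.k1 * P.L + P.L) (s := P.L)
      (by rw [abs_of_pos hL]; linarith)
    refine h1.trans ?_
    rw [hCH, add_mul, mul_assoc]
    refine add_le_add (by rw [hH₁0]; exact hH₀n) ?_
    gcongr
  -- the continuation beyond the road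
  have hgm : Measurable g := by
    have hc : Continuous fun s => Real.exp (-κ * (s - P.L)) := by fun_prop
    exact hc.measurable.indicator measurableSet_Ioi
  set q := fun s => -κ * H₁ P.L * g s with hq
  have hqm : Measurable q := hgm.const_mul _
  have hq2 : MemLp q 2 volume := hg2.const_mul _
  have hqi : LocInt q := (IsHistory.of_integral hqm hq2 0).locInt
  have hq0 : ∀ s ≤ P.L, q s = 0 := fun s hs => by
    simp only [hq, hg]
    rw [indicator_of_notMem (by simpa using hs), mul_zero]
  have hqn : eLpNorm q 2 volume ≤ ‖-κ‖ₑ * CH * eLpNorm g 2 volume * N := by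
    have e1 : q = (-κ * H₁ P.L) • g := rfl
    rw [e1, eLpNorm_const_smul, enorm_mul]
    calc ‖-κ‖ₑ * ‖H₁ P.L‖ₑ * eLpNorm g 2 volume
        ≤ ‖-κ‖ₑ * (CH * N) * eLpNorm g 2 volume := by gcongr
      _ = _ := by ring
  have hφ2 : MemLp (fun s => φ₀ s + p s + q s) 2 volume := hφ₁2.add hq2
  have hφm : Measurable fun s => φ₀ s + p s + q s := hφ₁m.add hqm
  have hh := IsHistory.of_integral hφm hφ2 (H₀ 0)
  set H := fun t => H₀ 0 + ∫ r in (0 : ℝ)..t, (φ₀ r + p r + q r) with hH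
  have hH0 : H 0 = H₀ 0 := by simp [hH]
  have hφn : eLpNorm (fun s => φ₀ s + p s + q s) 2 volume ≤ Cφ * N := by
    rw [hCφ, add_mul]
    exact (eLpNorm_add_le hφ₁2.1 hq2.1 (by norm_num)).trans (add_le_add hφ₁n hqn)
  have hHL : H P.L = H₁ P.L := hh.congr_of_le hh₁ (by rw [hH0, hH₁0]) hL.le
    (fun s hs => by simp only [hq0 s hs.le, add_zero]) le_rfl
  have hHneg : ∀ s ≤ 0, H s = H₀ s := fun s hs => hh.congr_of_le hh₀ hH0 le_rfl
    (fun r hr => by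
      rw [hq0 r (by linarith), hp0 r (fun h => by linarith [h.1]), add_zero, add_zero]) hs
  have htail : ∀ s, P.L < s → φ₀ s + p s + q s = -κ * H P.L * Real.exp (-κ * (s - P.L)) := by
    intro s hs
    rw [hφ₀ s (fun h => by linarith [h.2]), hp0 s (fun h => by linarith [h.2]), hHL]
    simp only [hq, hg, zero_add]
    rw [indicator_of_mem (s := Ioi P.L) hs]
  have hwH : EqOn (P.opW H) w (Icc 0 P.L) := fun x hx => by
    rw [← hw₀ x hx, opW, opW, hHneg _ (by linarith [mul_nonneg hk.le hx.1])]
  refine ⟨_, H, hh, fun x hx => ?_, hwH, htail, fun s hs => ?_, ?_, fun s hs => ?_⟩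
  · have h0 : P.opV a H 0 = v 0 := by
      have h1 := inletCondition_op (P := P) (a := a) H
      rw [InletCondition] at h1 hin
      have h2 : ∫ y in (0 : ℝ)..P.L, a y * P.opW H y = ∫ y in (0 : ℝ)..P.L, a y * w y := by
        refine intervalIntegral.integral_congr fun y hy => ?_
        rw [uIcc_of_le hL.le] at hy
        simp only [hwH hy]
      rw [h2, hwH ⟨le_rfl, hL.le⟩] at h1
      exact mul_left_cancel₀ hk.ne' (by linarith)
    have h1 : ∫ y in (0 : ℝ)..x, (P.opV a (fun s => φ₀ s + p s + q s) y +
        -(1 / P.vs) * P.c y * H (-(P.k1 * y))) = ∫ y in (0 : ℝ)..x, deriv v y := by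
      rw [intervalIntegral.integral_of_le hx.1, intervalIntegral.integral_of_le hx.1,
        integral_Ioc_eq_integral_Ioo, integral_Ioc_eq_integral_Ioo]
      refine setIntegral_congr_fun measurableSet_Ioo fun y hy => ?_
      have hy' : y ∈ Ioo 0 P.L := ⟨hy.1, hy.2.trans_le hx.2⟩
      have h2 := hpe y hy'
      have h3 : P.opV a (fun s => φ₀ s + p s + q s) y = P.opV a φ₀ y + P.opV a p y + P.opV a q y := by
        rw [opV_add ha (fun u v => (hh₀.locInt u v).add (hpi u v)) hqi, opV_add ha hh₀.locInt hpi]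
      simp only [h3]
      rw [opV_eq_zero hy.1.le fun s hs => hq0 s (hs.trans hy'.2.le),
        opV_eq_sub_conv ha hpi (fun s hs => hp0 s fun h => by linarith [h.1]) hy.1.le,
        hHneg _ (by linarith [mul_nonneg hk.le hy.1.le]), h2]
      simp only [hf]
      ring
    rw [opV_density ha hh hx.1, h0, h1, ← hv.sub_eq_integral hL.le hx ⟨le_rfl, hL.le⟩]
    ring
  · have h1 := hh.sub_eq P.L s
    have h2 : ∫ r in P.L..s, (φ₀ r + p r + q r) =
        ∫ r in P.L..s, -κ * H P.L * Real.exp (-κ * (r - P.L)) := by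
      rw [intervalIntegral.integral_of_le hs, intervalIntegral.integral_of_le hs]
      exact setIntegral_congr_fun measurableSet_Ioc fun r hr => htail r hr.1
    have h3 : ∀ r, HasDerivAt (fun r => H P.L * Real.exp (-κ * (r - P.L)))
        (-κ * H P.L * Real.exp (-κ * (r - P.L))) r := fun r => by
      have := ((((hasDerivAt_id r).sub_const P.L).const_mul (-κ)).exp).const_mul (H P.L)
      refine this.congr_deriv ?_
      simp only [id]; ring
    have h4 := intervalIntegral.integral_eq_sub_of_hasDerivAt (a := P.L) (b := s)
      (fun r _ => h3 r) (by apply Continuous.intervalIntegrable; fun_prop)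
    rw [h2, h4, sub_self, mul_zero, Real.exp_zero] at h1
    linarith
  · refine hφn.trans ?_
    gcongr
    exact le_self_add
  · have h1 := hh.enorm_le hs
    refine h1.trans ?_
    rw [add_mul]
    refine le_trans ?_ le_add_self
    rw [hCT, add_mul, mul_assoc]
    refine add_le_add (by rw [hH0]; exact hH₀n) ?_
    gcongr

end Traffic

/-! ### Closed-loop solutions with a given initial state -/

lemma l2_le_of_eLpNorm_le {L r : ℝ} {f : ℝ → ℝ} {A : ENNReal} (hA : A ≠ ⊤) (hr : 0 ≤ r)
    (h : eLpNorm f 2 (road L) ≤ A * ENNReal.ofReal r) : l2 L f ≤ A.toReal * r := by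
  have := ENNReal.toReal_mono (ENNReal.mul_ne_top hA ENNReal.ofReal_ne_top) h
  rwa [ENNReal.toReal_mul, ENNReal.toReal_ofReal hr] at this

namespace Traffic

variable {P : Traffic} {a : ℝ → ℝ} {K : Kernels} {φ H : ℝ → ℝ}

/-- Existence of a global closed-loop solution that decays at the rate of the dynamic extension. -/
lemma exists_isClosedLoop (ha : ContinuousOn a (Icc 0 P.L)) (hK : P.IsKernels a K) {k3 : ℝ}
    (hk3 : 0 < k3) :
    ∃ C : ℝ, 0 < C ∧ ∀ v₀ w₀ : ℝ → ℝ, IsH1 P.L v₀ → IsH1 P.L w₀ → P.InletCondition a v₀ w₀ →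
      ∃ (v w : ℝ → ℝ → ℝ) (α : ℝ → ℝ), (∀ T, P.IsClosedLoop a K k3 T v w α) ∧
        EqOn (v 0) v₀ (Icc 0 P.L) ∧ EqOn (w 0) w₀ (Icc 0 P.L) ∧
        ∀ t, 0 ≤ t → h1Norm P.L (v t) (w t) ≤ C * Real.exp (-k3 * t) * h1Norm P.L v₀ w₀ := by
  have hL := P.L_pos
  have hlam := P.lam_pos
  have hk := P.k1_pos
  set ℓ := P.k1 * P.L with hℓ
  have hℓ0 : 0 < ℓ := mul_pos hk hL
  set κ := k3 / P.lam with hκ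
  have hκ0 : 0 < κ := div_pos hk3 hlam
  have hκlam : κ * P.lam = k3 := div_mul_cancel₀ _ hlam.ne'
  obtain ⟨C, hC, hist⟩ := exists_history ha hκ0
  obtain ⟨CV, hCV, hV⟩ := (isTraceOp_opV ha).bound
  obtain ⟨CW, hCW, hW⟩ := (isTraceOp_opW (P := P)).bound
  have hQop : IsTraceOp (P.k1 * P.L) P.L fun g x => -(1 / P.vs) * P.c x * g (-(P.k1 * x)) := by
    have := P.continuous_c
    exact (IsTraceOp.of_reflect hL.le hk).mul (r := fun x => -(1 / P.vs) * P.c x) (by fun_prop)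
  obtain ⟨CQ, hCQ, hQ⟩ := hQop.bound
  -- `B` bounds the history on the moving window, `BH` and `Bφ` its `L²` norm and that of its density
  set B : ENNReal := C * ENNReal.ofReal (Real.exp (κ * (ℓ + P.L))) with hB
  have hB' : B ≠ ⊤ := ENNReal.mul_ne_top hC ENNReal.ofReal_ne_top
  set W : ENNReal := window ℓ P.L Set.univ ^ (2 : ENNReal).toReal⁻¹ with hWdef
  have hW' : W ≠ ⊤ := ENNReal.rpow_ne_top_of_nonneg (by norm_num) (by simp)
  set BH : ENNReal := B * W with hBH
  set Bφ : ENNReal := B + ‖-κ‖ₑ * B * W with hBφ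
  have hBH' : BH ≠ ⊤ := ENNReal.mul_ne_top hB' hW'
  have hBφ' : Bφ ≠ ⊤ := ENNReal.add_ne_top.2
    ⟨hB', ENNReal.mul_ne_top (ENNReal.mul_ne_top enorm_ne_top hB') hW'⟩
  have f1 : CV * BH ≠ ⊤ := ENNReal.mul_ne_top hCV hBH'
  have f2 : CV * Bφ + CQ * BH ≠ ⊤ := ENNReal.add_ne_top.2
    ⟨ENNReal.mul_ne_top hCV hBφ', ENNReal.mul_ne_top hCQ hBH'⟩
  have f3 : CW * BH ≠ ⊤ := ENNReal.mul_ne_top hCW hBH'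
  have f4 : ‖-P.k1‖ₑ * (CW * Bφ) ≠ ⊤ :=
    ENNReal.mul_ne_top enorm_ne_top (ENNReal.mul_ne_top hCW hBφ')
  set A : ℝ := (CV * BH).toReal + (CV * Bφ + CQ * BH).toReal +
    ((CW * BH).toReal + (‖-P.k1‖ₑ * (CW * Bφ)).toReal) with hA
  have hA0 : 0 ≤ A := by positivity
  refine ⟨A + 1, by linarith, fun v₀ w₀ hv₀ hw₀ hin => ?_⟩
  obtain ⟨φ, H, hh, hHv, hHw, hφt, hHt, hφn, hHn⟩ := hist v₀ w₀ hv₀ hw₀ hin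
  set n := h1Norm P.L v₀ w₀ with hn
  have hn0 : 0 ≤ n := h1Norm_nonneg _ _ _
  refine ⟨fun t => P.opV a fun s => H (P.lam * t + s), fun t => P.opW fun s => H (P.lam * t + s),
    fun t => H P.L * Real.exp (-k3 * t), fun T => ?_, ?_, ?_, fun t ht => ?_⟩
  · refine isClosedLoop_op ha hK hh (fun t ht => ?_) fun t _ => ?_
    · rw [hHt _ (by linarith [mul_nonneg hlam.le ht.1])]
      congr 2
      rw [← hκlam]; ring
    · have := (((hasDerivAt_id t).const_mul (-k3)).exp).const_mul (H P.L)
      refine (this.congr_deriv ?_).hasDerivWithinAt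
      simp only [id]; ring
  · simpa using hHv
  · simpa using hHw
  set r := Real.exp (-k3 * t) * n with hr
  have hr0 : 0 ≤ r := mul_nonneg (Real.exp_pos _).le hn0
  have hlt := mul_nonneg hlam.le ht
  -- on the window at time `t`, the exponential factor has decayed by at least `exp (-k₃ t)`
  have hexp : ∀ {y z : ℝ}, z - κ * (ℓ + P.L) ≤ -k3 * t → y ≤ Real.exp z →
      y ≤ Real.exp (κ * (ℓ + P.L)) * Real.exp (-k3 * t) := fun hz hy => by
    rw [← Real.exp_add]
    exact hy.trans (Real.exp_le_exp.2 (by linarith))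
  have hone : P.lam * t ≤ ℓ + P.L → C * ENNReal.ofReal n ≤ B * ENNReal.ofReal r := fun h => by
    rw [hB, hr, mul_assoc, ← ENNReal.ofReal_mul (Real.exp_pos _).le, ← mul_assoc]
    refine mul_le_mul_right (ENNReal.ofReal_le_ofReal ?_) _
    refine le_mul_of_one_le_left hn0 (hexp (z := 0) ?_ (by simp))
    have := mul_le_mul_of_nonneg_left h hκ0.le
    rw [← mul_assoc, hκlam] at this
    linarith
  have hHL : ‖H P.L‖ₑ ≤ C * ENNReal.ofReal n :=
    hHn _ (by rw [abs_of_pos hL]; linarith)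
  have hpt : ∀ s ∈ Ioo (-ℓ) P.L, ‖H (P.lam * t + s)‖ₑ ≤ B * ENNReal.ofReal r := by
    intro s hs
    rcases le_or_gt (P.lam * t + s) P.L with h | h
    · refine (hHn _ (abs_le.2 ⟨by linarith [hs.1], by linarith⟩)).trans (hone (by linarith [hs.1]))
    · rw [hHt _ h.le, enorm_mul, hB, hr, mul_assoc, ← ENNReal.ofReal_mul (Real.exp_pos _).le,
        ← mul_assoc, mul_comm (Real.exp _ * Real.exp _), ENNReal.ofReal_mul hn0, ← mul_assoc,
        Real.enorm_of_nonneg (Real.exp_pos _).le]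
      refine mul_le_mul' hHL (ENNReal.ofReal_le_ofReal (hexp ?_ le_rfl))
      have := mul_le_mul_of_nonneg_left hs.1.le hκ0.le
      rw [← hκlam]
      linarith
  have hHw' : eLpNorm (fun s => H (P.lam * t + s)) 2 (window ℓ P.L) ≤ BH * ENNReal.ofReal r := by
    refine (eLpNorm_le_of_ae_enorm_bound ((ae_restrict_mem measurableSet_Ioo).mono hpt)).trans ?_
    rw [smul_eq_mul, hBH, mul_right_comm]
  have hφw : eLpNorm (fun s => φ (P.lam * t + s)) 2 (window ℓ P.L) ≤ Bφ * ENNReal.ofReal r := by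
    rw [hBφ, add_mul]
    rcases le_or_gt (P.lam * t) (ℓ + P.L) with h | h
    · refine le_trans ?_ le_self_add
      refine le_trans ?_ (hφn.trans (hone h))
      refine (eLpNorm_mono_measure _ Measure.restrict_le_self).trans (le_of_eq ?_)
      exact eLpNorm_comp_measurePreserving hh.memLp.1 (measurePreserving_add_left volume _)
    · refine le_trans ?_ le_add_self
      have hpt' : ∀ᵐ s ∂(window ℓ P.L), ‖φ (P.lam * t + s)‖ₑ ≤ ‖-κ‖ₑ * (B * ENNReal.ofReal r) := by
        refine (ae_restrict_mem measurableSet_Ioo).mono fun s hs => ?_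
        have h1 : P.L < P.lam * t + s := by linarith [hs.1]
        rw [hφt _ h1, mul_assoc, ← hHt _ h1.le, enorm_mul]
        exact mul_le_mul_right (hpt s hs) _
      refine (eLpNorm_le_of_ae_enorm_bound hpt').trans (le_of_eq ?_)
      rw [smul_eq_mul, ← hWdef]; ring
  have lH := hh.locInt_primitive.shift (P.lam * t)
  have lφ := hh.locInt.shift (P.lam * t)
  obtain ⟨⟨hV1, -⟩, hW1, -⟩ := history_isEvolution ha hh
  have g1 : l2 P.L (P.opV a fun s => H (P.lam * t + s)) ≤ (CV * BH).toReal * r :=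
    l2_le_of_eLpNorm_le f1 hr0 ((hV _ lH).trans (by rw [mul_assoc]; gcongr))
  have g2 : l2 P.L (deriv (P.opV a fun s => H (P.lam * t + s))) ≤
      (CV * Bφ + CQ * BH).toReal * r := by
    refine l2_le_of_eLpNorm_le f2 hr0 ?_
    rw [eLpNorm_congr_ae (hV1 _).2, add_mul, mul_assoc, mul_assoc]
    refine (eLpNorm_add_le ((isTraceOp_opV ha).meas _ lφ) (hQop.meas _ lH) (by norm_num)).trans
      (add_le_add ((hV _ lφ).trans ?_) ((hQ _ lH).trans ?_)) <;> gcongr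
  have g3 : l2 P.L (P.opW fun s => H (P.lam * t + s)) ≤ (CW * BH).toReal * r :=
    l2_le_of_eLpNorm_le f3 hr0 ((hW _ lH).trans (by rw [mul_assoc]; gcongr))
  have g4 : l2 P.L (deriv (P.opW fun s => H (P.lam * t + s))) ≤
      (‖-P.k1‖ₑ * (CW * Bφ)).toReal * r := by
    refine l2_le_of_eLpNorm_le f4 hr0 ?_
    have e : (fun y => -P.k1 * P.opW (fun s => φ (P.lam * t + s)) y) =
        (-P.k1) • P.opW (fun s => φ (P.lam * t + s)) := rfl
    rw [eLpNorm_congr_ae (hW1 _).2, e, eLpNorm_const_smul, mul_assoc, mul_assoc]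
    gcongr
    exact (hW _ lφ).trans (by gcongr)
  refine (h1Norm_le hL.le (hV1 _).1 (hW1 _).1).trans ?_
  calc _ ≤ A * r := by rw [hA]; linarith
    _ ≤ (A + 1) * r := by linarith
    _ = _ := by rw [hr]; ring

end Traffic

/-! ### Uniqueness by an energy estimate -/

/-- The energy of an evolution is differentiable in time. -/
lemma IsEvolution.hasDerivWithinAt_l2_sq {L : ℝ} {T : EReal} {f F : ℝ → ℝ → ℝ} (hL : 0 ≤ L)
    (hf : IsEvolution L T f F) {t : ℝ} (ht : t ∈ timeInterval T) (hF : MemLp (F t) 2 (road L)) :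
    HasDerivWithinAt (fun s => l2 L (f s) ^ 2) (2 * ∫ x in (0 : ℝ)..L, f t x * F t x)
      (timeInterval T) t := by
  set I := timeInterval T with hI
  have hm : ∀ s ∈ I, MemLp (f s) 2 (road L) := fun s hs => (hf.mem s hs).memLp hL
  have hsub : ∀ s ∈ I, MemLp (fun x => f s x - f t x) 2 (road L) := fun s hs =>
    (hm s hs).sub (hm t ht)
  have hq : ∀ s ∈ I, MemLp (fun x => (s - t)⁻¹ * (f s x - f t x) - F t x) 2 (road L) :=
    fun s hs => ((hsub s hs).const_mul _).sub hF
  rw [hasDerivWithinAt_iff_tendsto_slope]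
  have hmono : 𝓝[I \ {t}] t ≤ 𝓝[I] t := nhdsWithin_mono _ sdiff_subset
  have hmem : ∀ᶠ s in 𝓝[I \ {t}] t, s ∈ I \ {t} := self_mem_nhdsWithin
  have h1 : Tendsto (fun s => l2 L fun x => f s x - f t x) (𝓝[I \ {t}] t) (𝓝 0) := by
    have := ((tendsto_h1Norm_zero_iff hL (l := 𝓝[I] t) (u := fun s x => f s x - f t x)
      (by filter_upwards [self_mem_nhdsWithin] with s hs
          exact ((hf.mem s hs).sub hL (hf.mem t ht)).1)).1 (hf.continuous t ht)).1
    exact this.mono_left hmono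
  have h2 : Tendsto (fun s => l2 L fun x => (s - t)⁻¹ * (f s x - f t x) - F t x)
      (𝓝[I \ {t}] t) (𝓝 0) :=
    (ENNReal.tendsto_toReal ENNReal.zero_ne_top).comp (hf.deriv_eq t ht)
  have hb : Tendsto (fun s => (l2 L fun x => (s - t)⁻¹ * (f s x - f t x) - F t x) *
      ((l2 L fun x => f s x - f t x) + 2 * l2 L (f t)) + l2 L (F t) *
      l2 L fun x => f s x - f t x) (𝓝[I \ {t}] t) (𝓝 0) := by
    have := (h2.mul (h1.add_const (2 * l2 L (f t)))).add (h1.const_mul (l2 L (F t)))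
    simpa using this
  rw [tendsto_iff_norm_sub_tendsto_zero]
  refine squeeze_zero' (Eventually.of_forall fun _ => norm_nonneg _) ?_ hb
  filter_upwards [hmem] with s hs
  have hst : s - t ≠ 0 := sub_ne_zero.2 hs.2
  have hsum : MemLp (fun x => (f s x - f t x) + 2 * f t x) 2 (road L) :=
    (hsub s hs.1).add ((hm t ht).const_mul 2)
  have i1 := (intervalIntegrable_iff_road hL _).2 ((hq s hs.1).integrable_mul hsum)
  have i2 := (intervalIntegrable_iff_road hL _).2 (hF.integrable_mul (hsub s hs.1))
  have i3 := (intervalIntegrable_iff_road hL _).2 ((hm t ht).integrable_mul hF)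
  have j1 := (intervalIntegrable_iff_road hL _).2 ((hm s hs.1).integrable_sq)
  have j2 := (intervalIntegrable_iff_road hL _).2 ((hm t ht).integrable_sq)
  simp only [Pi.mul_def] at i1 i2 i3
  have e : slope (fun s => l2 L (f s) ^ 2) t s - 2 * ∫ x in (0 : ℝ)..L, f t x * F t x =
      (∫ x in (0 : ℝ)..L, ((s - t)⁻¹ * (f s x - f t x) - F t x) *
        ((f s x - f t x) + 2 * f t x)) + ∫ x in (0 : ℝ)..L, F t x * (f s x - f t x) := by
    rw [slope_def_field, l2_sq hL (hm s hs.1), l2_sq hL (hm t ht), ← intervalIntegral.integral_sub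
      j1 j2, ← intervalIntegral.integral_const_mul, div_eq_inv_mul,
      ← intervalIntegral.integral_const_mul, ← intervalIntegral.integral_sub
      ((j1.sub j2).const_mul _) (i3.const_mul _), ← intervalIntegral.integral_add i1 i2]
    refine intervalIntegral.integral_congr fun x _ => ?_
    ring
  rw [e, Real.norm_eq_abs]
  refine (abs_add_le _ _).trans (add_le_add ((abs_integral_mul_le_l2 hL (hq s hs.1) hsum).trans
    (mul_le_mul_of_nonneg_left ?_ (l2_nonneg _ _))) (abs_integral_mul_le_l2 hL hF (hsub s hs.1)))
  refine (l2_add_le (hsub s hs.1) ((hm t ht).const_mul 2)).trans (add_le_add le_rfl (le_of_eq ?_))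
  have e2 : (fun x => 2 * f t x) = (2 : ℝ) • f t := rfl
  rw [l2, e2, eLpNorm_const_smul, ENNReal.toReal_mul, l2]
  simp

lemma ordConnected_timeInterval (T : EReal) : OrdConnected (timeInterval T) :=
  ⟨fun _ hx _ hy _ hz => ⟨hx.1.trans hz.1,
    lt_of_le_of_lt (EReal.coe_le_coe_iff.2 hz.2) hy.2⟩⟩

/-- A differential inequality `E' ≤ C E` forces `E` to stay nonpositive. -/
lemma nonpos_of_hasDerivWithinAt_le {T : EReal} {E E' : ℝ → ℝ} {C : ℝ}
    (hd : ∀ t ∈ timeInterval T, HasDerivWithinAt E (E' t) (timeInterval T) t)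
    (hle : ∀ t ∈ timeInterval T, E' t ≤ C * E t) (h0 : E 0 ≤ 0) {t : ℝ}
    (ht : t ∈ timeInterval T) : E t ≤ 0 := by
  have h0m : (0 : ℝ) ∈ timeInterval T :=
    ⟨le_rfl, lt_of_le_of_lt (EReal.coe_le_coe_iff.2 ht.1) ht.2⟩
  have hsub : Icc 0 t ⊆ timeInterval T := (ordConnected_timeInterval T).out h0m ht
  have hd2 : ∀ s ∈ timeInterval T, HasDerivWithinAt (fun s => Real.exp (-C * s) * E s)
      (Real.exp (-C * s) * (E' s - C * E s)) (timeInterval T) s := fun s hs => by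
    have h1 := (((hasDerivAt_id s).const_mul (-C)).exp).hasDerivWithinAt (s := timeInterval T)
    refine (h1.mul (hd s hs)).congr_deriv ?_
    simp only [id]; ring
  have hanti : AntitoneOn (fun s => Real.exp (-C * s) * E s) (Icc 0 t) := by
    refine antitoneOn_of_hasDerivWithinAt_nonpos (convex_Icc 0 t)
      (f' := fun s => Real.exp (-C * s) * (E' s - C * E s))
      (fun s hs => ((hd2 s (hsub hs)).mono hsub).continuousWithinAt) (fun s hs => ?_) fun s hs => ?_
    · exact (hd2 s (hsub (interior_subset hs))).mono (interior_subset.trans hsub)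
    · exact mul_nonpos_of_nonneg_of_nonpos (Real.exp_pos _).le
        (sub_nonpos.2 (hle s (hsub (interior_subset hs))))
  have h1 := hanti ⟨le_rfl, ht.1⟩ ⟨ht.1, le_rfl⟩ ht.1
  simp only [mul_zero, Real.exp_zero, one_mul] at h1
  by_contra! h2
  linarith [mul_pos (Real.exp_pos (-C * t)) h2]

/-- Continuous functions with vanishing `L²` norm vanish. -/
lemma IsH1.eqOn_zero_of_l2_le {L : ℝ} (hL : 0 < L) {f : ℝ → ℝ} (hf : IsH1 L f) (h : l2 L f ≤ 0) :
    EqOn f 0 (Icc 0 L) := by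
  have h0 : eLpNorm f 2 (road L) = 0 := by
    have := le_antisymm h (l2_nonneg _ _)
    rw [l2, ENNReal.toReal_eq_zero_iff] at this
    exact this.resolve_right (hf.memLp hL.le).2.ne
  rw [eLpNorm_eq_zero_iff (hf.memLp hL.le).1 (by norm_num), road, restrict_Ioo_eq_restrict_Icc] at h0
  exact Measure.eqOn_Icc_of_ae_eq _ hL.ne h0 (hf.continuousOn hL.le) continuousOn_const

namespace Traffic

variable {P : Traffic} {a : ℝ → ℝ} {K : Kernels} {T : EReal}

/-- The part of the feedback law that is linear in the state and bounded in `L²`. -/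
def feedback (P : Traffic) (a : ℝ → ℝ) (K : Kernels) (v w : ℝ → ℝ) : ℝ :=
  (∫ y in (0 : ℝ)..P.L, P.gainV K y * v y) + (∫ y in (0 : ℝ)..P.L, P.gainW a K y * w y)
    - ∫ y in (min (P.mu * P.L) P.L)..P.L, P.k1⁻¹ * a y * w (y - P.mu * P.L)

lemma ramp_eq (α : ℝ) (v w : ℝ → ℝ) :
    P.ramp a K α v w = α - P.k2 * w P.L + P.feedback a K v w := by
  rw [ramp, feedback]; ring

lemma mapsTo_delay : MapsTo (fun y => y - P.mu * P.L) (Ioc (min (P.mu * P.L) P.L) P.L)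
    (Icc 0 P.L) := fun y hy => by
  have h1 := mul_nonneg P.mu_pos.le P.L_pos.le
  refine ⟨?_, by linarith [hy.2]⟩
  rcases min_lt_iff.1 hy.1 with h | h
  · linarith
  · exact absurd hy.2 (not_le.2 h)

lemma intervalIntegrable_delay (ha : ContinuousOn a (Icc 0 P.L)) {w : ℝ → ℝ}
    (hw : ContinuousOn w (Icc 0 P.L)) :
    IntervalIntegrable (fun y => P.k1⁻¹ * a y * w (y - P.mu * P.L)) volume
      (min (P.mu * P.L) P.L) P.L := by
  have h1 := mul_nonneg P.mu_pos.le P.L_pos.le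
  rw [intervalIntegrable_iff, uIoc_of_le (min_le_right _ _)]
  obtain ⟨A, hA⟩ := isCompact_Icc.exists_bound_of_continuousOn ha
  obtain ⟨B, hB⟩ := isCompact_Icc.exists_bound_of_continuousOn hw
  have hsub : Ioc (min (P.mu * P.L) P.L) P.L ⊆ Icc 0 P.L := fun y hy =>
    ⟨(le_min h1 P.L_pos.le).trans hy.1.le, hy.2⟩
  have hm : AEStronglyMeasurable (fun y => P.k1⁻¹ * a y * w (y - P.mu * P.L))
      (volume.restrict (Ioc (min (P.mu * P.L) P.L) P.L)) := by
    refine ContinuousOn.aestronglyMeasurable ?_ measurableSet_Ioc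
    exact (continuousOn_const.mul (ha.mono hsub)).mul
      (hw.comp (by fun_prop) mapsTo_delay)
  refine Integrable.of_bound hm (P.k1⁻¹ * A * B) ?_
  refine (ae_restrict_mem measurableSet_Ioc).mono fun y hy => ?_
  rw [norm_mul, norm_mul, Real.norm_of_nonneg (inv_nonneg.2 P.k1_pos.le)]
  have h2 := hA y (hsub hy)
  have h3 := hB _ (mapsTo_delay hy)
  have h4 := inv_nonneg.2 P.k1_pos.le
  exact mul_le_mul (mul_le_mul_of_nonneg_left h2 h4) h3 (norm_nonneg _)
    (mul_nonneg h4 ((norm_nonneg _).trans h2))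

lemma feedback_sub (ha : ContinuousOn a (Icc 0 P.L)) (hK : P.IsKernels a K) {v w v' w' : ℝ → ℝ}
    (hv : ContinuousOn v (Icc 0 P.L)) (hw : ContinuousOn w (Icc 0 P.L))
    (hv' : ContinuousOn v' (Icc 0 P.L)) (hw' : ContinuousOn w' (Icc 0 P.L)) :
    P.feedback a K (fun x => v x - v' x) (fun x => w x - w' x) =
      P.feedback a K v w - P.feedback a K v' w' := by
  have hL := P.L_pos.le
  have iV : ∀ {u : ℝ → ℝ}, ContinuousOn u (Icc 0 P.L) →
      IntervalIntegrable (fun y => P.gainV K y * u y) volume 0 P.L := fun hu =>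
    (intervalIntegrable_iff_road hL _).2 ((hK.memLp_gainV ha).integrable_mul hu.memLp_road)
  have iW : ∀ {u : ℝ → ℝ}, ContinuousOn u (Icc 0 P.L) →
      IntervalIntegrable (fun y => P.gainW a K y * u y) volume 0 P.L := fun hu =>
    (intervalIntegrable_iff_road hL _).2 ((hK.memLp_gainW ha).integrable_mul hu.memLp_road)
  simp only [feedback, mul_sub]
  rw [intervalIntegral.integral_sub (iV hv) (iV hv'), intervalIntegral.integral_sub (iW hw) (iW hw'),
    intervalIntegral.integral_sub (intervalIntegrable_delay ha hw)
      (intervalIntegrable_delay ha hw')]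
  ring

/-- The feedback is bounded in `L²`; the point value of `w` at the outlet cancels in the closed
loop. -/
lemma exists_abs_feedback_le (ha : ContinuousOn a (Icc 0 P.L)) (hK : P.IsKernels a K) :
    ∃ C : ℝ, 0 ≤ C ∧ ∀ v w : ℝ → ℝ, ContinuousOn v (Icc 0 P.L) → ContinuousOn w (Icc 0 P.L) →
      |P.feedback a K v w| ≤ C * (l2 P.L v + l2 P.L w) := by
  have hL := P.L_pos.le
  have hμL := mul_nonneg P.mu_pos.le hL
  have hk := inv_nonneg.2 P.k1_pos.le
  obtain ⟨A, hA⟩ := isCompact_Icc.exists_bound_of_continuousOn ha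
  have hA0 : 0 ≤ A := (norm_nonneg _).trans (hA 0 ⟨le_rfl, hL⟩)
  set G₁ := l2 P.L (P.gainV K)
  set G₂ := l2 P.L (P.gainW a K)
  set D := P.k1⁻¹ * A * Real.sqrt P.L
  have hG₁ : 0 ≤ G₁ := l2_nonneg _ _
  have hG₂ : 0 ≤ G₂ := l2_nonneg _ _
  have hD : 0 ≤ D := by positivity
  refine ⟨G₁ + G₂ + D, by positivity, fun v w hv hw => ?_⟩
  have b1 := abs_integral_mul_le_l2 hL (hK.memLp_gainV ha) hv.memLp_road
  have b2 := abs_integral_mul_le_l2 hL (hK.memLp_gainW ha) hw.memLp_road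
  have b3 : |∫ y in (min (P.mu * P.L) P.L)..P.L, P.k1⁻¹ * a y * w (y - P.mu * P.L)| ≤
      D * l2 P.L w := by
    have hwi : IntegrableOn (fun y => |w y|) (Icc 0 P.L) :=
      hw.abs.integrableOn_Icc
    have hwi' : Integrable ((Icc 0 P.L).indicator fun y => |w y|) :=
      (integrable_indicator_iff measurableSet_Icc).2 hwi
    have c1 : |∫ y in (min (P.mu * P.L) P.L)..P.L, P.k1⁻¹ * a y * w (y - P.mu * P.L)| ≤
        ∫ y in Ioc (min (P.mu * P.L) P.L) P.L,
          P.k1⁻¹ * A * (Icc 0 P.L).indicator (fun y => |w y|) (y - P.mu * P.L) := by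
      rw [intervalIntegral.integral_of_le (min_le_right _ _), ← Real.norm_eq_abs]
      refine norm_integral_le_of_norm_le
        ((hwi'.comp_sub_right (P.mu * P.L)).const_mul _).integrableOn ?_
      refine (ae_restrict_mem measurableSet_Ioc).mono fun y hy => ?_
      rw [indicator_of_mem (mapsTo_delay hy), norm_mul, norm_mul, Real.norm_of_nonneg hk]
      refine mul_le_mul_of_nonneg_right (mul_le_mul_of_nonneg_left (hA y ⟨?_, hy.2⟩) hk)
        (abs_nonneg _)
      exact (le_min hμL hL).trans hy.1.le
    have c2 : ∫ y in Ioc (min (P.mu * P.L) P.L) P.L,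
        P.k1⁻¹ * A * (Icc 0 P.L).indicator (fun y => |w y|) (y - P.mu * P.L) ≤
        P.k1⁻¹ * A * ∫ y, |w y| ∂(road P.L) := by
      refine (setIntegral_le_integral ((hwi'.comp_sub_right (P.mu * P.L)).const_mul _)
        (Eventually.of_forall fun y => ?_)).trans (le_of_eq ?_)
      · exact mul_nonneg (mul_nonneg hk hA0) (indicator_nonneg (fun _ _ => abs_nonneg _) _)
      · rw [integral_const_mul, integral_sub_right_eq_self
          ((Icc 0 P.L).indicator fun y => |w y|), integral_indicator measurableSet_Icc,
          integral_Icc_eq_integral_Ioo]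
    refine c1.trans (c2.trans ?_)
    have := integral_abs_le_l2 hL hw.memLp_road
    calc _ ≤ P.k1⁻¹ * A * (Real.sqrt P.L * l2 P.L w) := by gcongr
      _ = _ := by ring
  have hv0 := l2_nonneg P.L v
  have hw0 := l2_nonneg P.L w
  rw [feedback]
  refine (abs_sub _ _).trans ((add_le_add (abs_add_le _ _) le_rfl).trans
    ((add_le_add (add_le_add b1 b2) b3).trans ?_))
  nlinarith [mul_nonneg hG₁ hw0, mul_nonneg hG₂ hv0, mul_nonneg hD hv0]

/-- Twice the integral of `f f'` is the increment of `f²`. -/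
lemma _root_.IsH1.two_mul_integral_mul_deriv {L : ℝ} {f : ℝ → ℝ} (hf : IsH1 L f) :
    2 * ∫ x in (0 : ℝ)..L, f x * deriv f x = f L ^ 2 - f 0 ^ 2 := by
  have h := hf.1.integral_deriv_mul_eq_sub hf.1
  rw [← intervalIntegral.integral_const_mul, sq, sq, ← h]
  exact intervalIntegral.integral_congr fun x _ => by ring

/-- The energy estimate: a solution of the homogeneous closed loop that starts from rest stays at
rest. The weight of `w` in the energy makes the reflection at the inlet dissipative. -/
lemma eqOn_zero_of_homogeneous (ha : ContinuousOn a (Icc 0 P.L)) (hK : P.IsKernels a K)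
    {v w : ℝ → ℝ → ℝ} (hs : P.RiemannSystem T v w)
    (hin : ∀ t ∈ timeInterval T, P.InletCondition a (v t) (w t))
    (hout : ∀ t ∈ timeInterval T, v t P.L = P.feedback a K (v t) (w t))
    (hv0 : EqOn (v 0) 0 (Icc 0 P.L)) (hw0 : EqOn (w 0) 0 (Icc 0 P.L)) {t : ℝ}
    (ht : t ∈ timeInterval T) :
    EqOn (v t) 0 (Icc 0 P.L) ∧ EqOn (w t) 0 (Icc 0 P.L) := by
  have hL := P.L_pos
  have hk := P.k1_pos
  have hlam := P.lam_pos
  have hvs := P.vs_pos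
  obtain ⟨hsw, hsv⟩ := hs
  obtain ⟨C, hC, hfb⟩ := exists_abs_feedback_le ha hK
  obtain ⟨D, hD, hc⟩ := exists_l2_mul_le (L := P.L) P.continuous_c
  set A := l2 P.L a with hA
  have hA0 : 0 ≤ A := l2_nonneg _ _
  -- the weight for which twice the squared reflection `k₁ v(0)` at the inlet is absorbed by the outflow
  -- `λ v(0)²` of the energy of `v`
  set δ := (2 * P.k1)⁻¹ with hδ
  have hδ0 : 0 < δ := by positivity
  have hδk : δ * P.vs * (2 * P.k1 ^ 2) = P.lam := by
    rw [hδ, ← k1_mul_vs]; field_simp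
  set E := fun s => l2 P.L (v s) ^ 2 + δ * l2 P.L (w s) ^ 2 with hE
  set E' := fun s => 2 * (∫ x in (0 : ℝ)..P.L, v s x * (P.lam * deriv (v s) x + P.c x * w s x)) +
    δ * (2 * ∫ x in (0 : ℝ)..P.L, w s x * (-P.vs * deriv (w s) x)) with hE'
  have hd : ∀ s ∈ timeInterval T, HasDerivWithinAt E (E' s) (timeInterval T) s := fun s hs =>
    (hsv.hasDerivWithinAt_l2_sq hL.le hs ((((hsv.mem s hs).2.const_mul _)).add
      (continuous_mul_memLp P.continuous_c ((hsw.mem s hs).memLp hL.le)))).add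
    ((hsw.hasDerivWithinAt_l2_sq hL.le hs ((hsw.mem s hs).2.const_mul _)).const_mul δ)
  have hle : ∀ s ∈ timeInterval T, E' s ≤ (2 * P.lam * C ^ 2 + D + (2 * P.lam * C ^ 2 + D +
      2 * δ * P.vs * A ^ 2) / δ) * E s := by
    intro s hs
    have hv1 := hsv.mem s hs
    have hw1 := hsw.mem s hs
    have mv := hv1.memLp hL.le
    have mw := hw1.memLp hL.le
    set V := l2 P.L (v s) with hV
    set W := l2 P.L (w s) with hW
    have hV0 : 0 ≤ V := l2_nonneg _ _
    have hW0 : 0 ≤ W := l2_nonneg _ _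
    -- the transport terms integrate to boundary values
    have e1 : 2 * (∫ x in (0 : ℝ)..P.L, v s x * (P.lam * deriv (v s) x + P.c x * w s x)) =
        P.lam * (v s P.L ^ 2 - v s 0 ^ 2) +
          2 * ∫ x in (0 : ℝ)..P.L, v s x * (P.c x * w s x) := by
      have i1 := (intervalIntegrable_iff_road hL.le _).2 (mv.integrable_mul hv1.2)
      have i2 := (intervalIntegrable_iff_road hL.le _).2
        (mv.integrable_mul (continuous_mul_memLp P.continuous_c mw))
      simp only [Pi.mul_def] at i1 i2
      rw [← hv1.two_mul_integral_mul_deriv]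
      have : ∫ x in (0 : ℝ)..P.L, v s x * (P.lam * deriv (v s) x + P.c x * w s x) =
          P.lam * (∫ x in (0 : ℝ)..P.L, v s x * deriv (v s) x) +
            ∫ x in (0 : ℝ)..P.L, v s x * (P.c x * w s x) := by
        rw [← intervalIntegral.integral_const_mul, ← intervalIntegral.integral_add
          (i1.const_mul _) i2]
        exact intervalIntegral.integral_congr fun x _ => by ring
      rw [this]; ring
    have e2 : 2 * ∫ x in (0 : ℝ)..P.L, w s x * (-P.vs * deriv (w s) x) =
        -P.vs * (w s P.L ^ 2 - w s 0 ^ 2) := by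
      have : ∫ x in (0 : ℝ)..P.L, w s x * (-P.vs * deriv (w s) x) =
          -P.vs * ∫ x in (0 : ℝ)..P.L, w s x * deriv (w s) x := by
        rw [← intervalIntegral.integral_const_mul]
        exact intervalIntegral.integral_congr fun x _ => by ring
      rw [← hw1.two_mul_integral_mul_deriv, this]
      ring
    have b1 : |∫ x in (0 : ℝ)..P.L, v s x * (P.c x * w s x)| ≤ V * (D * W) :=
      (abs_integral_mul_le_l2 hL.le mv (continuous_mul_memLp P.continuous_c mw)).trans
        (mul_le_mul_of_nonneg_left (hc _ mw) hV0)
    have b2 : |v s P.L| ≤ C * (V + W) := by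
      rw [hout s hs]; exact hfb _ _ (hv1.continuousOn hL.le) (hw1.continuousOn hL.le)
    have b3 : |∫ y in (0 : ℝ)..P.L, a y * w s y| ≤ A * W :=
      abs_integral_mul_le_l2 hL.le ha.memLp_road mw
    have h0 := hin s hs
    rw [InletCondition] at h0
    set J := ∫ y in (0 : ℝ)..P.L, a y * w s y
    have q2 : v s P.L ^ 2 ≤ C ^ 2 * (V + W) ^ 2 := by
      rw [← mul_pow, ← sq_abs]; exact pow_le_pow_left₀ (abs_nonneg _) b2 2
    have q3 : J ^ 2 ≤ A ^ 2 * W ^ 2 := by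
      rw [← mul_pow, ← sq_abs]; exact pow_le_pow_left₀ (abs_nonneg _) b3 2
    have q4 : w s 0 ^ 2 ≤ 2 * P.k1 ^ 2 * v s 0 ^ 2 + 2 * J ^ 2 := by
      rw [h0]; linarith [sq_nonneg (P.k1 * v s 0 - J)]
    have q5 : (V + W) ^ 2 ≤ 2 * (V ^ 2 + W ^ 2) := by linarith [sq_nonneg (V - W)]
    have q6 : 2 * (V * (D * W)) ≤ D * (V ^ 2 + W ^ 2) := by
      have := mul_nonneg hD (sq_nonneg (V - W)); linarith
    have r1 : P.lam * v s P.L ^ 2 ≤ 2 * P.lam * C ^ 2 * (V ^ 2 + W ^ 2) := by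
      calc P.lam * v s P.L ^ 2 ≤ P.lam * (C ^ 2 * (2 * (V ^ 2 + W ^ 2))) := by
            refine mul_le_mul_of_nonneg_left (q2.trans ?_) hlam.le
            exact mul_le_mul_of_nonneg_left q5 (sq_nonneg C)
        _ = _ := by ring
    have r2 : δ * P.vs * w s 0 ^ 2 ≤ P.lam * v s 0 ^ 2 + 2 * δ * P.vs * A ^ 2 * W ^ 2 := by
      calc δ * P.vs * w s 0 ^ 2 ≤ δ * P.vs * (2 * P.k1 ^ 2 * v s 0 ^ 2 + 2 * (A ^ 2 * W ^ 2)) := by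
            refine mul_le_mul_of_nonneg_left (q4.trans ?_) (by positivity)
            linarith
        _ = δ * P.vs * (2 * P.k1 ^ 2) * v s 0 ^ 2 + 2 * δ * P.vs * A ^ 2 * W ^ 2 := by ring
        _ = _ := by rw [hδk]
    have r3 : 0 ≤ δ * P.vs * w s P.L ^ 2 := by positivity
    have r4 : 2 * ∫ x in (0 : ℝ)..P.L, v s x * (P.c x * w s x) ≤ D * (V ^ 2 + W ^ 2) := by
      linarith [le_abs_self (∫ x in (0 : ℝ)..P.L, v s x * (P.c x * w s x))]
    have hfin : E' s ≤ (2 * P.lam * C ^ 2 + D) * (V ^ 2 + W ^ 2) +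
        2 * δ * P.vs * A ^ 2 * W ^ 2 := by
      simp only [hE', e1, e2]; linarith
    refine hfin.trans ?_
    simp only [hE]
    have s1 : (2 * P.lam * C ^ 2 + D + 2 * δ * P.vs * A ^ 2) / δ * (δ * W ^ 2) =
        (2 * P.lam * C ^ 2 + D + 2 * δ * P.vs * A ^ 2) * W ^ 2 := by field_simp
    have s2 : 0 ≤ (2 * P.lam * C ^ 2 + D) * (δ * W ^ 2) := by positivity
    have s3 : 0 ≤ (2 * P.lam * C ^ 2 + D + 2 * δ * P.vs * A ^ 2) / δ * V ^ 2 := by positivity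
    linarith
  have hE0 : E 0 ≤ 0 := by
    have z : ∀ {f : ℝ → ℝ}, EqOn f 0 (Icc 0 P.L) → l2 P.L f = 0 := fun {f} hf => by
      have : f =ᵐ[road P.L] 0 := (ae_restrict_mem measurableSet_Ioo).mono fun x hx =>
        hf (Ioo_subset_Icc_self hx)
      rw [l2_congr this, l2]; simp
    simp only [hE, z hv0, z hw0]; simp
  have hEt := nonpos_of_hasDerivWithinAt_le hd hle hE0 ht
  simp only [hE] at hEt
  have n1 := sq_nonneg (l2 P.L (v t))
  have n2 := mul_nonneg hδ0.le (sq_nonneg (l2 P.L (w t)))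
  have z1 : l2 P.L (v t) ^ 2 = 0 := le_antisymm (by linarith) n1
  have z2 : l2 P.L (w t) ^ 2 = 0 :=
    (mul_eq_zero.1 (le_antisymm (by linarith) n2)).resolve_left hδ0.ne'
  exact ⟨(hsv.mem t ht).eqOn_zero_of_l2_le hL (pow_eq_zero_iff (two_ne_zero) |>.1 z1).le,
    (hsw.mem t ht).eqOn_zero_of_l2_le hL (pow_eq_zero_iff (two_ne_zero) |>.1 z2).le⟩

/-- Closed-loop solutions are determined by their initial state. -/
lemma IsClosedLoop.eqOn (ha : ContinuousOn a (Icc 0 P.L)) (hK : P.IsKernels a K) {k3 : ℝ}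
    {v w v' w' : ℝ → ℝ → ℝ} {α α' : ℝ → ℝ} (h : P.IsClosedLoop a K k3 T v w α)
    (h' : P.IsClosedLoop a K k3 T v' w' α') (hv : EqOn (v 0) (v' 0) (Icc 0 P.L))
    (hw : EqOn (w 0) (w' 0) (Icc 0 P.L)) {t : ℝ} (ht : t ∈ timeInterval T) :
    EqOn (v t) (v' t) (Icc 0 P.L) ∧ EqOn (w t) (w' t) (Icc 0 P.L) := by
  have hL := P.L_pos.le
  have h0m : (0 : ℝ) ∈ timeInterval T :=
    ⟨le_rfl, lt_of_le_of_lt (EReal.coe_le_coe_iff.2 ht.1) ht.2⟩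
  have cv : ∀ s ∈ timeInterval T, ContinuousOn (v s) (Icc 0 P.L) := fun s hs =>
    (h.system.2.mem s hs).continuousOn hL
  have cw : ∀ s ∈ timeInterval T, ContinuousOn (w s) (Icc 0 P.L) := fun s hs =>
    (h.system.1.mem s hs).continuousOn hL
  have cv' : ∀ s ∈ timeInterval T, ContinuousOn (v' s) (Icc 0 P.L) := fun s hs =>
    (h'.system.2.mem s hs).continuousOn hL
  have cw' : ∀ s ∈ timeInterval T, ContinuousOn (w' s) (Icc 0 P.L) := fun s hs =>
    (h'.system.1.mem s hs).continuousOn hL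
  have hout : ∀ s ∈ timeInterval T, v s P.L - v' s P.L = (α s - α' s) +
      P.feedback a K (fun x => v s x - v' s x) (fun x => w s x - w' s x) := fun s hs => by
    have h1 := h.outlet s hs
    have h2 := h'.outlet s hs
    rw [ramp_eq] at h1 h2
    rw [feedback_sub ha hK (cv s hs) (cw s hs) (cv' s hs) (cw' s hs)]
    linarith
  -- the dynamic extensions coincide
  have hα0 : α 0 - α' 0 = 0 := by
    have h1 := hout 0 h0m
    have hLm : P.L ∈ Icc 0 P.L := ⟨hL, le_rfl⟩
    have h2 : P.feedback a K (fun x => v 0 x - v' 0 x) (fun x => w 0 x - w' 0 x) = 0 := by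
      have e1 : ∀ y ∈ Icc 0 P.L, v 0 y - v' 0 y = 0 := fun y hy => sub_eq_zero.2 (hv hy)
      have e2 : ∀ y ∈ Icc 0 P.L, w 0 y - w' 0 y = 0 := fun y hy => sub_eq_zero.2 (hw hy)
      rw [feedback, intervalIntegral.integral_zero_ae, intervalIntegral.integral_zero_ae,
        intervalIntegral.integral_zero_ae]
      · simp
      · refine Eventually.of_forall fun y hy => ?_
        rw [uIoc_of_le (min_le_right _ _)] at hy
        rw [e2 _ (mapsTo_delay hy), mul_zero]
      · refine Eventually.of_forall fun y hy => ?_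
        rw [uIoc_of_le hL] at hy
        rw [e2 _ (Ioc_subset_Icc_self hy), mul_zero]
      · refine Eventually.of_forall fun y hy => ?_
        rw [uIoc_of_le hL] at hy
        rw [e1 _ (Ioc_subset_Icc_self hy), mul_zero]
    rw [h2, hv hLm] at h1
    linarith
  have hα : ∀ s ∈ timeInterval T, α s = α' s := by
    intro s hs
    have hd : ∀ r ∈ timeInterval T, HasDerivWithinAt (fun r => (α r - α' r) ^ 2)
        (-(2 * k3) * (α r - α' r) ^ 2) (timeInterval T) r := fun r hr => by
      refine (((h.extension r hr).sub (h'.extension r hr)).pow 2).congr_deriv ?_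
      simp only [Pi.sub_apply]
      push_cast
      ring
    have h1 := nonpos_of_hasDerivWithinAt_le hd (fun _ _ => le_rfl)
      (by simp only [hα0]; norm_num) hs
    have h2 := pow_eq_zero_iff (two_ne_zero) |>.1 (le_antisymm h1 (sq_nonneg (α s - α' s)))
    linarith
  have mW : ∀ {v w : ℝ → ℝ → ℝ}, P.RiemannSystem T v w → ∀ s ∈ timeInterval T,
      MemLp (fun x => -P.vs * deriv (w s) x) 2 (road P.L) := fun h s hs =>
    (h.1.mem s hs).2.const_mul _
  have mV : ∀ {v w : ℝ → ℝ → ℝ}, P.RiemannSystem T v w → ∀ s ∈ timeInterval T,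
      MemLp (fun x => P.lam * deriv (v s) x + P.c x * w s x) 2 (road P.L) := fun h s hs =>
    ((h.2.mem s hs).2.const_mul _).add
      (continuous_mul_memLp P.continuous_c ((h.1.mem s hs).memLp hL))
  have hsys : P.RiemannSystem T (fun s x => v s x - v' s x) (fun s x => w s x - w' s x) := by
    constructor
    · refine (h.system.1.sub hL h'.system.1 (mW h.system) (mW h'.system)).congr fun s hs => ?_
      filter_upwards [((h.system.1.mem s hs).sub hL (h'.system.1.mem s hs)).2] with x hx
      rw [hx]; ring
    · refine (h.system.2.sub hL h'.system.2 (mV h.system) (mV h'.system)).congr fun s hs => ?_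
      filter_upwards [((h.system.2.mem s hs).sub hL (h'.system.2.mem s hs)).2] with x hx
      rw [hx]; ring
  have key := eqOn_zero_of_homogeneous ha hK hsys (fun s hs => ?_)
    (fun s hs => by rw [hout s hs, hα s hs, sub_self, zero_add])
    (fun x hx => sub_eq_zero.2 (hv hx)) (fun x hx => sub_eq_zero.2 (hw hx)) ht
  · exact ⟨fun x hx => sub_eq_zero.1 (key.1 hx), fun x hx => sub_eq_zero.1 (key.2 hx)⟩
  · have h1 := h.inlet s hs
    have h2 := h'.inlet s hs
    rw [InletCondition] at h1 h2 ⊢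
    have i1 : ∀ {u : ℝ → ℝ}, ContinuousOn u (Icc 0 P.L) →
        IntervalIntegrable (fun y => a y * u y) volume 0 P.L := fun hu => by
      refine ContinuousOn.intervalIntegrable ?_
      rw [uIcc_of_le hL]
      exact ha.mul hu
    simp only [mul_sub]
    rw [intervalIntegral.integral_sub (i1 (cw s hs)) (i1 (cw' s hs))]
    linarith

end Traffic

/-! ### Admissible states -/

namespace Traffic

variable {P : Traffic} {v w : ℝ → ℝ}

/-- In terms of `v`, the second summand of the flow rate perturbation has the coefficient `k₁`. -/
lemma flowPert_eq (x : ℝ) :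
    P.flowPert v w x = Real.exp (-(x / (P.τ * P.vs))) * w x + P.k1 * v x := by
  have h := P.gamma_ps
  have h1 := P.gamma_ps_pos.ne'
  have h2 := P.qs_pos.ne'
  have h3 := P.vs_pos.ne'
  rw [flowPert, velPert, k1]
  congr 1
  set G := P.γ * P.ps
  have : P.lam = G - P.vs := by linarith
  rw [this]
  field_simp

/-- Small states satisfy the physical constraints. -/
lemma isAdmissible_of_abs_lt {ε : ℝ} (hv : ∀ x ∈ Icc 0 P.L, |v x| < ε ∧ |w x| < ε)
    (hε : ε ≤ P.epsAdm) : P.IsAdmissible v w := by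
  intro x hx
  obtain ⟨hvx, hwx⟩ := hv x hx
  have hk := P.k1_pos
  have hρ := P.ρm_pos
  have hq := P.qs_pos
  set b := P.γ * P.ps / P.qs with hb
  have hb0 : 0 < b := div_pos P.gamma_ps_pos hq
  have hden : 0 < 1 + P.k1 + (1 + P.ρm) * b := by positivity
  have hε' : ε * (1 + P.k1 + (1 + P.ρm) * b) ≤ P.eps0 := by
    rw [epsAdm, ← hb] at hε
    exact (le_div_iff₀ hden).1 hε
  have hε0 : 0 < ε := (abs_nonneg _).trans_lt hvx
  have hvel : |P.velPert v x| < b * ε := by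
    rw [velPert, abs_mul, abs_of_pos hb0]
    exact mul_lt_mul_of_pos_left hvx hb0
  have hflow : |P.flowPert v w x| < (1 + P.k1) * ε := by
    have he : Real.exp (-(x / (P.τ * P.vs))) ≤ 1 := by
      rw [Real.exp_le_one_iff, neg_nonpos]
      exact div_nonneg hx.1 (mul_pos P.τ_pos P.vs_pos).le
    have h1 : |Real.exp (-(x / (P.τ * P.vs))) * w x| ≤ |w x| := by
      rw [abs_mul, abs_of_pos (Real.exp_pos _)]
      exact mul_le_of_le_one_left (abs_nonneg _) he
    have h2 : |P.k1 * v x| < P.k1 * ε := by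
      rw [abs_mul, abs_of_pos hk]
      exact mul_lt_mul_of_pos_left hvx hk
    rw [flowPert_eq]
    have := abs_add_le (Real.exp (-(x / (P.τ * P.vs))) * w x) (P.k1 * v x)
    linarith
  have p1 := mul_pos hk hε0
  have p2 := mul_pos hb0 hε0
  have p3 := mul_pos hρ p2
  have hsum : (1 + P.k1) * ε + b * ε + P.ρm * (b * ε) ≤ P.eps0 := by
    refine le_trans (le_of_eq ?_) hε'; ring
  obtain ⟨hv1, hv2⟩ := abs_lt.1 hvel
  obtain ⟨hq1, hq2⟩ := abs_lt.1 hflow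
  have hρv : P.ρm * (-(b * ε)) < P.ρm * P.velPert v x := mul_lt_mul_of_pos_left hv1 hρ
  have e1 : P.eps0 ≤ P.ρm * P.vs - P.qs := (min_le_left _ _).trans (min_le_left _ _)
  have e2 : P.eps0 ≤ P.qs := (min_le_left _ _).trans (min_le_right _ _)
  have e3 : P.eps0 ≤ P.vf - P.vs := (min_le_right _ _).trans (min_le_left _ _)
  have e4 : P.eps0 ≤ P.vs := (min_le_right _ _).trans (min_le_right _ _)
  refine ⟨by linarith, by linarith, by linarith, by linarith, by linarith, ?_⟩
  rw [mul_add]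
  linarith

end Traffic

end

theorem mainTheorem1 (P : Traffic) (a : ℝ → ℝ) (ha : ContinuousOn a (Set.Icc 0 P.L))
    (k3 : ℝ) (hk3 : 0 < k3) :
    -- the Riemann system is the linearized model in other coordinates
    (∀ (T : EReal) (v w : ℝ → ℝ → ℝ), P.RiemannSystem T v w ↔
      P.LinearizedARZ T (fun t => P.flowPert (v t) (w t)) (fun t => P.velPert (v t))) ∧
    -- the controller is well defined
    (∃ K : Traffic.Kernels, P.IsKernels a K) ∧
    ∀ K : Traffic.Kernels, P.IsKernels a K →
      ∃ M rate : ℝ, 0 < M ∧ 0 < rate ∧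
        -- exponential stability
        (∀ (T : EReal) (v w : ℝ → ℝ → ℝ) (α : ℝ → ℝ), P.IsClosedLoop a K k3 T v w α →
          ∀ t ∈ timeInterval T,
            h1Norm P.L (v t) (w t) ≤
              M * Real.exp (-rate * t) * h1Norm P.L (v 0) (w 0)) ∧
        -- global existence within the admissible set, for small data
        (∀ ε : ℝ, 0 < ε → ∀ v₀ w₀ : ℝ → ℝ, IsH1 P.L v₀ → IsH1 P.L w₀ →
          P.InletCondition a v₀ w₀ → h1Norm P.L v₀ w₀ < M⁻¹ * ε →
          ∃ (v w : ℝ → ℝ → ℝ) (α : ℝ → ℝ), P.IsClosedLoop a K k3 ⊤ v w α ∧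
            Set.EqOn (v 0) v₀ (Set.Icc 0 P.L) ∧ Set.EqOn (w 0) w₀ (Set.Icc 0 P.L) ∧
            ∀ t : ℝ, 0 ≤ t →
              h1Norm P.L (v t) (w t) < ε ∧
              (∀ x ∈ Set.Icc 0 P.L, |v t x| < ε ∧ |w t x| < ε) ∧
              (ε ≤ P.epsAdm → P.IsAdmissible (v t) (w t))) := by
  refine ⟨fun T v w => P.riemannSystem_iff, Traffic.exists_isKernels ha, fun K hK => ?_⟩
  have hL := P.L_pos
  obtain ⟨C, hC, hex⟩ := Traffic.exists_isClosedLoop ha hK hk3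
  -- the factor `S` bounds the supremum norm by the `H¹` norm
  set S := Real.sqrt P.L / P.L + Real.sqrt P.L + 1 with hS
  have hS1 : 1 ≤ S := by
    have := Real.sqrt_nonneg P.L
    have := div_nonneg this hL.le
    rw [hS]; linarith
  have hM : C ≤ C * S := le_mul_of_one_le_right hC.le hS1
  refine ⟨C * S, k3, by positivity, hk3, fun T v w α h t ht => ?_,
    fun ε hε v₀ w₀ hv₀ hw₀ hin hsmall => ?_⟩
  -- a solution coincides with the decaying one that starts from the same initial state
  · have h0 : (0 : ℝ) ∈ timeInterval T :=
      ⟨le_rfl, lt_of_le_of_lt (EReal.coe_le_coe_iff.2 ht.1) ht.2⟩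
    obtain ⟨v', w', α', hcl, hv, hw, hdec⟩ := hex (v 0) (w 0) (h.system.2.mem 0 h0)
      (h.system.1.mem 0 h0) (h.inlet 0 h0)
    obtain ⟨ev, ew⟩ := h.eqOn ha hK (hcl T) hv.symm hw.symm ht
    rw [h1Norm_congr hL.le ev ew]
    exact (hdec t ht.1).trans (by have := h1Norm_nonneg P.L (v 0) (w 0); gcongr)
  · obtain ⟨v, w, α, hcl, hv, hw, hdec⟩ := hex v₀ w₀ hv₀ hw₀ hin
    refine ⟨v, w, α, hcl ⊤, hv, hw, fun t ht => ?_⟩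
    have htm : t ∈ timeInterval ⊤ := ⟨ht, EReal.coe_lt_top t⟩
    have hn0 := h1Norm_nonneg P.L v₀ w₀
    have hbound : S * h1Norm P.L (v t) (w t) < ε := by
      have h1 : h1Norm P.L (v t) (w t) ≤ C * h1Norm P.L v₀ w₀ := by
        refine (hdec t ht).trans (mul_le_mul_of_nonneg_right ?_ hn0)
        refine mul_le_of_le_one_right hC.le (Real.exp_le_one_iff.2 ?_)
        linarith [mul_nonneg hk3.le ht]
      have h2 : C * S * h1Norm P.L v₀ w₀ < ε := by
        rw [inv_mul_eq_div, lt_div_iff₀ (by positivity)] at hsmall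
        linarith
      have h3 := mul_le_mul_of_nonneg_left h1 (zero_le_one.trans hS1)
      linarith
    have hN0 := h1Norm_nonneg P.L (v t) (w t)
    have hvH := (hcl ⊤).system.2.mem t htm
    have hwH := (hcl ⊤).system.1.mem t htm
    obtain ⟨n1, n2, n3, n4⟩ := l2_le_h1Norm hL.le hvH hwH
    have hsup : ∀ f : ℝ → ℝ, IsH1 P.L f → l2 P.L f ≤ h1Norm P.L (v t) (w t) →
        l2 P.L (deriv f) ≤ h1Norm P.L (v t) (w t) → ∀ x ∈ Icc 0 P.L, |f x| < ε := by
      intro f hf m1 m2 x hx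
      refine lt_of_le_of_lt (hf.abs_le hL hx) (lt_of_le_of_lt ?_ hbound)
      have s1 := mul_le_mul_of_nonneg_left m1 (div_nonneg (Real.sqrt_nonneg P.L) hL.le)
      have s2 := mul_le_mul_of_nonneg_left m2 (Real.sqrt_nonneg P.L)
      rw [hS, add_mul, add_mul]
      linarith
    have hpt : ∀ x ∈ Icc 0 P.L, |v t x| < ε ∧ |w t x| < ε := fun x hx =>
      ⟨hsup _ hvH n1 n2 x hx, hsup _ hwH n3 n4 x hx⟩
    exact ⟨lt_of_le_of_lt (le_mul_of_one_le_left hN0 hS1) hbound, hpt,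
      fun hε' => Traffic.isAdmissible_of_abs_lt hpt hε'⟩
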